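/- **Data.** Let $\mathcal G$ be an abelian group. *Relative $\mathcal G$-LW data* over $\mathbb C$ consist of: - a symmetric subset $\mathcal X\subset\mathcal G$ ($-\mathcal X=\mathcal X$) that is small ($\mathcal G\not\subset Y+\mathcal X$ for every finite $Y$); elements of $\mathcal G\setminus\mathcal X$ are called generic; - finite sets $I_g$ for generic $g$, and $\mathsf A=\bigsqcup_g I_g$ (write $|j|=g$ for $j\in I_g$) with an involution $*$ such that $I_g^*=I_{-g}$; - multiplicities $\delta_{ijk}\in\mathbb N$ with $\delta_{ijk}=\delta_{jki}=\delta_{k^*j^*i^*}$, and $\delta_{ijk}=0$ unless $|i|+|j|+|k|=0$; - non-zero real, $*$-invariant functions $\mathsf b,\mathsf d,\beta$ on $\mathsf A$ such that, for generic $g_1,g_2,g_1+g_2$ and $j\in I_{g_1+g_2}$, $\mathsf b(j)=\sum_{j_1\in I_{g_1},j_2\in I_{g_2}}\mathsf b(j_1)\mathsf b(j_2)\delta_{j^*j_1j_2}$; - non-zero real numbers $\gamma^n_{i,j,k}$ ($1\le n\le\delta_{ijk}$) with $\gamma^n_{i,j,k}\gamma^n_{k^*,j^*,i^*}\beta(i)\beta(j)\beta(k)=1$;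 - $6j$-symbols $N^{j_1j_2j_3}_{j_4j_5j_6}(^{a_1a_2}_{a_3a_4})\in\mathbb C$, zero unless $1\le a_1\le\delta_{j_1j_2j_3^*}$, $1\le a_2\le\delta_{j_3j_4j_5^*}$, $1\le a_3\le\delta_{j_5j_6^*j_1^*}$, $1\le a_4\le\delta_{j_6j_4^*j_2^*}$, such that $$N^{j_1 j_2 j_3}_{j_4 j_5 j_6}(^{a_1a_2}_{a_3a_4})= N^{j_2 j_3^*j_1^*}_{j_5 j_6j_4}(^{a_1a_3}_{a_4a_2})= N^{j_3 j_4 j_5}_{j_6^* j_1 j_2^*}(^{a_2a_3}_{a_1a_4}),$$ $$\sum_{j,c_1,c_2,c_3}\mathsf d(j) N^{j_1 j_2 j_5}_{j_3 j_6 j}(^{a_1a_2}_{c_1c_2}) N^{j_1 j j_6}_{j_4 j_0 j_7}(^{c_1a_3}_{a_0c_3})N^{j_2 j_3 j}_{j_4 j_7 j_8}(^{c_2c_3}_{a_4a_5})=\sum_{c_4}N^{j_5 j_3 j_6}_{j_4 j_0 j_8}(^{a_2a_3}_{c_4a_5})N^{j_1 j_2 j_5}_{j_8 j_0 j_7}(^{a_1c_4}_{a_0a_4})$$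 whenever $|j_2|+|j_3|$ is generic (the sum is over $j\in I_{|j_2|+|j_3|}$ and the $c_i$ in their ranges), $$\sum_{n,a_3,a_4}\mathsf d(n) N^{i j p}_{l m n}(^{a_1a_2}_{a_3a_4}) N^{k j^{*} i}_{n m l}(^{a'_1a_3}_{a'_2a_4})=\frac{\delta_{k,p}\delta_{a_1,a'_1}\delta_{a_2,a'_2}}{\mathsf d(k)}$$ whenever $|j|+|l|$ is generic, $1\le a_1\le\delta_{ijp^*}$ and $1\le a_2\le\delta_{plm^*}$ (the sum is over $n\in I_{|j|+|l|}$), and $$\overline{N^{j_1 j_2 j_3}_{j_4j_5j_6}(^{a_1a_2}_{a_3a_4})}=N^{j_2^* j_1^* j_3^*}_{j_5j_4j_6}(^{a_1a_2}_{a_4a_3})\,\gamma^{a_1}_{j_1,j_2,j_3^*}\gamma^{a_2}_{j_3,j_4,j_5^*}\gamma^{a_3}_{j_1^*,j_5,j_6^*}\gamma^{a_4}_{j_2^*,j_6,j_4^*}\prod_{i=1}^6\beta(j_i).$$ **State space.** Let $\Sigma$ be a compact connected oriented surface without boundary, triangulated by a finite simplicial complex, and $\Gamma$ the dual trivalent graph,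 with vertex set $\Gamma_0$ (triangles), edge set $\Gamma_1$, and the cyclic order of the edges at each vertex given by the orientation; for each vertex $v$ fix a linear order $e_1,e_2,e_3$ of its edges, oriented towards $v$, inducing that cyclic order. Plaquettes are the components of $\Sigma\setminus\Gamma$. A $\mathcal G$-coloring is a map $\Phi$ from oriented edges of $\Gamma$ to $\mathcal G$ with $\Phi(-e)=-\Phi(e)$ and $\Phi(e_1)+\Phi(e_2)+\Phi(e_3)=0$ at every vertex; it is admissible if all its values are generic. A state $\sigma$ of $\Phi$ assigns to each oriented edge $e$ a label $\sigma(e)\in I_{\Phi(e)}$ with $\sigma(-e)=\sigma(e)^*$ and to each vertex $v$ an integer $0\le\sigma_0(v)\le\delta_{\sigma(e_1)\sigma(e_2)\sigma(e_3)}$. Let $\mathcal H=\mathcal H(\Gamma,\Phi)$ be the finite-dimensional Hilbert space with orthonormal basis the states $|\Gamma,\sigma\rangle$ and inner product $\langle\cdot|\cdot\rangle_+$. Put $$\eta|\Gamma,\sigma\rangle=\frac{\prod_{e\in\Gamma_1}\mathsf d(\sigma(e))}{\prod_{v\in\Gamma_0}\gamma(\sigma(v))\prod_{e\in\Gamma_1}\beta(\sigma(e))}|\Gamma,\sigma\rangle,\qquad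 \langle\psi|\phi\rangle=\langle\psi|\eta^{-1}\phi\rangle_+,$$ where $\gamma(\sigma(v))=\gamma^{\sigma_0(v)}_{\sigma(e_1),\sigma(e_2),\sigma(e_3)}$ if $\sigma_0(v)\ge1$, and $\gamma(\sigma(v))=1$ if $\sigma_0(v)=0$. **Operators.** $Q_v|\Gamma,\sigma\rangle$ is $|\Gamma,\sigma\rangle$ if $\sigma_0(v)\ge1$ and $0$ otherwise. For a plaquette $p$, let its boundary run through the vertices $v_1,\dots,v_n$ (indices mod $n$), in the direction for which the cyclic order at $v_i$ is: edge from $v_{i-1}$, edge to $v_{i+1}$, third edge. Let $j_i$ be the label of the edge from $v_{i-1}$ to $v_i$, $k_i$ the label of the third edge at $v_i$, oriented away from $v_i$, and $C_i=\sigma_0(v_i)$. For a label $s$ of generic degree $g$, $$B_p^s|\Gamma,\sigma\rangle=\sum_{j',A,C'}\prod_{i=1}^n\mathsf d(j_i')\,N^{j_i'\,s\,j_i}_{j_{i+1}^*\,k_i\,j_{i+1}'^*}(^{A_i\,C_i}_{C_i'\,A_{i+1}})\,|\Gamma,\sigma'\rangle\in\mathcal H(\Gamma,\Phi+g.\delta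 p),$$ where $\sigma'$ is $\sigma$ with all $j_i$, $C_i$ replaced by $j_i'$, $C_i'$, and $\Phi+g.\delta p$ is $\Phi$ with $g$ subtracted along the boundary edges in the above direction (and added in the opposite one). Put $B_p^g=\sum_{s\in I_g}\mathsf b(s)B_p^s$ and $B_p=B_p^gB_p^{-g}:\mathcal H(\Gamma,\Phi)\to\mathcal H(\Gamma,\Phi)$ for a generic $g$ for which $\Phi-g.\delta p$ is admissible; such $g$ exist because $\mathcal X$ is small. **Theorem.** For all relative $\mathcal G$-LW data over $\mathbb C$, all triangulated surfaces as above and all admissible colorings $\Phi$, the operators $B_p$ do not depend on the choice of $g$, and the Hamiltonian $$H=\sum_p(1-B_p)+\sum_v(1-Q_v):\mathcal H(\Gamma,\Phi)\to\mathcal H(\Gamma,\Phi)$$ has the following properties. 1. $H$ is Hermitian for the indefinite inner product: $\langle\psi|H\phi\rangle=\langle H\psi|\phi\rangle$. Equivalently it is pseudo-Hermitian for $\langle\cdot|\cdot\rangle_+$: $\eta$ is Hermitian and the adjoint of $H$ is $H^\sharp=\eta^{-1}H\eta$. 2. $H$ is local: each $1-B_p$ acts only on the vertices on the boundary of $p$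 and the edges at these vertices, and each $1-Q_v$ only on $v$ and its edges. (An operator acts only on a set $R$ of vertices and the edges at them if it leaves every state unchanged at the vertices outside $R$ and on the edges at those vertices, and its matrix coefficients depend only on the restrictions of the two states to $R$ and its edges.) $H$ is gapped: distinct points of its spectrum are at distance at least $1$, whatever the data, the surface, the triangulation and the coloring. 3. The spectrum of $H$ is contained in $\mathbb Z_{\ge0}$, and its space of ground states, i.e. the eigenspace $\ker H$ of energy zero, is the joint $+1$-eigenspace of all $B_p$ and $Q_v$. -/

import Mathlib

/-! ### Relative `𝒢`-Levin–Wen data -/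

/-- Relative `G`-LW data over a field `K` with involution `star`.  The set of labels is
`A = ⊔_g I g`; the labels of degree `g` form the finite set `I g`.
`N j₁ j₂ j₃ j₄ j₅ j₆ a₁ a₂ a₃ a₄` is the modified 6j-symbol
`N^{j₁ j₂ j₃}_{j₄ j₅ j₆} (a₁ a₂ ; a₃ a₄)`, and `γ i j k n` is `γ^n_{i,j,k}`. -/
structure LWData (K : Type*) [Field K] [StarRing K] (G : Type*) [AddCommGroup G]
    (A : Type*) where
  /-- the singular degrees: a symmetric and small subset of `G` -/
  X : Set G
  X_symm : ∀ x ∈ X, -x ∈ X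
  X_small : ∀ Y : Finset G, ∃ g : G, ∀ y ∈ Y, ∀ x ∈ X, g ≠ y + x
  /-- the finite set of labels of a given degree -/
  I : G → Finset A
  deg : A → G
  mem_I : ∀ a g, a ∈ I g ↔ deg a = g
  deg_generic : ∀ a, deg a ∉ X
  /-- the involution `*` on labels -/
  dual : A → A
  dual_dual : ∀ a, dual (dual a) = a
  deg_dual : ∀ a, deg (dual a) = -deg a
  /-- the fusion multiplicities, with dihedral symmetry -/
  δ : A → A → A → ℕ
  δ_rot : ∀ i j k, δ i j k = δ j k i
  δ_dual : ∀ i j k, δ i j k = δ (dual k) (dual j) (dual i)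
  δ_deg : ∀ i j k, deg i + deg j + deg k ≠ 0 → δ i j k = 0
  /-- the map `b` -/
  b : A → K
  b_ne_zero : ∀ i, b i ≠ 0
  b_star : ∀ i, star (b i) = b i
  b_dual : ∀ i, b (dual i) = b i
  /-- the modified dimension -/
  d : A → K
  d_ne_zero : ∀ i, d i ≠ 0
  d_star : ∀ i, star (d i) = d i
  d_dual : ∀ i, d (dual i) = d i
  b_fusion : ∀ g₁ g₂ : G, g₁ ∉ X → g₂ ∉ X → g₁ + g₂ ∉ X → ∀ j ∈ I (g₁ + g₂),
    b j = ∑ j₁ ∈ I g₁, ∑ j₂ ∈ I g₂, b j₁ * b j₂ * (δ (dual j) j₁ j₂ : K)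
  /-- the basic data `β` -/
  β : A → K
  β_ne_zero : ∀ i, β i ≠ 0
  β_star : ∀ i, star (β i) = β i
  β_dual : ∀ i, β (dual i) = β i
  /-- the basic data `γ`; only the values with `1 ≤ n ≤ δ i j k` matter -/
  γ : A → A → A → ℕ → K
  γ_ne_zero : ∀ i j k n, 1 ≤ n → n ≤ δ i j k → γ i j k n ≠ 0
  γ_star : ∀ i j k n, 1 ≤ n → n ≤ δ i j k → star (γ i j k n) = γ i j k n
  γ_theta : ∀ i j k n, 1 ≤ n → n ≤ δ i j k →
    γ i j k n * γ (dual k) (dual j) (dual i) n * β i * β j * β k = 1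
  /-- the modified 6j-symbols -/
  N : A → A → A → A → A → A → ℕ → ℕ → ℕ → ℕ → K
  N_zero : ∀ j₁ j₂ j₃ j₄ j₅ j₆ a₁ a₂ a₃ a₄,
    ¬ ((1 ≤ a₁ ∧ a₁ ≤ δ j₁ j₂ (dual j₃)) ∧ (1 ≤ a₂ ∧ a₂ ≤ δ j₃ j₄ (dual j₅)) ∧
      (1 ≤ a₃ ∧ a₃ ≤ δ j₅ (dual j₆) (dual j₁)) ∧
      (1 ≤ a₄ ∧ a₄ ≤ δ j₆ (dual j₄) (dual j₂))) →
    N j₁ j₂ j₃ j₄ j₅ j₆ a₁ a₂ a₃ a₄ = 0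
  /-- tetrahedral symmetry -/
  N_symm₁ : ∀ j₁ j₂ j₃ j₄ j₅ j₆ a₁ a₂ a₃ a₄,
    N j₁ j₂ j₃ j₄ j₅ j₆ a₁ a₂ a₃ a₄
      = N j₂ (dual j₃) (dual j₁) j₅ j₆ j₄ a₁ a₃ a₄ a₂
  N_symm₂ : ∀ j₁ j₂ j₃ j₄ j₅ j₆ a₁ a₂ a₃ a₄,
    N j₁ j₂ j₃ j₄ j₅ j₆ a₁ a₂ a₃ a₄
      = N j₃ j₄ j₅ (dual j₆) j₁ (dual j₂) a₂ a₃ a₁ a₄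
  /-- pentagon identity; the summation label `j` has degree `|j₂| + |j₃|`, which has to be
  generic for labels of this degree to exist -/
  N_pentagon : ∀ j₀ j₁ j₂ j₃ j₄ j₅ j₆ j₇ j₈ a₀ a₁ a₂ a₃ a₄ a₅, deg j₂ + deg j₃ ∉ X →
    ∑ j ∈ I (deg j₂ + deg j₃),
      ∑ c₁ ∈ Finset.Icc 1 (δ j₆ (dual j) (dual j₁)),
      ∑ c₂ ∈ Finset.Icc 1 (δ j (dual j₃) (dual j₂)),
      ∑ c₃ ∈ Finset.Icc 1 (δ j₇ (dual j₄) (dual j)),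
        d j * N j₁ j₂ j₅ j₃ j₆ j a₁ a₂ c₁ c₂ * N j₁ j j₆ j₄ j₀ j₇ c₁ a₃ a₀ c₃
          * N j₂ j₃ j j₄ j₇ j₈ c₂ c₃ a₄ a₅
    = ∑ c₄ ∈ Finset.Icc 1 (δ j₀ (dual j₈) (dual j₅)),
        N j₅ j₃ j₆ j₄ j₀ j₈ a₂ a₃ c₄ a₅ * N j₁ j₂ j₅ j₈ j₀ j₇ a₁ c₄ a₀ a₄
  /-- orthogonality; the summation label `n` has degree `|j| + |l|`, which has to be generic,
  and `a₁`, `a₂` are branching labels in their range -/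
  N_ortho : ∀ i j k l m p a₁ a₂ a₁' a₂', deg j + deg l ∉ X →
    1 ≤ a₁ → a₁ ≤ δ i j (dual p) → 1 ≤ a₂ → a₂ ≤ δ p l (dual m) →
    ∑ n ∈ I (deg j + deg l),
      ∑ a₃ ∈ Finset.Icc 1 (δ m (dual n) (dual i)),
      ∑ a₄ ∈ Finset.Icc 1 (δ n (dual l) (dual j)),
        d n * N i j p l m n a₁ a₂ a₃ a₄ * N k (dual j) i n m l a₁' a₃ a₂' a₄
    = open Classical in if k = p ∧ a₁ = a₁' ∧ a₂ = a₂' then (d k)⁻¹ else 0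
  /-- behaviour under the involution of the field -/
  N_star : ∀ j₁ j₂ j₃ j₄ j₅ j₆ a₁ a₂ a₃ a₄,
    star (N j₁ j₂ j₃ j₄ j₅ j₆ a₁ a₂ a₃ a₄)
      = N (dual j₂) (dual j₁) (dual j₃) j₅ j₄ j₆ a₁ a₂ a₄ a₃
        * γ j₁ j₂ (dual j₃) a₁ * γ j₃ j₄ (dual j₅) a₂
        * γ (dual j₁) j₅ (dual j₆) a₃ * γ (dual j₂) j₆ (dual j₄) a₄
        * (β j₁ * β j₂ * β j₃ * β j₄ * β j₅ * β j₆)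

/-! ### Triangulated surfaces and the dual trivalent graph -/

/-- A triangulation, by a finite simplicial complex with vertex set `V` and set of triangles
`F`, of a compact connected oriented surface without boundary.  The vertices of a triangle
`t` are listed as `vert t 0, vert t 1, vert t 2` in an order compatible with the orientation.
The pair `(t, i) : F × Fin 3` stands for the oriented edge from `vert t i` to
`vert t (i + 1)`, which has the triangle `t` on its positive side.

The dual graph `Γ` has the triangles as vertices and the points of `V` as plaquettes.  The pair
`(t, i)` also stands for the oriented edge of `Γ` that crosses the above edge of the
triangulation and is oriented towards `t`; `opp` reverses the orientation of the edges of
`Γ`.  The three edges of `Γ` at `t`, oriented towards `t`, are `(t, 0), (t, 1), (t, 2)`, in an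
order compatible with the orientation of the surface. -/
structure TriangulatedSurface (V F : Type*) where
  vert : F → Fin 3 → V
  vert_injective : ∀ t, Function.Injective (vert t)
  /-- triangles are determined by their sets of vertices -/
  face_ext : ∀ t t', Set.range (vert t) = Set.range (vert t') → t = t'
  /-- the other triangle at an edge, which induces the opposite orientation on it -/
  opp : F × Fin 3 → F × Fin 3
  vert_opp : ∀ e, vert (opp e).1 (opp e).2 = vert e.1 (e.2 + 1)
  vert_opp_add_one : ∀ e, vert (opp e).1 ((opp e).2 + 1) = vert e.1 e.2
  /-- an oriented edge of the triangulation lies on the positive boundary of one triangle only -/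
  edge_ext : ∀ e e' : F × Fin 3, vert e.1 e.2 = vert e'.1 e'.2 →
    vert e.1 (e.2 + 1) = vert e'.1 (e'.2 + 1) → e = e'
  nonempty : Nonempty V
  vert_surjective : ∀ v, ∃ e : F × Fin 3, vert e.1 e.2 = v
  /-- the link of every point is a single cycle: turning around a point reaches every edge
  that starts there -/
  link_connected : ∀ e e' : F × Fin 3, vert e.1 e.2 = vert e'.1 e'.2 →
    ∃ n : ℕ, (fun x : F × Fin 3 => opp (x.1, x.2 + 2))^[n] e = e'
  connected : ∀ u w : V, Relation.ReflTransGen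
    (fun x y => ∃ e : F × Fin 3, vert e.1 e.2 = x ∧ vert e.1 (e.2 + 1) = y) u w

namespace TriangulatedSurface

variable {V F : Type*} (S : TriangulatedSurface V F)

/-- The initial point of an oriented edge of the triangulation.  The dual edge crossing it
turns positively around this point. -/
def src (e : F × Fin 3) : V := S.vert e.1 e.2

/-- The final point of an oriented edge of the triangulation. -/
def tgt (e : F × Fin 3) : V := S.vert e.1 (e.2 + 1)

/-- The next edge with the same initial point, turning positively around that point. -/
def next (e : F × Fin 3) : F × Fin 3 := S.opp (e.1, e.2 + 2)

theorem src_opp (e : F × Fin 3) : S.src (S.opp e) = S.tgt e := S.vert_opp e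

theorem tgt_opp (e : F × Fin 3) : S.tgt (S.opp e) = S.src e := S.vert_opp_add_one e

theorem opp_opp (e : F × Fin 3) : S.opp (S.opp e) = e :=
  S.edge_ext _ _ ((S.src_opp (S.opp e)).trans (S.tgt_opp e))
    ((S.tgt_opp (S.opp e)).trans (S.src_opp e))

/-- Two oriented edges of `Γ` with the same underlying unoriented edge. -/
def edgeSetoid : Setoid (F × Fin 3) where
  r e e' := e' = e ∨ e' = S.opp e
  iseqv :=
    { refl := fun _ => Or.inl rfl
      symm := by
        rintro e e' (h | h)
        · exact Or.inl h.symm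
        · exact Or.inr (by rw [h, S.opp_opp])
      trans := by
        rintro a b c (h | h) (h' | h')
        · exact Or.inl (by rw [h', h])
        · exact Or.inr (by rw [h', h])
        · exact Or.inr (by rw [h', h])
        · exact Or.inl (by rw [h', h, S.opp_opp]) }

/-- The unoriented edges of `Γ`. -/
def Edge : Type _ := Quotient S.edgeSetoid

noncomputable instance [Fintype F] : Fintype S.Edge := by
  classical
  exact Fintype.ofSurjective (Quotient.mk S.edgeSetoid) Quotient.mk_surjective

/-- The triangles containing the point `p`, i.e. the vertices of `Γ` on the boundary of the
plaquette `p`. -/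
noncomputable def starFaces [Fintype F] (p : V) : Finset F :=
  open Classical in Finset.univ.filter fun t => ∃ i, S.vert t i = p

end TriangulatedSurface

/-! ### Colorings -/

/-- A `G`-coloring of the dual graph `Γ`. -/
@[ext]
structure GColoring {V F : Type*} (S : TriangulatedSurface V F) (G : Type*)
    [AddCommGroup G] where
  val : F × Fin 3 → G
  val_opp : ∀ e, val (S.opp e) = -val e
  val_vertex : ∀ t, val (t, 0) + val (t, 1) + val (t, 2) = 0

namespace GColoring

variable {V F : Type*} {S : TriangulatedSurface V F} {G : Type*} [AddCommGroup G]

/-- Admissibility with respect to the set `X` of singular degrees. -/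
def Admissible (X : Set G) (Φ : GColoring S G) : Prop := ∀ e, Φ.val e ∉ X

/-- The coloring `Φ + g.δp`, where `δp` consists of the oriented edges of `Γ` that turn
positively around `p`. -/
def addPlaquette [DecidableEq V] (Φ : GColoring S G) (g : G) (p : V) : GColoring S G where
  val e := Φ.val e + (if S.src e = p then g else 0) - (if S.tgt e = p then g else 0)
  val_opp e := by
    rw [Φ.val_opp, S.src_opp, S.tgt_opp]; abel
  val_vertex t := by
    have h := Φ.val_vertex t
    have e0 : S.tgt (t, 0) = S.src (t, 1) := rfl
    have e1 : S.tgt (t, 1) = S.src (t, 2) := rfl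
    have e2 : S.tgt (t, 2) = S.src (t, 0) := rfl
    rw [e0, e1, e2]
    rw [← h]; abel

end GColoring

/-! ### States and the state space -/

/-- A state of the coloring `Φ`: a label of degree `Φ e` on every oriented edge `e` of `Γ`, and
a branching label in `{0, …, δ}` on every vertex of `Γ`. -/
@[ext]
structure LWState {K : Type*} [Field K] [StarRing K] {G : Type*} [AddCommGroup G]
    {A : Type*} (D : LWData K G A) {V F : Type*} {S : TriangulatedSurface V F}
    (Φ : GColoring S G) where
  lab : F × Fin 3 → A
  lab_mem : ∀ e, lab e ∈ D.I (Φ.val e)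
  lab_opp : ∀ e, lab (S.opp e) = D.dual (lab e)
  br : F → ℕ
  br_le : ∀ t, br t ≤ D.δ (lab (t, 0)) (lab (t, 1)) (lab (t, 2))

instance LWState.instFinite {K : Type*} [Field K] [StarRing K] {G : Type*} [AddCommGroup G]
    {A : Type*} (D : LWData K G A) {V F : Type*} [Finite F] {S : TriangulatedSurface V F}
    (Φ : GColoring S G) : Finite (LWState D Φ) := by
  let T := Σ f : (∀ e, D.I (Φ.val e)),
    ∀ t, Fin (D.δ (f (t, 0)) (f (t, 1)) (f (t, 2)) + 1)
  let φ : LWState D Φ → T := fun σ =>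
    ⟨fun e => ⟨σ.lab e, σ.lab_mem e⟩, fun t => ⟨σ.br t, Nat.lt_succ_of_le (σ.br_le t)⟩⟩
  refine Finite.of_injective φ ?_
  rintro ⟨l, hl, ho, b, hb⟩ ⟨l', hl', ho', b', hb'⟩ h
  have h1 : l = l' := by
    funext e
    have := congrArg (fun x : T => ((x.1 e : D.I (Φ.val e)) : A)) h
    exact this
  subst h1
  have h2 : b = b' := by
    funext t
    have := congrArg (fun x : T => (x.2 t : ℕ)) h
    exact this
  subst h2
  rfl

noncomputable instance LWState.instFintype {K : Type*} [Field K] [StarRing K] {G : Type*}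
    [AddCommGroup G] {A : Type*} (D : LWData K G A) {V F : Type*} [Finite F]
    {S : TriangulatedSurface V F} (Φ : GColoring S G) : Fintype (LWState D Φ) :=
  Fintype.ofFinite _

noncomputable instance LWState.instDecidableEq {K : Type*} [Field K] [StarRing K]
    {G : Type*} [AddCommGroup G] {A : Type*} (D : LWData K G A) {V F : Type*}
    {S : TriangulatedSurface V F} (Φ : GColoring S G) : DecidableEq (LWState D Φ) :=
  Classical.decEq _

/-- The Hilbert space `ℋ(Γ, Φ)`: the states form an orthonormal basis for `⟨·|·⟩₊`. -/
abbrev LWSpace {G : Type*} [AddCommGroup G] {A : Type*} (D : LWData ℂ G A) {V F : Type*}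
    {S : TriangulatedSurface V F} (Φ : GColoring S G) : Type _ :=
  EuclideanSpace ℂ (LWState D Φ)

namespace LW

variable {G : Type*} [AddCommGroup G] {A : Type*} (D : LWData ℂ G A)
  {V F : Type*} [Fintype V] [DecidableEq V] [Fintype F] [DecidableEq F]
  {S : TriangulatedSurface V F}

/-- The basis vector `|Γ, σ⟩`. -/
noncomputable def ket {Φ : GColoring S G} (σ : LWState D Φ) : LWSpace D Φ :=
  EuclideanSpace.single σ 1

/-! ### The indefinite inner product -/

/-- The product over the unoriented edges `e` of `Γ` of `f (σ e)`, for a function `f` of labels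
that is invariant under `*`. -/
noncomputable def edgeProd {Φ : GColoring S G} (σ : LWState D Φ) (f : A → ℂ)
    (hf : ∀ a, f (D.dual a) = f a) : ℂ :=
  ∏ e : S.Edge, Quotient.lift (fun x => f (σ.lab x))
    (by
      rintro a b (h | h)
      · rw [h]
      · rw [h, σ.lab_opp, hf]) e

/-- The factor `γ(σ(v))`; it is `1` at the vertices with branching label `0`. -/
noncomputable def vertexGamma {Φ : GColoring S G} (σ : LWState D Φ) (t : F) : ℂ :=
  if σ.br t = 0 then 1
  else D.γ (σ.lab (t, 0)) (σ.lab (t, 1)) (σ.lab (t, 2)) (σ.br t)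

/-- The eigenvalue `∏ d / (∏ γ ∏ β)` of `η` on `|Γ, σ⟩`. -/
noncomputable def etaWeight {Φ : GColoring S G} (σ : LWState D Φ) : ℂ :=
  edgeProd D σ D.d D.d_dual / ((∏ t : F, vertexGamma D σ t) * edgeProd D σ D.β D.β_dual)

theorem edgeProd_ne_zero {Φ : GColoring S G} (σ : LWState D Φ) (f : A → ℂ)
    (hf : ∀ a, f (D.dual a) = f a) (h0 : ∀ a, f a ≠ 0) : edgeProd D σ f hf ≠ 0 := by
  refine Finset.prod_ne_zero_iff.2 fun e _ => ?_
  induction e using Quotient.inductionOn with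
  | h x => exact h0 _

theorem etaWeight_ne_zero {Φ : GColoring S G} (σ : LWState D Φ) : etaWeight D σ ≠ 0 := by
  refine div_ne_zero (edgeProd_ne_zero D σ _ _ D.d_ne_zero)
    (mul_ne_zero (Finset.prod_ne_zero_iff.2 fun t _ => ?_)
      (edgeProd_ne_zero D σ _ _ D.β_ne_zero))
  unfold vertexGamma
  split_ifs with h
  · exact one_ne_zero
  · exact D.γ_ne_zero _ _ _ _ (Nat.one_le_iff_ne_zero.2 h) (σ.br_le t)

/-- The invertible operator `η`, diagonal in the basis of states. -/
noncomputable def eta (Φ : GColoring S G) : LWSpace D Φ ≃ₗ[ℂ] LWSpace D Φ where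
  toFun ψ := WithLp.toLp 2 fun σ => etaWeight D σ * ψ σ
  map_add' ψ φ := by ext σ; simp [mul_add]
  map_smul' c ψ := by ext σ; simp [mul_left_comm]
  invFun ψ := WithLp.toLp 2 fun σ => (etaWeight D σ)⁻¹ * ψ σ
  left_inv ψ := by ext σ; simp [etaWeight_ne_zero]
  right_inv ψ := by ext σ; simp [etaWeight_ne_zero]

/-- The indefinite inner product `⟨ψ|φ⟩ = ⟨ψ|η⁻¹ φ⟩₊`. -/
noncomputable def indefInner {Φ : GColoring S G} (ψ φ : LWSpace D Φ) : ℂ :=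
  inner ℂ ψ ((eta D Φ).symm φ)

/-- Hermitian operators for the indefinite inner product. -/
def IsIndefHermitian {Φ : GColoring S G} (T : Module.End ℂ (LWSpace D Φ)) : Prop :=
  ∀ ψ φ, indefInner D ψ (T φ) = indefInner D (T ψ) φ

/-- Pseudo-Hermitian operators for the positive definite inner product, with respect to the
invertible Hermitian operator `η`: the adjoint of `T` is `η⁻¹ T η`. -/
def IsPseudoHermitian {Φ : GColoring S G} (T : Module.End ℂ (LWSpace D Φ)) : Prop :=
  (eta D Φ).toLinearMap.IsSymmetric ∧
    LinearMap.adjoint T = (eta D Φ).symm.toLinearMap ∘ₗ T ∘ₗ (eta D Φ).toLinearMap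

/-! ### Vertex and plaquette operators -/

/-- The vertex operator `Q_v`. -/
noncomputable def vertexOp (Φ : GColoring S G) (t : F) : Module.End ℂ (LWSpace D Φ) :=
  Matrix.toEuclideanLin (Matrix.diagonal fun σ : LWState D Φ =>
    if 1 ≤ σ.br t ∧ σ.br t ≤ D.δ (σ.lab (t, 0)) (σ.lab (t, 1)) (σ.lab (t, 2))
    then (1 : ℂ) else 0)

/-- The coefficient of `|Γ, σ'⟩` in `B_p^s |Γ, σ⟩`.

Let `e = (t, i)` be an edge of the triangulation that starts at `p`.  The three edges of `Γ` at
`t`, oriented towards `t`, are `(t, i)`, `(t, i + 1)`, `(t, i + 2)`.  The second one does not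
belong to the boundary of `p`; the others do.  In the usual notation, where the boundary of
`p` is followed through its vertices by `j_1, j_2, …` and the outgoing legs are `k_1, k_2, …`,
at the vertex `t` one has `j_i = σ (t, i + 2)`, `j_{i+1}^* = σ (t, i)`, `k_i^* = σ (t, i + 1)`.
The summation index `Al` assigns a branching label to every edge on the boundary of `p`, each
represented by its orientation starting at `p`; it is put to `0` on all the others. -/
noncomputable def plaquetteCoeff (p : V) (s : A) {Φ Φ' : GColoring S G}
    (σ' : LWState D Φ') (σ : LWState D Φ) : ℂ :=
  open Classical in
  if (∀ e, S.src e ≠ p → S.tgt e ≠ p → σ'.lab e = σ.lab e) ∧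
      (∀ t, (∀ i, S.vert t i ≠ p) → σ'.br t = σ.br t) then
    ∑ Al ∈ Fintype.piFinset (fun e : F × Fin 3 =>
        if S.src e = p then
          Finset.Icc 1 (D.δ (D.dual (σ'.lab e)) s (σ.lab e))
        else {0}),
      ∏ e ∈ Finset.univ.filter (fun e : F × Fin 3 => S.src e = p),
        D.d (σ'.lab (e.1, e.2 + 2)) *
          D.N (σ'.lab (e.1, e.2 + 2)) s (σ.lab (e.1, e.2 + 2))
            (σ.lab (e.1, e.2)) (D.dual (σ.lab (e.1, e.2 + 1))) (σ'.lab (e.1, e.2))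
            (Al (S.next e)) (σ.br e.1) (σ'.br e.1) (Al e)
  else 0

/-- The operator `B_p^s : ℋ(Γ, Φ) → ℋ(Γ, Φ')`, where `Φ' = Φ + |s|.δp`. -/
noncomputable def plaquetteLabelOp (p : V) (s : A) (Φ Φ' : GColoring S G) :
    LWSpace D Φ →ₗ[ℂ] LWSpace D Φ' :=
  Matrix.toEuclideanLin (Matrix.of fun σ' σ => plaquetteCoeff D p s σ' σ)

/-- The operator `B_p^g = ∑_{s ∈ I_g} b(s) B_p^s : ℋ(Γ, Φ) → ℋ(Γ, Φ')`, where
`Φ' = Φ + g.δp`. -/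
noncomputable def plaquetteDegOp (p : V) (g : G) (Φ Φ' : GColoring S G) :
    LWSpace D Φ →ₗ[ℂ] LWSpace D Φ' :=
  ∑ s ∈ D.I g, D.b s • plaquetteLabelOp D p s Φ Φ'

/-- The degrees `g` for which `B_p^g B_p^{-g}` is defined on `ℋ(Γ, Φ)`: both `g` and the
intermediate coloring `Φ - g.δp` are generic. -/
def GenericAt (Φ : GColoring S G) (p : V) (g : G) : Prop :=
  g ∉ D.X ∧ (Φ.addPlaquette (-g) p).Admissible D.X

/-- The composite `B_p^g B_p^{-g} : ℋ(Γ, Φ) → ℋ(Γ, Φ - g.δp) → ℋ(Γ, Φ)`. -/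
noncomputable def plaquetteComp (Φ : GColoring S G) (p : V) (g : G) :
    Module.End ℂ (LWSpace D Φ) :=
  plaquetteDegOp D p g (Φ.addPlaquette (-g) p) Φ ∘ₗ
    plaquetteDegOp D p (-g) Φ (Φ.addPlaquette (-g) p)

/-- Since the set of singular degrees is small, `B_p^g B_p^{-g}` is defined for some `g`. -/
theorem exists_genericAt (Φ : GColoring S G) (hΦ : Φ.Admissible D.X) (p : V) :
    ∃ g, GenericAt D Φ p g := by
  classical
  obtain ⟨g, hg⟩ := D.X_small (insert 0 (Finset.univ.image Φ.val))
  refine ⟨g, fun h => hg 0 (by simp) g h (by simp), fun e he => ?_⟩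
  have hne : S.src e ≠ S.tgt e := fun h => by
    have := S.vert_injective e.1 h
    have h3 : ∀ i : Fin 3, i ≠ i + 1 := by decide
    exact h3 _ this
  by_cases h1 : S.src e = p
  · have h2 : S.tgt e ≠ p := fun h => hne (h1.trans h.symm)
    have h3 : Φ.val e - g ∈ D.X := by
      simpa [GColoring.addPlaquette, h1, h2, sub_eq_add_neg] using he
    exact hg (Φ.val e) (by simp) _ (D.X_symm _ h3) (by abel)
  · by_cases h2 : S.tgt e = p
    · have h3 : Φ.val e + g ∈ D.X := by
        simpa [GColoring.addPlaquette, h1, h2] using he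
      refine hg (Φ.val (S.opp e)) (by simp) _ h3 ?_
      rw [Φ.val_opp]; abel
    · exact hΦ e (by simpa [GColoring.addPlaquette, h1, h2] using he)

/-- The plaquette operator `B_p = B_p^g B_p^{-g}`, for some degree `g` for which this is
defined. -/
noncomputable def plaquetteOp (Φ : GColoring S G) (hΦ : Φ.Admissible D.X) (p : V) :
    Module.End ℂ (LWSpace D Φ) :=
  plaquetteComp D Φ p (exists_genericAt D Φ hΦ p).choose

/-- The Hamiltonian `H = ∑_p (1 - B_p) + ∑_v (1 - Q_v)`. -/
noncomputable def hamiltonian (Φ : GColoring S G) (hΦ : Φ.Admissible D.X) :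
    Module.End ℂ (LWSpace D Φ) :=
  ∑ p : V, (1 - plaquetteOp D Φ hΦ p) + ∑ t : F, (1 - vertexOp D Φ t)

/-! ### Locality and gap -/

/-- Two states agree at the vertex `t` of `Γ` and on the three edges at `t`. -/
def AgreeAt {Φ : GColoring S G} (σ τ : LWState D Φ) (t : F) : Prop :=
  σ.br t = τ.br t ∧ ∀ i, σ.lab (t, i) = τ.lab (t, i)

/-- The operator `T` acts only on the region formed by the set `R` of vertices of `Γ` and the
edges at these vertices: it changes nothing at the vertices outside `R` and on the edges at
those vertices, and its matrix coefficients depend only on the restrictions of the states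
to the region. -/
def SupportedOn {Φ : GColoring S G} (R : Finset F) (T : Module.End ℂ (LWSpace D Φ)) : Prop :=
  (∀ σ σ' : LWState D Φ, T (ket D σ) σ' ≠ 0 → ∀ t ∉ R, AgreeAt D σ' σ t) ∧
  (∀ σ σ' τ τ' : LWState D Φ,
    (∀ t ∉ R, AgreeAt D σ' σ t) → (∀ t ∉ R, AgreeAt D τ' τ t) →
    (∀ t ∈ R, AgreeAt D σ τ t) → (∀ t ∈ R, AgreeAt D σ' τ' t) →
    T (ket D σ) σ' = T (ket D τ) τ')

/-- Any two distinct points of the spectrum of `T` are at distance at least `Δ`. -/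
def HasSpectralGap {Φ : GColoring S G} (T : Module.End ℂ (LWSpace D Φ)) (Δ : ℝ) : Prop :=
  ∀ x ∈ spectrum ℂ T, ∀ y ∈ spectrum ℂ T, x ≠ y → Δ ≤ ‖x - y‖

end LW

/-! ### Sums of commuting idempotents -/

section CommutingIdempotents

variable {K M : Type*} [Field K] [AddCommGroup M] [Module K M]

theorem exists_joint_eigenvector_of_commuting_idempotents {ι : Type*} (P : ι → Module.End K M)
    (hP : ∀ i, P i * P i = P i) (hc : ∀ i j, P i * P j = P j * P i) (s : Finset ι)
    (T : Module.End K M) (hT : ∀ i, T * P i = P i * T) (z : K) (v : M) (hv : v ≠ 0)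
    (hTv : T v = z • v) :
    ∃ w, w ≠ 0 ∧ T w = z • w ∧ (∀ i ∈ s, P i w = 0 ∨ P i w = w) ∧
      ∀ j, P j v = v → P j w = w := by
  classical
  induction s using Finset.induction_on with
  | empty => exact ⟨v, hv, hTv, by simp, fun _ h => h⟩
  | insert a s _ ih =>
    obtain ⟨w, hw, hTw, hs, hj⟩ := ih
    by_cases h0 : P a w = 0
    · refine ⟨w, hw, hTw, fun i hi => ?_, hj⟩
      rcases Finset.mem_insert.1 hi with rfl | hi
      · exact Or.inl h0
      · exact hs i hi
    · have comm : ∀ j u, P j (P a u) = P a (P j u) := fun j u =>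
        congrArg (fun f : Module.End K M => f u) (hc j a)
      refine ⟨P a w, h0, ?_, fun i hi => ?_, fun j hv => ?_⟩
      · have : T (P a w) = P a (T w) := congrArg (fun f : Module.End K M => f w) (hT a)
        rw [this, hTw, map_smul]
      · rcases Finset.mem_insert.1 hi with rfl | hi
        · exact Or.inr (congrArg (fun f : Module.End K M => f w) (hP i))
        · rw [comm]
          rcases hs i hi with h | h
          · left; rw [h, map_zero]
          · right; rw [h]
      · rw [comm, hj j hv]

theorem eigenvalue_sum_commuting_idempotents {ι : Type*} [Fintype ι] (P : ι → Module.End K M)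
    (hP : ∀ i, P i * P i = P i) (hc : ∀ i j, P i * P j = P j * P i) (z : K) (v : M)
    (hv : v ≠ 0) (hz : (∑ i, P i) v = z • v) :
    ∃ n : ℕ, z = n ∧ ∀ j, P j v = v → 0 < n := by
  classical
  obtain ⟨w, hw, hTw, hs, hj⟩ := exists_joint_eigenvector_of_commuting_idempotents P hP hc
    Finset.univ (∑ i, P i) (fun i => by
      rw [Finset.sum_mul, Finset.mul_sum]; exact Finset.sum_congr rfl fun j _ => hc j i) z v hv hz
  refine ⟨(Finset.univ.filter fun i => P i w = w).card, ?_, fun j h => ?_⟩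
  · have h1 : (∑ i, P i) w = ((Finset.univ.filter fun i => P i w = w).card : K) • w := by
      rw [LinearMap.sum_apply, Finset.card_filter, Nat.cast_sum, Finset.sum_smul]
      refine Finset.sum_congr rfl fun i _ => ?_
      by_cases h : P i w = w
      · simp [h]
      · have h0 : P i w = 0 := (hs i (Finset.mem_univ i)).resolve_right h
        simp [h0, hw.symm]
    exact smul_left_injective K hw (hTw.symm.trans h1)
  · exact Finset.card_pos.2 ⟨j, by simp [hj j h]⟩

theorem sum_commuting_idempotents_apply_eq_zero [CharZero K] {ι : Type*} [Fintype ι]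
    (P : ι → Module.End K M)
    (hP : ∀ i, P i * P i = P i) (hc : ∀ i j, P i * P j = P j * P i) (v : M)
    (h : (∑ i, P i) v = 0) (j : ι) : P j v = 0 := by
  by_contra hne
  have hT : (∑ i, P i) (P j v) = (0 : K) • P j v := by
    have : (∑ i, P i) * P j = P j * ∑ i, P i := by
      rw [Finset.sum_mul, Finset.mul_sum]; exact Finset.sum_congr rfl fun i _ => hc i j
    have h2 : (∑ i, P i) (P j v) = P j ((∑ i, P i) v) :=
      congrArg (fun f : Module.End K M => f v) this
    rw [h2, h, map_zero, zero_smul]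
  obtain ⟨n, hn, hpos⟩ := eigenvalue_sum_commuting_idempotents P hP hc 0 (P j v) hne hT
  have h1 := hpos j (congrArg (fun f : Module.End K M => f v) (hP j))
  exact h1.ne (by exact_mod_cast hn)

end CommutingIdempotents

/-! ### Symmetries of the multiplicities and of the 6j-symbols -/

namespace LWData

variable {K : Type*} [Field K] [StarRing K] {G : Type*} [AddCommGroup G] {A : Type*}
  (D : LWData K G A)

theorem δ_rot' (i j k : A) : D.δ i j k = D.δ k i j := by rw [D.δ_rot k i j]

theorem dual_injective : Function.Injective D.dual := fun a b h => by
  rw [← D.dual_dual a, h, D.dual_dual]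

theorem mem_I_dual {a : A} {g : G} : D.dual a ∈ D.I (-g) ↔ a ∈ D.I g := by
  rw [D.mem_I, D.mem_I, D.deg_dual, neg_inj]

/-- The rotation of the tetrahedron around its third vertex. -/
theorem N_rot₃ (j₁ j₂ j₃ j₄ j₅ j₆ : A) (a₁ a₂ a₃ a₄ : ℕ) :
    D.N j₁ j₂ j₃ j₄ j₅ j₆ a₁ a₂ a₃ a₄
      = D.N (D.dual j₅) j₃ (D.dual j₄) (D.dual j₂) (D.dual j₆) j₁ a₂ a₄ a₃ a₁ := by
  rw [D.N_symm₂, D.N_symm₁, D.N_symm₁]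
  simp only [D.dual_dual]

/-- A half turn of the tetrahedron. -/
theorem N_half_turn (j₁ j₂ j₃ j₄ j₅ j₆ : A) (a₁ a₂ a₃ a₄ : ℕ) :
    D.N j₁ j₂ j₃ j₄ j₅ j₆ a₁ a₂ a₃ a₄
      = D.N (D.dual j₄) (D.dual j₂) (D.dual j₆) (D.dual j₁) (D.dual j₅) (D.dual j₃)
        a₄ a₃ a₂ a₁ := by
  rw [D.N_symm₂, D.N_symm₁, D.N_symm₁, D.N_symm₂]
  simp only [D.dual_dual]

/-- The orthogonality relation in the form in which it is used for the fusion of plaquette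
operators. -/
theorem N_ortho_fusion (s₁ s₂ u u' x y : A) (c₁ c₂ c₂' c₃ : ℕ) (h : D.deg s₂ + D.deg x ∉ D.X)
    (h2 : c₂ ∈ Finset.Icc 1 (D.δ s₁ s₂ (D.dual u)))
    (h3 : c₃ ∈ Finset.Icc 1 (D.δ (D.dual y) u x)) :
    ∑ m ∈ D.I (D.deg s₂ + D.deg x),
      ∑ a ∈ Finset.Icc 1 (D.δ (D.dual y) s₁ m),
      ∑ b ∈ Finset.Icc 1 (D.δ (D.dual m) s₂ x),
        D.d m * D.N (D.dual y) s₁ (D.dual m) s₂ (D.dual x) u' a b c₁ c₂'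
          * D.N s₁ s₂ u x y m c₂ c₃ a b
      = open Classical in if u' = u ∧ c₂ = c₂' ∧ c₃ = c₁ then (D.d u')⁻¹ else 0 := by
  rw [Finset.mem_Icc] at h2 h3
  rw [← D.N_ortho s₁ s₂ u' x y u c₂ c₃ c₂' c₁ h h2.1 h2.2 h3.1 (by rw [D.δ_rot']; exact h3.2)]
  refine Finset.sum_congr rfl fun m _ => ?_
  have e1 : D.δ (D.dual y) s₁ m = D.δ y (D.dual m) (D.dual s₁) := by
    rw [D.δ_dual, D.dual_dual, ← D.δ_rot y]
  have e2 : D.δ (D.dual m) s₂ x = D.δ m (D.dual x) (D.dual s₂) := by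
    rw [D.δ_dual, D.dual_dual, ← D.δ_rot m]
  rw [e1, e2]
  refine Finset.sum_congr rfl fun a _ => Finset.sum_congr rfl fun b _ => ?_
  have e3 : D.N (D.dual y) s₁ (D.dual m) s₂ (D.dual x) u' a b c₁ c₂'
      = D.N u' (D.dual s₂) s₁ m y x c₂' a c₁ b := by
    rw [D.N_symm₁, D.N_symm₂ u']
    simp only [D.dual_dual]
  rw [e3]; ring

end LWData

/-! ### Fusion of plaquette operators: the local computation -/

namespace LWData

variable {K : Type*} [Field K] [StarRing K] {G : Type*} [AddCommGroup G] {A : Type*}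
  (D : LWData K G A)

/-- The labels created at a corner of a plaquette by the fusion of `s₁` and `s₂`: a label `u`, a
branching label for `u → s₁ s₂`, and branching labels on the two edges. -/
def fusionLabels (s₁ s₂ yn xn y x : A) : Finset (Σ _ : A, ℕ × ℕ × ℕ) :=
  (D.I (D.deg s₁ + D.deg s₂)).sigma fun u =>
    Finset.Icc 1 (D.δ s₁ s₂ (D.dual u)) ×ˢ Finset.Icc 1 (D.δ (D.dual yn) u xn) ×ˢ
      Finset.Icc 1 (D.δ (D.dual y) u x)

/-- The pentagon identity at a corner of a plaquette. -/
theorem N_pentagon_fusion (s₁ s₂ yn mn xn y m x k : A) (an bn a b c c'' : ℕ)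
    (h : D.deg s₁ + D.deg s₂ ∉ D.X) :
    ∑ c' ∈ Finset.Icc 1 (D.δ m k (D.dual mn)),
      D.N (D.dual yn) s₁ (D.dual mn) m (D.dual k) y an c' c'' a *
        D.N (D.dual mn) s₂ (D.dual xn) x (D.dual k) m bn c c' b
    = ∑ z ∈ D.fusionLabels s₁ s₂ yn xn y x,
        D.N (D.dual yn) s₁ (D.dual mn) s₂ (D.dual xn) z.1 an bn z.2.2.1 z.2.1 *
          D.N s₁ s₂ z.1 x y m z.2.1 z.2.2.2 a b *
          (D.d z.1 *
            D.N (D.dual yn) z.1 (D.dual xn) x (D.dual k) y z.2.2.1 c c'' z.2.2.2) := by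
  have e0 : D.δ m k (D.dual mn) = D.δ (D.dual k) (D.dual m) (D.dual (D.dual mn)) := by
    rw [D.δ_dual, D.dual_dual, ← D.δ_rot']
  have key := D.N_pentagon (D.dual k) (D.dual yn) s₁ s₂ x (D.dual mn) (D.dual xn) y m
    c'' an bn c a b h
  rw [e0]
  calc _ = _ := Finset.sum_congr rfl fun c' _ => mul_comm _ _
    _ = _ := key.symm
    _ = _ := by
      rw [fusionLabels, Finset.sum_sigma]
      refine Finset.sum_congr rfl fun u _ => ?_
      rw [Finset.sum_product, Finset.sum_comm]
      have e1 : D.δ (D.dual xn) (D.dual u) (D.dual (D.dual yn)) = D.δ (D.dual yn) u xn := by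
        rw [D.δ_dual]; simp only [D.dual_dual]
      have e2 : D.δ u (D.dual s₂) (D.dual s₁) = D.δ s₁ s₂ (D.dual u) := by
        rw [D.δ_dual]; simp only [D.dual_dual]
      have e3 : D.δ y (D.dual x) (D.dual u) = D.δ (D.dual y) u x := by
        rw [D.δ_dual, D.δ_rot']; simp only [D.dual_dual]
      rw [e1, e2, e3]
      refine Finset.sum_congr rfl fun c₂ _ => ?_
      rw [Finset.sum_product]
      refine Finset.sum_congr rfl fun c₁ _ => Finset.sum_congr rfl fun c₃ _ => ?_
      ring

variable {E : Type*} [Fintype E] [DecidableEq E] (nx : Equiv.Perm E)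

/-- The matrix coefficient of a plaquette operator.  The set `E` indexes the edges on the
boundary of the plaquette, with labels `x` before and `y` after the action, as well as the
vertices, with branching labels `c` and `c'`; the vertex `e` lies between the edges `nx e` and
`e`.  The third legs have the labels `k`. -/
def ringCoeff (k : E → A) (s : A) (y x : E → A) (c' c : E → ℕ) : K :=
  ∑ a ∈ Fintype.piFinset fun e => Finset.Icc 1 (D.δ (D.dual (y e)) s (x e)),
    ∏ e, (D.d (y e) * D.N (D.dual (y (nx e))) s (D.dual (x (nx e))) (x e) (D.dual (k e)) (y e)
      (a (nx e)) (c e) (c' e) (a e))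

theorem ringCoeff_eq (k : E → A) (s : A) (y x : E → A) (c' c : E → ℕ) :
    D.ringCoeff nx k s y x c' c = (∏ e, D.d (y e)) *
      ∑ a ∈ Fintype.piFinset fun e => Finset.Icc 1 (D.δ (D.dual (y e)) s (x e)),
        ∏ e, D.N (D.dual (y (nx e))) s (D.dual (x (nx e))) (x e) (D.dual (k e)) (y e)
          (a (nx e)) (c e) (c' e) (a e) := by
  rw [ringCoeff, Finset.mul_sum]
  exact Finset.sum_congr rfl fun a _ => Finset.prod_mul_distrib

theorem sum_piFinset_prod₃ {R B C : Type*} [CommSemiring R] (s : E → Finset B)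
    (t t' : E → B → Finset C) (f : E → B → C → C → R) :
    ∑ m ∈ Fintype.piFinset s, ∑ a ∈ Fintype.piFinset fun e => t e (m e),
      ∑ b ∈ Fintype.piFinset fun e => t' e (m e), ∏ e, f e (m e) (a e) (b e)
    = ∏ e, ∑ m ∈ s e, ∑ a ∈ t e m, ∑ b ∈ t' e m, f e m a b := by
  rw [Finset.prod_univ_sum]
  refine Finset.sum_congr rfl fun m _ => ?_
  rw [Finset.prod_univ_sum]
  refine Finset.sum_congr rfl fun a _ => ?_
  rw [Finset.prod_univ_sum]

/-- Labels that are created by fusion at all corners of a plaquette and that match along all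
edges. -/
theorem sum_fusionLabels_matching [Nonempty E] (hnx : ∀ e e', ∃ n : ℕ, nx^[n] e = e')
    (s₁ s₂ : A) (y x : E → A) (f : A → (E → ℕ) → K) :
    ∑ z ∈ Fintype.piFinset fun e => D.fusionLabels s₁ s₂ (y (nx e)) (x (nx e)) (y e) (x e),
      (open Classical in
        if ∀ e, (z e).1 = (z (nx e)).1 ∧ (z (nx e)).2.1 = (z e).2.1 ∧
          (z (nx e)).2.2.2 = (z e).2.2.1
        then f (z (Classical.arbitrary E)).1 (fun e => (z e).2.2.2) else 0)
    = ∑ u ∈ D.I (D.deg s₁ + D.deg s₂), (D.δ s₁ s₂ (D.dual u) : K) *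
        ∑ a ∈ Fintype.piFinset fun e => Finset.Icc 1 (D.δ (D.dual (y e)) u (x e)), f u a := by
  classical
  have h1 : ∀ u ∈ D.I (D.deg s₁ + D.deg s₂), (D.δ s₁ s₂ (D.dual u) : K) *
        ∑ a ∈ Fintype.piFinset fun e => Finset.Icc 1 (D.δ (D.dual (y e)) u (x e)), f u a
      = ∑ w ∈ Finset.Icc 1 (D.δ s₁ s₂ (D.dual u)) ×ˢ
          Fintype.piFinset (fun e => Finset.Icc 1 (D.δ (D.dual (y e)) u (x e))), f u w.2 := by
    intro u _
    simp only [Finset.sum_product, Finset.sum_const, Nat.card_Icc, nsmul_eq_mul,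
      Nat.add_sub_cancel]
  rw [Finset.sum_congr rfl h1, Finset.sum_sigma', ← Finset.sum_filter]
  refine Finset.sum_bij'
    (fun z _ => ⟨(z (Classical.arbitrary E)).1, ((z (Classical.arbitrary E)).2.1,
      fun e => (z e).2.2.2)⟩)
    (fun w _ => fun e => ⟨w.1, (w.2.1, w.2.2 (nx e), w.2.2 e)⟩) ?_ ?_ ?_ ?_ ?_
  · intro z hz
    rw [Finset.mem_filter, Fintype.mem_piFinset] at hz
    obtain ⟨hz, hm⟩ := hz
    have hc : ∀ e e', (z e).1 = (z e').1 := by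
      intro e e'
      obtain ⟨n, rfl⟩ := hnx e e'
      induction n with
      | zero => rfl
      | succ n ih => rw [Function.iterate_succ_apply', ← (hm _).1]; exact ih
    simp only [fusionLabels, Finset.mem_sigma, Finset.mem_product] at hz ⊢
    refine ⟨(hz _).1, (hz _).2.1, Fintype.mem_piFinset.2 fun e => ?_⟩
    rw [hc _ e]
    exact (hz e).2.2.2
  · intro w hw
    simp only [Finset.mem_sigma, Finset.mem_product, Fintype.mem_piFinset] at hw
    rw [Finset.mem_filter, Fintype.mem_piFinset]
    refine ⟨fun e => ?_, fun e => ⟨rfl, rfl, rfl⟩⟩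
    simp only [fusionLabels, Finset.mem_sigma, Finset.mem_product]
    exact ⟨hw.1, hw.2.1, hw.2.2 _, hw.2.2 _⟩
  · intro z hz
    rw [Finset.mem_filter, Fintype.mem_piFinset] at hz
    obtain ⟨hz, hm⟩ := hz
    have hc : ∀ e e', (z e).1 = (z e').1 ∧ (z e).2.1 = (z e').2.1 := by
      intro e e'
      obtain ⟨n, rfl⟩ := hnx e e'
      induction n with
      | zero => exact ⟨rfl, rfl⟩
      | succ n ih =>
        rw [Function.iterate_succ_apply', ← (hm _).1, (hm _).2.1]; exact ih
    funext e
    have h3 := (hm e).2.2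
    have h4 := hc (Classical.arbitrary E) e
    change (⟨(z (Classical.arbitrary E)).1, ((z (Classical.arbitrary E)).2.1, (z (nx e)).2.2.2,
      (z e).2.2.2)⟩ : Σ _ : A, ℕ × ℕ × ℕ) = z e
    rw [h3, h4.1, h4.2]
  · intro w _
    rfl
  · intro z _
    rfl

/-- Fusion of the matrix coefficients of plaquette operators. -/
theorem ringCoeff_comp [Nonempty E] (hnx : ∀ e e', ∃ n : ℕ, nx^[n] e = e') (k : E → A)
    (s₁ s₂ : A) (y x : E → A) (c'' c : E → ℕ) (h : D.deg s₁ + D.deg s₂ ∉ D.X)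
    (hx : ∀ e, D.deg s₂ + D.deg (x e) ∉ D.X) :
    ∑ m ∈ Fintype.piFinset fun e => D.I (D.deg s₂ + D.deg (x e)),
      ∑ c' ∈ Fintype.piFinset fun e => Finset.Icc 1 (D.δ (m e) (k e) (D.dual (m (nx e)))),
        D.ringCoeff nx k s₁ y m c'' c' * D.ringCoeff nx k s₂ m x c' c
    = ∑ u ∈ D.I (D.deg s₁ + D.deg s₂), (D.δ s₁ s₂ (D.dual u) : K) *
        D.ringCoeff nx k u y x c'' c := by
  classical
  let P : E → A → ℕ → ℕ → (Σ _ : A, ℕ × ℕ × ℕ) → K := fun e m a b z =>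
    D.N (D.dual (y e)) s₁ (D.dual m) s₂ (D.dual (x e)) z.1 a b z.2.2.1 z.2.1
  let Q : E → A → ℕ → ℕ → (Σ _ : A, ℕ × ℕ × ℕ) → K := fun e m a b z =>
    D.N s₁ s₂ z.1 (x e) (y e) m z.2.1 z.2.2.2 a b
  let R : E → (Σ _ : A, ℕ × ℕ × ℕ) → K := fun e z =>
    D.N (D.dual (y (nx e))) z.1 (D.dual (x (nx e))) (x e) (D.dual (k e)) (y e)
      z.2.2.1 (c e) (c'' e) z.2.2.2
  let Z := Fintype.piFinset fun e => D.fusionLabels s₁ s₂ (y (nx e)) (x (nx e)) (y e) (x e)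
  -- expand the product over the corners
  have step1 : ∀ m : E → A,
      ∑ c' ∈ Fintype.piFinset fun e => Finset.Icc 1 (D.δ (m e) (k e) (D.dual (m (nx e)))),
        D.ringCoeff nx k s₁ y m c'' c' * D.ringCoeff nx k s₂ m x c' c
      = (∏ e, D.d (y e)) *
        ∑ a ∈ Fintype.piFinset fun e => Finset.Icc 1 (D.δ (D.dual (y e)) s₁ (m e)),
        ∑ b ∈ Fintype.piFinset fun e => Finset.Icc 1 (D.δ (D.dual (m e)) s₂ (x e)),
        ∑ z ∈ Z, (∏ e, (D.d (z e).1 * R e (z e))) *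
          ∏ e, (D.d (m e) * P e (m e) (a e) (b e) (z (nx.symm e)) *
            Q e (m e) (a e) (b e) (z e)) := by
    intro m
    have h1 : ∀ c' : E → ℕ,
        D.ringCoeff nx k s₁ y m c'' c' * D.ringCoeff nx k s₂ m x c' c
        = (∏ e, D.d (y e)) *
        ∑ a ∈ Fintype.piFinset fun e => Finset.Icc 1 (D.δ (D.dual (y e)) s₁ (m e)),
        ∑ b ∈ Fintype.piFinset fun e => Finset.Icc 1 (D.δ (D.dual (m e)) s₂ (x e)),
          (∏ e, D.d (m e)) * ∏ e,
          (D.N (D.dual (y (nx e))) s₁ (D.dual (m (nx e))) (m e) (D.dual (k e)) (y e)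
            (a (nx e)) (c' e) (c'' e) (a e) *
          D.N (D.dual (m (nx e))) s₂ (D.dual (x (nx e))) (x e) (D.dual (k e)) (m e)
            (b (nx e)) (c e) (c' e) (b e)) := by
      intro c'
      rw [ringCoeff_eq, ringCoeff_eq, mul_assoc, mul_left_comm (∑ _ ∈ _, _), Finset.sum_mul_sum]
      simp only [Finset.mul_sum, Finset.prod_mul_distrib]
    simp only [h1]
    rw [← Finset.mul_sum, Finset.sum_comm]
    congr 1
    refine Finset.sum_congr rfl fun a _ => ?_
    rw [Finset.sum_comm]
    refine Finset.sum_congr rfl fun b _ => ?_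
    rw [← Finset.mul_sum, ← Finset.prod_univ_sum
      (fun e => Finset.Icc 1 (D.δ (m e) (k e) (D.dual (m (nx e)))))
      (fun e c' => D.N (D.dual (y (nx e))) s₁ (D.dual (m (nx e))) (m e) (D.dual (k e)) (y e)
            (a (nx e)) c' (c'' e) (a e) *
          D.N (D.dual (m (nx e))) s₂ (D.dual (x (nx e))) (x e) (D.dual (k e)) (m e)
            (b (nx e)) (c e) c' (b e))]
    simp only [D.N_pentagon_fusion _ _ _ _ _ _ _ _ _ _ _ _ _ _ _ h]
    rw [Finset.prod_univ_sum, Finset.mul_sum]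
    refine Finset.sum_congr rfl fun z _ => ?_
    have h2 : ∏ e, P (nx e) (m (nx e)) (a (nx e)) (b (nx e)) (z e)
        = ∏ e, P e (m e) (a e) (b e) (z (nx.symm e)) := by
      rw [← Equiv.prod_comp nx fun e => P e (m e) (a e) (b e) (z (nx.symm e))]
      simp only [Equiv.symm_apply_apply]
    simp only [Finset.prod_mul_distrib]
    rw [← h2]
    simp only [P, Q, R]
    ring
  -- sum over the intermediate labels of the edges
  have step2 : ∀ z ∈ Z,
      ∑ m ∈ Fintype.piFinset fun e => D.I (D.deg s₂ + D.deg (x e)),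
      ∑ a ∈ Fintype.piFinset fun e => Finset.Icc 1 (D.δ (D.dual (y e)) s₁ (m e)),
      ∑ b ∈ Fintype.piFinset fun e => Finset.Icc 1 (D.δ (D.dual (m e)) s₂ (x e)),
        (∏ e, (D.d (z e).1 * R e (z e))) *
          ∏ e, (D.d (m e) * P e (m e) (a e) (b e) (z (nx.symm e)) *
            Q e (m e) (a e) (b e) (z e))
      = if ∀ e, (z e).1 = (z (nx e)).1 ∧ (z (nx e)).2.1 = (z e).2.1 ∧
          (z (nx e)).2.2.2 = (z e).2.2.1
        then ∏ e, D.N (D.dual (y (nx e))) (z (Classical.arbitrary E)).1 (D.dual (x (nx e))) (x e)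
          (D.dual (k e)) (y e) (z (nx e)).2.2.2 (c e) (c'' e) (z e).2.2.2 else 0 := by
    intro z hz
    have hz' := Fintype.mem_piFinset.1 hz
    simp only [fusionLabels, Finset.mem_sigma, Finset.mem_product] at hz'
    have h0 : ∑ m ∈ Fintype.piFinset fun e => D.I (D.deg s₂ + D.deg (x e)),
      ∑ a ∈ Fintype.piFinset fun e => Finset.Icc 1 (D.δ (D.dual (y e)) s₁ (m e)),
      ∑ b ∈ Fintype.piFinset fun e => Finset.Icc 1 (D.δ (D.dual (m e)) s₂ (x e)),
        (∏ e, (D.d (z e).1 * R e (z e))) *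
          ∏ e, (D.d (m e) * P e (m e) (a e) (b e) (z (nx.symm e)) *
            Q e (m e) (a e) (b e) (z e))
      = (∏ e, (D.d (z e).1 * R e (z e))) *
      ∑ m ∈ Fintype.piFinset fun e => D.I (D.deg s₂ + D.deg (x e)),
      ∑ a ∈ Fintype.piFinset fun e => Finset.Icc 1 (D.δ (D.dual (y e)) s₁ (m e)),
      ∑ b ∈ Fintype.piFinset fun e => Finset.Icc 1 (D.δ (D.dual (m e)) s₂ (x e)),
        ∏ e, (D.d (m e) * P e (m e) (a e) (b e) (z (nx.symm e)) *
            Q e (m e) (a e) (b e) (z e)) := by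
      simp only [Finset.mul_sum]
    rw [h0, sum_piFinset_prod₃ (fun e => D.I (D.deg s₂ + D.deg (x e)))
      (fun e m => Finset.Icc 1 (D.δ (D.dual (y e)) s₁ m))
      (fun e m => Finset.Icc 1 (D.δ (D.dual m) s₂ (x e)))
      (fun e m a b => D.d m * P e m a b (z (nx.symm e)) * Q e m a b (z e))]
    have h3 : ∀ e, ∑ m ∈ D.I (D.deg s₂ + D.deg (x e)),
        ∑ a ∈ Finset.Icc 1 (D.δ (D.dual (y e)) s₁ m),
        ∑ b ∈ Finset.Icc 1 (D.δ (D.dual m) s₂ (x e)),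
          D.d m * P e m a b (z (nx.symm e)) * Q e m a b (z e)
        = if (z (nx.symm e)).1 = (z e).1 ∧ (z e).2.1 = (z (nx.symm e)).2.1 ∧
          (z e).2.2.2 = (z (nx.symm e)).2.2.1 then (D.d (z (nx.symm e)).1)⁻¹ else 0 := by
      intro e
      rw [← D.N_ortho_fusion s₁ s₂ _ _ (x e) (y e) _ _ _ _ (hx e) (hz' e).2.1 (hz' e).2.2.2]
    simp only [h3]
    rw [← Equiv.prod_comp nx fun e => if (z (nx.symm e)).1 = (z e).1 ∧
          (z e).2.1 = (z (nx.symm e)).2.1 ∧ (z e).2.2.2 = (z (nx.symm e)).2.2.1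
          then (D.d (z (nx.symm e)).1)⁻¹ else 0, ← Finset.prod_mul_distrib]
    simp only [Equiv.symm_apply_apply]
    split_ifs with hm
    · have hc : ∀ e e', (z e).1 = (z e').1 := by
        intro e e'
        obtain ⟨n, rfl⟩ := hnx e e'
        induction n with
        | zero => rfl
        | succ n ih => rw [Function.iterate_succ_apply', ← (hm _).1]; exact ih
      refine Finset.prod_congr rfl fun e _ => ?_
      rw [if_pos (hm e), (hm e).2.2, hc (Classical.arbitrary E) e]
      simp only [R]
      field_simp [D.d_ne_zero]
    · obtain ⟨e, he⟩ := not_forall.1 hm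
      refine Finset.prod_eq_zero (Finset.mem_univ e) ?_
      rw [if_neg he, mul_zero]
  simp only [step1]
  rw [← Finset.mul_sum]
  have swap : ∑ m ∈ Fintype.piFinset fun e => D.I (D.deg s₂ + D.deg (x e)),
      ∑ a ∈ Fintype.piFinset fun e => Finset.Icc 1 (D.δ (D.dual (y e)) s₁ (m e)),
      ∑ b ∈ Fintype.piFinset fun e => Finset.Icc 1 (D.δ (D.dual (m e)) s₂ (x e)),
      ∑ z ∈ Z, (∏ e, (D.d (z e).1 * R e (z e))) *
          ∏ e, (D.d (m e) * P e (m e) (a e) (b e) (z (nx.symm e)) *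
            Q e (m e) (a e) (b e) (z e))
      = ∑ z ∈ Z, ∑ m ∈ Fintype.piFinset fun e => D.I (D.deg s₂ + D.deg (x e)),
      ∑ a ∈ Fintype.piFinset fun e => Finset.Icc 1 (D.δ (D.dual (y e)) s₁ (m e)),
      ∑ b ∈ Fintype.piFinset fun e => Finset.Icc 1 (D.δ (D.dual (m e)) s₂ (x e)),
        (∏ e, (D.d (z e).1 * R e (z e))) *
          ∏ e, (D.d (m e) * P e (m e) (a e) (b e) (z (nx.symm e)) *
            Q e (m e) (a e) (b e) (z e)) := by
    exact (Finset.sum_congr rfl fun m _ => (Finset.sum_congr rfl fun a _ =>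
      Finset.sum_comm).trans Finset.sum_comm).trans Finset.sum_comm
  rw [swap, Finset.sum_congr rfl step2]
  have := D.sum_fusionLabels_matching nx hnx s₁ s₂ y x (fun u a =>
    ∏ e, D.N (D.dual (y (nx e))) u (D.dual (x (nx e))) (x e)
          (D.dual (k e)) (y e) (a (nx e)) (c e) (c'' e) (a e))
  refine (congrArg _ this).trans ?_
  rw [Finset.mul_sum]
  refine Finset.sum_congr rfl fun u _ => ?_
  rw [ringCoeff_eq, mul_left_comm]

end LWData

/-! ### Turning around a point of a triangulated surface -/

namespace TriangulatedSurface

variable {V F : Type*} (S : TriangulatedSurface V F)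

theorem src_ne_tgt (e : F × Fin 3) : S.src e ≠ S.tgt e := fun h => by
  have h3 : ∀ i : Fin 3, i ≠ i + 1 := by decide
  exact h3 _ (S.vert_injective e.1 h)

theorem opp_injective : Function.Injective S.opp := fun a b h => by
  rw [← S.opp_opp a, h, S.opp_opp]

theorem tgt_add_two (e : F × Fin 3) : S.tgt (e.1, e.2 + 2) = S.src e := by
  have h : e.2 + 2 + 1 = e.2 := by rw [add_assoc]; exact add_zero _
  simp only [tgt, src, h]

theorem src_next (e : F × Fin 3) : S.src (S.next e) = S.src e := by
  rw [next, S.src_opp, S.tgt_add_two]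

/-- The previous edge with the same initial point. -/
def prev (e : F × Fin 3) : F × Fin 3 := ((S.opp e).1, (S.opp e).2 + 1)

theorem next_prev (e : F × Fin 3) : S.next (S.prev e) = e := by
  have h : ∀ i : Fin 3, i + 1 + 2 = i := by decide
  simp only [next, prev, h, Prod.mk.eta, S.opp_opp]

theorem prev_next (e : F × Fin 3) : S.prev (S.next e) = e := by
  have h : ∀ i : Fin 3, i + 2 + 1 = i := by decide
  simp only [next, prev, S.opp_opp, h, Prod.mk.eta]

/-- The oriented edges of the triangulation starting at `p`.  They index the edges on the boundary
of the plaquette `p` as well as its vertices. -/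
abbrev Spoke (p : V) : Type _ := {e : F × Fin 3 // S.src e = p}

/-- The permutation of the edges at `p` given by turning around `p`. -/
def nextPerm (p : V) : Equiv.Perm (S.Spoke p) where
  toFun e := ⟨S.next e.1, (S.src_next e.1).trans e.2⟩
  invFun e := ⟨S.prev e.1, by rw [← S.src_next, S.next_prev]; exact e.2⟩
  left_inv e := Subtype.ext (S.prev_next e.1)
  right_inv e := Subtype.ext (S.next_prev e.1)

instance (p : V) : Nonempty (S.Spoke p) := by
  obtain ⟨e, he⟩ := S.vert_surjective p
  exact ⟨⟨e, he⟩⟩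

theorem nextPerm_transitive (p : V) (e e' : S.Spoke p) : ∃ n : ℕ, (S.nextPerm p)^[n] e = e' := by
  obtain ⟨n, hn⟩ := S.link_connected e.1 e'.1 (e.2.trans e'.2.symm)
  refine ⟨n, Subtype.ext ?_⟩
  rw [← hn]
  clear hn
  induction n with
  | zero => rfl
  | succ n ih =>
    rw [Function.iterate_succ_apply', Function.iterate_succ_apply', ← ih]
    rfl

theorem spoke_face_injective (p : V) : Function.Injective fun e : S.Spoke p => e.1.1 := by
  rintro ⟨⟨t, i⟩, h⟩ ⟨⟨t', i'⟩, h'⟩ (rfl : t = t')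
  have : i = i' := S.vert_injective t (h.trans h'.symm)
  subst this
  rfl

theorem opp_spoke_ne (p : V) (e e' : S.Spoke p) : S.opp e.1 ≠ e'.1 := fun h =>
  S.src_ne_tgt e.1 (by rw [← S.src_opp, h, e.2, e'.2])

theorem spoke_opp_face (p : V) (e : S.Spoke p) : ∃ e' : S.Spoke p, e'.1.1 = (S.opp e.1).1 :=
  ⟨(S.nextPerm p).symm e, rfl⟩

/-- The edge opposite to `p` in a triangle at `p` does not meet `p`. -/
theorem third_not_mem (p : V) (e : S.Spoke p) :
    S.src (e.1.1, e.1.2 + 1) ≠ p ∧ S.tgt (e.1.1, e.1.2 + 1) ≠ p := by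
  have h1 : ∀ i : Fin 3, i + 1 ≠ i := by decide
  have h2 : ∀ i : Fin 3, i + 1 + 1 ≠ i := by decide
  exact ⟨fun h => h1 _ (S.vert_injective e.1.1 (h.trans e.2.symm)),
    fun h => h2 _ (S.vert_injective e.1.1 (h.trans e.2.symm))⟩

theorem not_mem_iff_spoke (p : V) (e : F × Fin 3) :
    (S.src e ≠ p ∧ S.tgt e ≠ p) ↔
      (∀ i : S.Spoke p, i.1 ≠ e) ∧ ∀ i : S.Spoke p, S.opp i.1 ≠ e := by
  constructor
  · rintro ⟨h1, h2⟩
    refine ⟨fun i h => h1 (h ▸ i.2), fun i h => h2 ?_⟩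
    rw [← h, S.tgt_opp, i.2]
  · rintro ⟨h1, h2⟩
    refine ⟨fun h => h1 ⟨e, h⟩ rfl, fun h => h2 ⟨S.opp e, ?_⟩ (S.opp_opp e)⟩
    rw [S.src_opp, h]

theorem face_not_mem_iff_spoke (p : V) (t : F) :
    (∀ i, S.vert t i ≠ p) ↔ ∀ e : S.Spoke p, e.1.1 ≠ t := by
  constructor
  · rintro h ⟨⟨t', i⟩, h'⟩ (rfl : t' = t)
    exact h i h'
  · exact fun h i hi => h ⟨(t, i), hi⟩ rfl

end TriangulatedSurface

/-! ### Sums over states -/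

theorem Fin.three_rot (i : Fin 3) : (i = 0 ∧ i + 1 = 1 ∧ i + 2 = 2) ∨
    (i = 1 ∧ i + 1 = 2 ∧ i + 2 = 0) ∨ (i = 2 ∧ i + 1 = 0 ∧ i + 2 = 1) := by
  revert i; decide

theorem Fin.three_cases (i j : Fin 3) : j = i ∨ j = i + 1 ∨ j = i + 2 := by
  revert i j; decide

namespace LWState

variable {K : Type*} [Field K] [StarRing K] {G : Type*} [AddCommGroup G] {A : Type*}
  {D : LWData K G A} {V F : Type*} {S : TriangulatedSurface V F} {Φ : GColoring S G}

theorem deg_lab (σ : LWState D Φ) (e : F × Fin 3) : D.deg (σ.lab e) = Φ.val e :=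
  (D.mem_I _ _).1 (σ.lab_mem e)

theorem lab_add_two (σ : LWState D Φ) (e : F × Fin 3) :
    σ.lab (e.1, e.2 + 2) = D.dual (σ.lab (S.next e)) := by
  rw [TriangulatedSurface.next, σ.lab_opp, D.dual_dual]

theorem δ_rot_lab (σ : LWState D Φ) (t : F) (i : Fin 3) :
    D.δ (σ.lab (t, 0)) (σ.lab (t, 1)) (σ.lab (t, 2))
      = D.δ (σ.lab (t, i)) (σ.lab (t, i + 1)) (σ.lab (t, i + 2)) := by
  rcases Fin.three_rot i with ⟨h0, h1, h2⟩ | ⟨h0, h1, h2⟩ | ⟨h0, h1, h2⟩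
  · rw [h1, h2, h0]
  · rw [h1, h2, h0, D.δ_rot]
  · rw [h1, h2, h0, ← D.δ_rot]

variable {ι κ : Type*} (ε : ι → F × Fin 3) (τ : κ → F)

/-- The state `ρ` has the labels `lab₀` and the branching labels `br₀` away from the edges `ε` and
the vertices `τ`. -/
def AgreesOff (lab₀ : F × Fin 3 → A) (br₀ : F → ℕ) (ρ : LWState D Φ) : Prop :=
  (∀ e, (∀ i, ε i ≠ e) → (∀ i, S.opp (ε i) ≠ e) → ρ.lab e = lab₀ e) ∧
    ∀ t, (∀ k, τ k ≠ t) → ρ.br t = br₀ t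

variable {ε τ}

theorem exists_patch (hε : Function.Injective ε) (hε' : ∀ i j, S.opp (ε i) ≠ ε j)
    (hτ : Function.Injective τ) (h1 : ∀ i, ∃ k, τ k = (ε i).1)
    (h2 : ∀ i, ∃ k, τ k = (S.opp (ε i)).1) (lab₀ : F × Fin 3 → A) (br₀ : F → ℕ)
    (hlab : ∀ e, (∀ i, ε i ≠ e) → (∀ i, S.opp (ε i) ≠ e) → lab₀ e ∈ D.I (Φ.val e) ∧
      lab₀ (S.opp e) = D.dual (lab₀ e))
    (hbr : ∀ t, (∀ k, τ k ≠ t) → br₀ t ≤ D.δ (lab₀ (t, 0)) (lab₀ (t, 1)) (lab₀ (t, 2)))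
    (r : (ι → A) → κ → ℕ)
    (hr : ∀ ρ : LWState D Φ, AgreesOff ε τ lab₀ br₀ ρ → ∀ k, r (fun i => ρ.lab (ε i)) k =
      D.δ (ρ.lab (τ k, 0)) (ρ.lab (τ k, 1)) (ρ.lab (τ k, 2)))
    (x : ι → A) (hx : ∀ i, x i ∈ D.I (Φ.val (ε i))) (c : κ → ℕ) (hc : ∀ k, c k ≤ r x k) :
    ∃ ρ : LWState D Φ, AgreesOff ε τ lab₀ br₀ ρ ∧ (∀ i, ρ.lab (ε i) = x i) ∧
      ∀ k, ρ.br (τ k) = c k := by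
  classical
  let lab : F × Fin 3 → A := fun e => if h : ∃ i, ε i = e then x h.choose else
    if h : ∃ i, S.opp (ε i) = e then D.dual (x h.choose) else lab₀ e
  have lab_ε : ∀ i, lab (ε i) = x i := fun i => by
    have h : ∃ j, ε j = ε i := ⟨i, rfl⟩
    simp only [lab, dif_pos h, hε h.choose_spec]
  have lab_ε' : ∀ i, lab (S.opp (ε i)) = D.dual (x i) := fun i => by
    have h : ∃ j, S.opp (ε j) = S.opp (ε i) := ⟨i, rfl⟩
    have h' : ¬ ∃ j, ε j = S.opp (ε i) := fun ⟨j, hj⟩ => hε' _ _ hj.symm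
    simp only [lab, dif_neg h', dif_pos h, hε (S.opp_injective h.choose_spec)]
  have lab_off : ∀ e, (∀ i, ε i ≠ e) → (∀ i, S.opp (ε i) ≠ e) → lab e = lab₀ e := fun e h h' => by
    simp only [lab, dif_neg (not_exists.2 h), dif_neg (not_exists.2 h')]
  have lab_mem : ∀ e, lab e ∈ D.I (Φ.val e) := fun e => by
    by_cases h : ∃ i, ε i = e
    · obtain ⟨i, rfl⟩ := h
      rw [lab_ε]; exact hx i
    by_cases h' : ∃ i, S.opp (ε i) = e
    · obtain ⟨i, rfl⟩ := h'
      rw [lab_ε', Φ.val_opp, D.mem_I_dual]; exact hx i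
    rw [lab_off e (not_exists.1 h) (not_exists.1 h')]
    exact (hlab e (not_exists.1 h) (not_exists.1 h')).1
  have lab_opp : ∀ e, lab (S.opp e) = D.dual (lab e) := fun e => by
    by_cases h : ∃ i, ε i = e
    · obtain ⟨i, rfl⟩ := h
      rw [lab_ε, lab_ε']
    by_cases h' : ∃ i, S.opp (ε i) = e
    · obtain ⟨i, rfl⟩ := h'
      rw [S.opp_opp, lab_ε, lab_ε', D.dual_dual]
    rw [lab_off e (not_exists.1 h) (not_exists.1 h'), lab_off (S.opp e)]
    · exact (hlab e (not_exists.1 h) (not_exists.1 h')).2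
    · exact fun i hi => h' ⟨i, by rw [hi, S.opp_opp]⟩
    · exact fun i hi => h ⟨i, S.opp_injective hi⟩
  have off : ∀ t, (∀ k, τ k ≠ t) → br₀ t ≤ D.δ (lab (t, 0)) (lab (t, 1)) (lab (t, 2)) := by
    intro t ht
    have h3 : ∀ j, lab (t, j) = lab₀ (t, j) := fun j => by
      refine lab_off _ (fun i hi => ?_) (fun i hi => ?_)
      · obtain ⟨k, hk⟩ := h1 i
        exact ht k (by rw [hk, hi])
      · obtain ⟨k, hk⟩ := h2 i
        exact ht k (by rw [hk, hi])
    rw [h3, h3, h3]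
    exact hbr t ht
  let ρ₀ : LWState D Φ :=
    { lab := lab, lab_mem := lab_mem, lab_opp := lab_opp
      br := fun t => if ∃ k, τ k = t then 0 else br₀ t
      br_le := fun t => by
        split_ifs with h
        · exact Nat.zero_le _
        · exact off t (not_exists.1 h) }
  have hr₀ := hr ρ₀ ⟨lab_off, fun t ht => if_neg (not_exists.2 ht)⟩
  have hx₀ : (fun i => ρ₀.lab (ε i)) = x := funext lab_ε
  rw [hx₀] at hr₀
  refine ⟨{ lab := lab, lab_mem := lab_mem, lab_opp := lab_opp
            br := fun t => if h : ∃ k, τ k = t then c h.choose else br₀ t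
            br_le := fun t => ?_ }, ⟨lab_off, fun t ht => dif_neg (not_exists.2 ht)⟩, lab_ε,
            fun k => ?_⟩
  · split_ifs with h
    · have := hr₀ h.choose
      rw [h.choose_spec] at this
      exact (hc _).trans_eq this
    · exact off t (not_exists.1 h)
  · have h : ∃ k', τ k' = τ k := ⟨k, rfl⟩
    simp only [dif_pos h, hτ h.choose_spec]

/-- A sum over states that have fixed labels away from the edges `ε` and the vertices `τ`. -/
theorem sum_eq_sum_patch [Finite F] [Fintype ι] [DecidableEq ι] [Fintype κ] [DecidableEq κ]
    (hε : Function.Injective ε) (hε' : ∀ i j, S.opp (ε i) ≠ ε j)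
    (hτ : Function.Injective τ) (h1 : ∀ i, ∃ k, τ k = (ε i).1)
    (h2 : ∀ i, ∃ k, τ k = (S.opp (ε i)).1) (lab₀ : F × Fin 3 → A) (br₀ : F → ℕ)
    (hlab : ∀ e, (∀ i, ε i ≠ e) → (∀ i, S.opp (ε i) ≠ e) → lab₀ e ∈ D.I (Φ.val e) ∧
      lab₀ (S.opp e) = D.dual (lab₀ e))
    (hbr : ∀ t, (∀ k, τ k ≠ t) → br₀ t ≤ D.δ (lab₀ (t, 0)) (lab₀ (t, 1)) (lab₀ (t, 2)))
    (r : (ι → A) → κ → ℕ)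
    (hr : ∀ ρ : LWState D Φ, AgreesOff ε τ lab₀ br₀ ρ → ∀ k, r (fun i => ρ.lab (ε i)) k =
      D.δ (ρ.lab (τ k, 0)) (ρ.lab (τ k, 1)) (ρ.lab (τ k, 2)))
    (f : LWState D Φ → K) (f₀ : (ι → A) → (κ → ℕ) → K)
    (hf : ∀ ρ, f ρ ≠ 0 → AgreesOff ε τ lab₀ br₀ ρ ∧ ∀ k, 1 ≤ ρ.br (τ k))
    (hf₀ : ∀ ρ, AgreesOff ε τ lab₀ br₀ ρ →
      f ρ = f₀ (fun i => ρ.lab (ε i)) (fun k => ρ.br (τ k))) :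
    ∑ ρ, f ρ = ∑ x ∈ Fintype.piFinset fun i => D.I (Φ.val (ε i)),
      ∑ c ∈ Fintype.piFinset fun k => Finset.Icc 1 (r x k), f₀ x c := by
  classical
  rw [← Finset.sum_subset (Finset.filter_subset
      (fun ρ => AgreesOff ε τ lab₀ br₀ ρ ∧ ∀ k, 1 ≤ ρ.br (τ k)) Finset.univ)
      (fun ρ _ h => by
        by_contra h'
        exact h (Finset.mem_filter.2 ⟨Finset.mem_univ _, hf ρ h'⟩)), Finset.sum_sigma']
  refine Finset.sum_bij
    (fun ρ _ => ⟨fun i => ρ.lab (ε i), fun k => ρ.br (τ k)⟩) ?_ ?_ ?_ ?_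
  · intro ρ h
    obtain ⟨h, h'⟩ := (Finset.mem_filter.1 h).2
    simp only [Finset.mem_sigma, Fintype.mem_piFinset, Finset.mem_Icc]
    refine ⟨fun i => ρ.lab_mem _, fun k => ⟨h' k, ?_⟩⟩
    rw [hr ρ h k]
    exact ρ.br_le _
  · intro ρ h ρ' h' heq
    obtain ⟨h, -⟩ := (Finset.mem_filter.1 h).2
    obtain ⟨h', -⟩ := (Finset.mem_filter.1 h').2
    have e1 : ∀ i, ρ.lab (ε i) = ρ'.lab (ε i) := fun i =>
      congrArg (fun w : (Σ _ : ι → A, κ → ℕ) => w.1 i) heq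
    have e2 : ∀ k, ρ.br (τ k) = ρ'.br (τ k) := fun k =>
      congrArg (fun w : (Σ _ : ι → A, κ → ℕ) => w.2 k) heq
    refine LWState.ext (funext fun e => ?_) (funext fun t => ?_)
    · by_cases h3 : ∃ i, ε i = e
      · obtain ⟨i, rfl⟩ := h3
        exact e1 i
      by_cases h4 : ∃ i, S.opp (ε i) = e
      · obtain ⟨i, rfl⟩ := h4
        rw [ρ.lab_opp, ρ'.lab_opp, e1]
      rw [h.1 e (not_exists.1 h3) (not_exists.1 h4), h'.1 e (not_exists.1 h3) (not_exists.1 h4)]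
    · by_cases h3 : ∃ k, τ k = t
      · obtain ⟨k, rfl⟩ := h3
        exact e2 k
      rw [h.2 t (not_exists.1 h3), h'.2 t (not_exists.1 h3)]
  · rintro ⟨x, c⟩ hw
    simp only [Finset.mem_sigma, Fintype.mem_piFinset, Finset.mem_Icc] at hw
    obtain ⟨ρ, ha, hx, hc⟩ := exists_patch hε hε' hτ h1 h2 lab₀ br₀ hlab hbr r hr x hw.1 c
      fun k => (hw.2 k).2
    have hx' : (fun i => ρ.lab (ε i)) = x := funext hx
    have hc' : (fun k => ρ.br (τ k)) = c := funext hc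
    refine ⟨ρ, Finset.mem_filter.2 ⟨Finset.mem_univ _, ha, fun k => ?_⟩, by rw [hx', hc']⟩
    rw [hc]; exact (hw.2 k).1
  · intro ρ h
    exact hf₀ ρ (Finset.mem_filter.1 h).2.1

end LWState

/-! ### Plaquette operators in terms of the labels around the plaquette -/

namespace LWData

variable {K : Type*} [Field K] [StarRing K] {G : Type*} [AddCommGroup G] {A : Type*}
  (D : LWData K G A) {E : Type*} [Fintype E] [DecidableEq E] (nx : Equiv.Perm E)

theorem ranges_of_N_ne_zero {j₁ j₂ j₃ j₄ j₅ j₆ : A} {a₁ a₂ a₃ a₄ : ℕ}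
    (h : D.N j₁ j₂ j₃ j₄ j₅ j₆ a₁ a₂ a₃ a₄ ≠ 0) :
    (1 ≤ a₁ ∧ a₁ ≤ D.δ j₁ j₂ (D.dual j₃)) ∧ (1 ≤ a₂ ∧ a₂ ≤ D.δ j₃ j₄ (D.dual j₅)) ∧
      (1 ≤ a₃ ∧ a₃ ≤ D.δ j₅ (D.dual j₆) (D.dual j₁)) ∧
      (1 ≤ a₄ ∧ a₄ ≤ D.δ j₆ (D.dual j₄) (D.dual j₂)) :=
  not_imp_comm.1 (D.N_zero _ _ _ _ _ _ _ _ _ _) h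

theorem one_le_of_ringCoeff_ne_zero {k : E → A} {s : A} {y x : E → A} {c' c : E → ℕ}
    (h : D.ringCoeff nx k s y x c' c ≠ 0) (e : E) : 1 ≤ c e ∧ 1 ≤ c' e := by
  obtain ⟨a, -, ha⟩ := Finset.exists_ne_zero_of_sum_ne_zero h
  have h1 := right_ne_zero_of_mul (Finset.prod_ne_zero_iff.1 ha e (Finset.mem_univ e))
  have h2 := D.ranges_of_N_ne_zero h1
  exact ⟨h2.2.1.1, h2.2.2.1.1⟩

end LWData

theorem Fintype.sum_piFinset_subtype {α K : Type*} [Fintype α] [DecidableEq α] [AddCommMonoid K]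
    (q : α → Prop) [DecidablePred q] (t : α → Finset ℕ) (f : ({a // q a} → ℕ) → K) :
    ∑ x ∈ Fintype.piFinset fun a => if q a then t a else {0}, f (fun a => x a.1)
      = ∑ x ∈ Fintype.piFinset fun a : {a // q a} => t a.1, f x := by
  refine Finset.sum_bij' (fun x _ a => x a.1) (fun x _ a => if h : q a then x ⟨a, h⟩ else 0)
    ?_ ?_ ?_ ?_ ?_
  · intro x hx
    rw [Fintype.mem_piFinset] at hx ⊢
    intro a
    have := hx a.1
    rwa [if_pos a.2] at this
  · intro x hx
    rw [Fintype.mem_piFinset] at hx ⊢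
    intro a
    split_ifs with h
    · exact hx ⟨a, h⟩
    · exact Finset.mem_singleton_self 0
  · intro x hx
    rw [Fintype.mem_piFinset] at hx
    funext a
    have := hx a
    split_ifs with h
    · rfl
    · rw [if_neg h, Finset.mem_singleton] at this
      exact this.symm
  · intro x _
    exact funext fun a => dif_pos a.2
  · intro x _
    rfl

namespace LW

variable {G : Type*} [AddCommGroup G] {A : Type*} {D : LWData ℂ G A}
  {V F : Type*} {S : TriangulatedSurface V F} {Φ Φ' Φ'' : GColoring S G}

/-- The labels of the edges on the boundary of a plaquette. -/
def rimLab (p : V) (σ : LWState D Φ) (e : S.Spoke p) : A := σ.lab e.1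

/-- The labels of the third legs at the vertices on the boundary of a plaquette. -/
def legLab (p : V) (σ : LWState D Φ) (e : S.Spoke p) : A := σ.lab (e.1.1, e.1.2 + 1)

/-- The branching labels of the vertices on the boundary of a plaquette. -/
def rimBr (p : V) (σ : LWState D Φ) (e : S.Spoke p) : ℕ := σ.br e.1.1

/-- Two states agree away from the boundary of the plaquette `p`. -/
def AgreeAway (p : V) (σ' : LWState D Φ') (σ : LWState D Φ) : Prop :=
  (∀ e, S.src e ≠ p → S.tgt e ≠ p → σ'.lab e = σ.lab e) ∧
    ∀ t, (∀ i, S.vert t i ≠ p) → σ'.br t = σ.br t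

theorem AgreeAway.symm {p : V} {σ' : LWState D Φ'} {σ : LWState D Φ} (h : AgreeAway p σ' σ) :
    AgreeAway p σ σ' :=
  ⟨fun e h1 h2 => (h.1 e h1 h2).symm, fun t h1 => (h.2 t h1).symm⟩

theorem AgreeAway.trans {p : V} {σ'' : LWState D Φ''} {σ' : LWState D Φ'} {σ : LWState D Φ}
    (h : AgreeAway p σ'' σ') (h' : AgreeAway p σ' σ) : AgreeAway p σ'' σ :=
  ⟨fun e h1 h2 => (h.1 e h1 h2).trans (h'.1 e h1 h2), fun t h1 => (h.2 t h1).trans (h'.2 t h1)⟩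

theorem AgreeAway.legLab_eq {p : V} {σ' : LWState D Φ'} {σ : LWState D Φ}
    (h : AgreeAway p σ' σ) : legLab p σ' = legLab p σ :=
  funext fun e => h.1 _ (S.third_not_mem p e).1 (S.third_not_mem p e).2

theorem agreesOff_iff {p : V} {ρ : LWState D Φ'} {σ : LWState D Φ} :
    LWState.AgreesOff (fun e : S.Spoke p => e.1) (fun e : S.Spoke p => e.1.1) σ.lab σ.br ρ ↔
      AgreeAway p ρ σ := by
  constructor
  · rintro ⟨h1, h2⟩
    refine ⟨fun e h h' => ?_, fun t ht => h2 t ((S.face_not_mem_iff_spoke p t).1 ht)⟩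
    obtain ⟨h3, h4⟩ := (S.not_mem_iff_spoke p e).1 ⟨h, h'⟩
    exact h1 e h3 h4
  · rintro ⟨h1, h2⟩
    refine ⟨fun e h h' => ?_, fun t ht => h2 t ((S.face_not_mem_iff_spoke p t).2 ht)⟩
    obtain ⟨h3, h4⟩ := (S.not_mem_iff_spoke p e).2 ⟨h, h'⟩
    exact h1 e h3 h4

variable [DecidableEq V] [Fintype F] [DecidableEq F]

open Classical in
theorem plaquetteCoeff_eq (p : V) (s : A) (σ' : LWState D Φ') (σ : LWState D Φ) :
    plaquetteCoeff D p s σ' σ = if AgreeAway p σ' σ then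
      D.ringCoeff (S.nextPerm p) (legLab p σ) s (rimLab p σ') (rimLab p σ) (rimBr p σ')
        (rimBr p σ) else 0 := by
  unfold plaquetteCoeff
  by_cases h : AgreeAway p σ' σ
  swap
  · rw [if_neg h]; exact if_neg h
  rw [if_pos h]
  refine (if_pos h).trans ?_
  have key := Fintype.sum_piFinset_subtype (fun e : F × Fin 3 => S.src e = p)
    (fun e => Finset.Icc 1 (D.δ (D.dual (σ'.lab e)) s (σ.lab e)))
    (fun a => ∏ e : S.Spoke p, (D.d (rimLab p σ' (S.nextPerm p e)) *
      D.N (D.dual (rimLab p σ' (S.nextPerm p e))) s (D.dual (rimLab p σ (S.nextPerm p e)))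
        (rimLab p σ e) (D.dual (legLab p σ e)) (rimLab p σ' e)
        (a (S.nextPerm p e)) (rimBr p σ e) (rimBr p σ' e) (a e)))
  refine Eq.trans ?_ (key.trans ?_)
  · refine Finset.sum_congr ?_ fun a _ => ?_
    · congr!
    rw [Finset.prod_subtype (p := fun e => S.src e = p) _ (fun e => by simp)]
    refine Finset.prod_congr rfl fun e _ => ?_
    rw [σ'.lab_add_two, σ.lab_add_two, D.d_dual]
    rfl
  · refine Finset.sum_congr rfl fun a _ => ?_
    rw [Finset.prod_mul_distrib, Finset.prod_mul_distrib,
      Equiv.prod_comp (S.nextPerm p) fun e => D.d (rimLab p σ' e)]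

theorem agreeAway_of_plaquetteCoeff_ne_zero {p : V} {s : A} {σ' : LWState D Φ'}
    {σ : LWState D Φ} (h : plaquetteCoeff D p s σ' σ ≠ 0) : AgreeAway p σ' σ := by
  classical
  rw [plaquetteCoeff_eq] at h
  exact of_not_not fun h' => h (if_neg h')

theorem one_le_of_plaquetteCoeff_ne_zero {p : V} {s : A} {σ' : LWState D Φ'}
    {σ : LWState D Φ} (h : plaquetteCoeff D p s σ' σ ≠ 0) (e : S.Spoke p) :
    1 ≤ σ.br e.1.1 ∧ 1 ≤ σ'.br e.1.1 := by
  classical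
  have ha := agreeAway_of_plaquetteCoeff_ne_zero h
  rw [plaquetteCoeff_eq, if_pos ha] at h
  have h1 := D.one_le_of_ringCoeff_ne_zero (S.nextPerm p) h e
  exact h1

open Classical in
/-- Matrix coefficients of the composite of two plaquette operators at the same plaquette. -/
theorem sum_plaquetteCoeff_mul (p : V) (s₁ s₂ : A)
    (hΦ : ∀ e, S.src e ≠ p → S.tgt e ≠ p → Φ'.val e = Φ.val e)
    (σ'' : LWState D Φ'') (σ : LWState D Φ) :
    ∑ ρ : LWState D Φ', plaquetteCoeff D p s₁ σ'' ρ * plaquetteCoeff D p s₂ ρ σ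
      = if AgreeAway p σ'' σ then
        ∑ m ∈ Fintype.piFinset fun e : S.Spoke p => D.I (Φ'.val e.1),
        ∑ c ∈ Fintype.piFinset fun e => Finset.Icc 1
          (D.δ (m e) (legLab p σ e) (D.dual (m (S.nextPerm p e)))),
        D.ringCoeff (S.nextPerm p) (legLab p σ) s₁ (rimLab p σ'') m (rimBr p σ'') c *
          D.ringCoeff (S.nextPerm p) (legLab p σ) s₂ m (rimLab p σ) c (rimBr p σ)
        else 0 := by
  split_ifs with h
  · refine LWState.sum_eq_sum_patch (ε := fun e : S.Spoke p => e.1)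
      (τ := fun e : S.Spoke p => e.1.1) Subtype.val_injective (S.opp_spoke_ne p)
      (S.spoke_face_injective p) (fun e => ⟨e, rfl⟩) (S.spoke_opp_face p) σ.lab σ.br ?_
      (fun t _ => σ.br_le t)
      (fun m e => D.δ (m e) (legLab p σ e) (D.dual (m (S.nextPerm p e)))) ?_ _
      (fun m c => D.ringCoeff (S.nextPerm p) (legLab p σ) s₁ (rimLab p σ'') m (rimBr p σ'') c *
          D.ringCoeff (S.nextPerm p) (legLab p σ) s₂ m (rimLab p σ) c (rimBr p σ)) ?_ ?_
    · intro e h1 h2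
      obtain ⟨h3, h4⟩ := (S.not_mem_iff_spoke p e).2 ⟨h1, h2⟩
      exact ⟨by rw [hΦ e h3 h4]; exact σ.lab_mem e, σ.lab_opp e⟩
    · intro ρ hρ e
      rw [agreesOff_iff] at hρ
      rw [ρ.δ_rot_lab e.1.1 e.1.2, ρ.lab_add_two, ← hρ.legLab_eq]
      rfl
    · intro ρ hρ
      refine ⟨agreesOff_iff.2 (agreeAway_of_plaquetteCoeff_ne_zero (right_ne_zero_of_mul hρ)),
        fun e => (one_le_of_plaquetteCoeff_ne_zero (left_ne_zero_of_mul hρ) e).1⟩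
    · intro ρ hρ
      rw [agreesOff_iff] at hρ
      rw [plaquetteCoeff_eq, plaquetteCoeff_eq, if_pos hρ, if_pos (h.trans hρ.symm), hρ.legLab_eq]
      rfl
  · refine Finset.sum_eq_zero fun ρ _ => ?_
    by_contra h'
    exact h ((agreeAway_of_plaquetteCoeff_ne_zero (left_ne_zero_of_mul h')).trans
      (agreeAway_of_plaquetteCoeff_ne_zero (right_ne_zero_of_mul h')))

/-- Fusion of plaquette operators. -/
theorem sum_plaquetteCoeff_mul_eq_fusion (p : V) (s₁ s₂ : A)
    (h₁₂ : D.deg s₁ + D.deg s₂ ∉ D.X) (hΦ' : Φ'.Admissible D.X)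
    (hΦ : Φ' = Φ.addPlaquette (D.deg s₂) p)
    (σ'' : LWState D Φ'') (σ : LWState D Φ) :
    ∑ ρ : LWState D Φ', plaquetteCoeff D p s₁ σ'' ρ * plaquetteCoeff D p s₂ ρ σ
      = ∑ u ∈ D.I (D.deg s₁ + D.deg s₂), (D.δ s₁ s₂ (D.dual u) : ℂ) *
        plaquetteCoeff D p u σ'' σ := by
  classical
  have hval : ∀ e : S.Spoke p, Φ'.val e.1 = D.deg s₂ + D.deg (rimLab p σ e) := fun e => by
    have h1 : S.tgt e.1 ≠ p := fun h => S.src_ne_tgt e.1 (e.2.trans h.symm)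
    rw [hΦ, rimLab, σ.deg_lab]
    simp [GColoring.addPlaquette, e.2, h1, add_comm]
  rw [sum_plaquetteCoeff_mul p s₁ s₂ (fun e h1 h2 => by
    rw [hΦ]; simp [GColoring.addPlaquette, h1, h2])]
  split_ifs with h
  · simp only [hval]
    rw [D.ringCoeff_comp _ (S.nextPerm_transitive p) _ _ _ _ _ _ _ h₁₂
      (fun e => by rw [← hval]; exact hΦ' _)]
    simp only [plaquetteCoeff_eq, if_pos h]
  · simp only [plaquetteCoeff_eq, if_neg h, mul_zero, Finset.sum_const_zero]

end LW

/-! ### Fusion of the operators `B_p^g` -/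

namespace LW

variable {G : Type*} [AddCommGroup G] {A : Type*} {D : LWData ℂ G A}
  {V F : Type*} {S : TriangulatedSurface V F} {Φ Φ' Φ'' : GColoring S G}

theorem neg_not_mem_X {g : G} (h : g ∉ D.X) : -g ∉ D.X := fun h' =>
  h (by simpa using D.X_symm _ h')

theorem sub_not_mem_X_comm {g h : G} (hgh : g - h ∉ D.X) : h - g ∉ D.X := by
  rw [← neg_sub]; exact neg_not_mem_X hgh

variable [DecidableEq V]

theorem addPlaquette_addPlaquette (Φ : GColoring S G) (g h : G) (p : V) :
    (Φ.addPlaquette g p).addPlaquette h p = Φ.addPlaquette (g + h) p := by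
  ext e
  simp only [GColoring.addPlaquette]
  split_ifs <;> abel

theorem addPlaquette_zero (Φ : GColoring S G) (p : V) : Φ.addPlaquette 0 p = Φ := by
  ext e
  simp [GColoring.addPlaquette]

theorem addPlaquette_comm (Φ : GColoring S G) (g h : G) (p q : V) :
    (Φ.addPlaquette g p).addPlaquette h q = (Φ.addPlaquette h q).addPlaquette g p := by
  ext e
  simp only [GColoring.addPlaquette]
  abel

theorem genericAt_of_forall (hΦ : Φ.Admissible D.X) (p : V) (g : G) (h0 : g ∉ D.X)
    (h : ∀ e, ∀ x ∈ D.X, g ≠ Φ.val e + x) : GenericAt D Φ p g := by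
  refine ⟨h0, fun e he => ?_⟩
  by_cases h1 : S.src e = p
  · have h2 : S.tgt e ≠ p := fun h => S.src_ne_tgt e (h1.trans h.symm)
    have h3 : Φ.val e - g ∈ D.X := by
      simpa [GColoring.addPlaquette, h1, h2, sub_eq_add_neg] using he
    exact h e _ (D.X_symm _ h3) (by abel)
  · by_cases h2 : S.tgt e = p
    · have h3 : Φ.val e + g ∈ D.X := by
        simpa [GColoring.addPlaquette, h1, h2] using he
      refine h (S.opp e) _ h3 ?_
      rw [Φ.val_opp]; abel
    · exact hΦ e (by simpa [GColoring.addPlaquette, h1, h2] using he)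

/-- Degrees that are generic with respect to two colorings and two given degrees. -/
theorem exists_genericAt₂ [Finite F] (hΦ : Φ.Admissible D.X) (hΦ' : Φ'.Admissible D.X) (p : V)
    (g h : G) : ∃ k, GenericAt D Φ p k ∧ GenericAt D Φ' p k ∧ g - k ∉ D.X ∧ h - k ∉ D.X := by
  classical
  have := Fintype.ofFinite F
  obtain ⟨k, hk⟩ := D.X_small (insert 0 (insert g (insert h
    (Finset.univ.image Φ.val ∪ Finset.univ.image Φ'.val))))
  have h0 : k ∉ D.X := fun h => hk 0 (by simp) k h (by simp)
  refine ⟨k, genericAt_of_forall hΦ p k h0 fun e => hk _ (by simp),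
    genericAt_of_forall hΦ' p k h0 fun e => hk _ (by simp), fun h' => ?_, fun h' => ?_⟩
  · exact hk g (by simp) _ (D.X_symm _ h') (by abel)
  · exact hk h (by simp) _ (D.X_symm _ h') (by abel)

variable [Fintype F] [DecidableEq F]

/-- The matrix of `B_p^g`. -/
noncomputable def degMatrix (D : LWData ℂ G A) (p : V) (g : G) (Φ Φ' : GColoring S G) :
    Matrix (LWState D Φ') (LWState D Φ) ℂ :=
  Matrix.of fun σ' σ => ∑ s ∈ D.I g, D.b s * plaquetteCoeff D p s σ' σ

theorem plaquetteDegOp_eq (p : V) (g : G) (Φ Φ' : GColoring S G) :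
    plaquetteDegOp D p g Φ Φ' = Matrix.toEuclideanLin (degMatrix D p g Φ Φ') := by
  have : degMatrix D p g Φ Φ' = ∑ s ∈ D.I g, D.b s •
      Matrix.of fun σ' σ => plaquetteCoeff D p s σ' σ := by
    ext σ' σ
    simp [degMatrix, Matrix.sum_apply]
  rw [this, map_sum]
  simp only [map_smul]
  rfl

theorem toEuclideanLin_comp {l m n : Type*} [Fintype l] [Fintype m] [Fintype n] [DecidableEq l]
    [DecidableEq m] [DecidableEq n] (M : Matrix l m ℂ) (N : Matrix m n ℂ) :
    Matrix.toEuclideanLin M ∘ₗ Matrix.toEuclideanLin N = Matrix.toEuclideanLin (M * N) := by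
  refine LinearMap.ext fun ψ => ?_
  simp [Matrix.toEuclideanLin, Matrix.toLpLin_apply, Matrix.mulVec_mulVec]

theorem toEuclideanLin_single {m n : Type*} [Fintype m] [Fintype n] [DecidableEq m]
    [DecidableEq n] (M : Matrix m n ℂ) (i : m) (j : n) :
    Matrix.toEuclideanLin M (EuclideanSpace.single j 1) i = M i j := by
  simp [Matrix.toEuclideanLin, Matrix.toLpLin_apply]

theorem plaquetteDegOp_comp (p : V) (g₁ g₂ : G) (h₁ : g₁ ∉ D.X) (h₂ : g₂ ∉ D.X)
    (h₁₂ : g₁ + g₂ ∉ D.X) (hΦ' : Φ'.Admissible D.X) (hΦ : Φ' = Φ.addPlaquette g₂ p) :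
    plaquetteDegOp D p g₁ Φ' Φ'' ∘ₗ plaquetteDegOp D p g₂ Φ Φ'
      = plaquetteDegOp D p (g₁ + g₂) Φ Φ'' := by
  simp only [plaquetteDegOp_eq, toEuclideanLin_comp]
  congr 1
  ext σ'' σ
  simp only [Matrix.mul_apply, degMatrix, Matrix.of_apply, Finset.sum_mul_sum]
  rw [Finset.sum_comm]
  have h3 : ∀ s₁ ∈ D.I g₁, ∑ ρ : LWState D Φ', ∑ s₂ ∈ D.I g₂,
      D.b s₁ * plaquetteCoeff D p s₁ σ'' ρ * (D.b s₂ * plaquetteCoeff D p s₂ ρ σ)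
      = ∑ s₂ ∈ D.I g₂, ∑ u ∈ D.I (g₁ + g₂), D.b s₁ * D.b s₂ * (D.δ (D.dual u) s₁ s₂ : ℂ) *
          plaquetteCoeff D p u σ'' σ := by
    intro s₁ hs₁
    rw [Finset.sum_comm]
    refine Finset.sum_congr rfl fun s₂ hs₂ => ?_
    rw [D.mem_I] at hs₁ hs₂
    have h4 := sum_plaquetteCoeff_mul_eq_fusion (Φ := Φ) (Φ' := Φ') p s₁ s₂
      (by rwa [hs₁, hs₂]) hΦ' (by rwa [hs₂]) σ'' σ
    rw [hs₁, hs₂] at h4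
    calc _ = D.b s₁ * D.b s₂ * ∑ ρ : LWState D Φ',
          plaquetteCoeff D p s₁ σ'' ρ * plaquetteCoeff D p s₂ ρ σ := by
          rw [Finset.mul_sum]
          exact Finset.sum_congr rfl fun ρ _ => by ring
      _ = _ := by
          rw [h4, Finset.mul_sum]
          refine Finset.sum_congr rfl fun u _ => ?_
          rw [D.δ_rot' s₁ s₂]; ring
  rw [Finset.sum_congr rfl h3]
  have h5 : ∀ u ∈ D.I (g₁ + g₂), D.b u * plaquetteCoeff D p u σ'' σ
      = ∑ s₁ ∈ D.I g₁, ∑ s₂ ∈ D.I g₂, D.b s₁ * D.b s₂ * (D.δ (D.dual u) s₁ s₂ : ℂ) *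
          plaquetteCoeff D p u σ'' σ := by
    intro u hu
    rw [D.b_fusion g₁ g₂ h₁ h₂ h₁₂ u hu, Finset.sum_mul]
    simp only [Finset.sum_mul]
  rw [Finset.sum_congr rfl h5]
  exact (Finset.sum_congr rfl fun s₁ _ => Finset.sum_comm).trans Finset.sum_comm

theorem plaquetteComp_eq_of_sub (p : V) {g h : G} (hg : GenericAt D Φ p g)
    (hh : GenericAt D Φ p h) (hgh : g - h ∉ D.X) :
    plaquetteComp D Φ p g = plaquetteComp D Φ p h := by
  have e1 : g - h + -g = -h := by abel
  have e2 : h + (g - h) = g := by abel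
  have h1 := plaquetteDegOp_comp (D := D) (Φ := Φ) (Φ' := Φ.addPlaquette (-g) p)
    (Φ'' := Φ.addPlaquette (-h) p) p (g - h) (-g) hgh (neg_not_mem_X hg.1)
    (by rw [e1]; exact neg_not_mem_X hh.1) hg.2 rfl
  have h2 := plaquetteDegOp_comp (D := D) (Φ := Φ.addPlaquette (-g) p)
    (Φ' := Φ.addPlaquette (-h) p) (Φ'' := Φ) p h (g - h) hh.1 hgh
    (by rw [e2]; exact hg.1) hh.2
    (by rw [addPlaquette_addPlaquette]; congr 1; abel)
  rw [e1] at h1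
  rw [e2] at h2
  rw [plaquetteComp, plaquetteComp, ← h1, ← h2, LinearMap.comp_assoc]

theorem plaquetteComp_eq (hΦ : Φ.Admissible D.X) (p : V) {g h : G} (hg : GenericAt D Φ p g)
    (hh : GenericAt D Φ p h) : plaquetteComp D Φ p g = plaquetteComp D Φ p h := by
  obtain ⟨k, hk, -, h1, h2⟩ := exists_genericAt₂ (D := D) hΦ hΦ p g h
  rw [plaquetteComp_eq_of_sub p hg hk h1, plaquetteComp_eq_of_sub p hh hk h2]

theorem plaquetteComp_mul_self (hΦ : Φ.Admissible D.X) (p : V) {g : G}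
    (hg : GenericAt D Φ p g) :
    plaquetteComp D Φ p g * plaquetteComp D Φ p g = plaquetteComp D Φ p g := by
  obtain ⟨h, hh, -, h1, -⟩ := exists_genericAt₂ (D := D) hΦ hΦ p g g
  have hhg : -g + h ∉ D.X := by rw [neg_add_eq_sub]; exact sub_not_mem_X_comm h1
  have e1 : -g + h + -h = -g := by abel
  have h2 := plaquetteDegOp_comp (D := D) (Φ := Φ.addPlaquette (-h) p)
    (Φ' := Φ) (Φ'' := Φ.addPlaquette (-g) p) p (-g) h (neg_not_mem_X hg.1) hh.1 hhg hΦ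
    (by rw [addPlaquette_addPlaquette, neg_add_cancel, addPlaquette_zero])
  have h3 := plaquetteDegOp_comp (D := D) (Φ := Φ)
    (Φ' := Φ.addPlaquette (-h) p) (Φ'' := Φ.addPlaquette (-g) p) p (-g + h) (-h) hhg
    (neg_not_mem_X hh.1) (by rw [e1]; exact neg_not_mem_X hg.1) hh.2 rfl
  rw [e1] at h3
  nth_rw 2 [plaquetteComp_eq hΦ p hg hh]
  rw [Module.End.mul_eq_comp, plaquetteComp, plaquetteComp, LinearMap.comp_assoc,
    ← LinearMap.comp_assoc (plaquetteDegOp D p (-h) _ _), h2, h3]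

end LW

/-! ### Hermiticity -/

namespace LWData

section

variable {K : Type*} [Field K] [StarRing K] {G : Type*} [AddCommGroup G] {A : Type*}
  (D : LWData K G A)

/-- The value `γ^n_{i,j,k}` does not change under rotations. -/
def GammaRot (i j k : A) (n : ℕ) : Prop :=
  D.γ i j k n = D.γ j k i n ∧ D.γ i j k n = D.γ k i j n

variable {D}

theorem GammaRot.rot {i j k : A} {n : ℕ} (h : D.GammaRot i j k n) : D.GammaRot j k i n :=
  ⟨h.1.symm.trans h.2, h.1.symm⟩

theorem GammaRot.of_dual {i j k : A} {n : ℕ} (h : D.GammaRot (D.dual k) (D.dual j) (D.dual i) n)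
    (h1 : 1 ≤ n) (h2 : n ≤ D.δ i j k) : D.GammaRot i j k n := by
  have t1 := D.γ_theta i j k n h1 h2
  have t2 := D.γ_theta j k i n h1 (by rwa [← D.δ_rot])
  have t3 := D.γ_theta k i j n h1 (by rwa [D.δ_rot'] at h2)
  have h0 : D.γ (D.dual k) (D.dual j) (D.dual i) n * (D.β i * D.β j * D.β k) ≠ 0 := by
    intro h'
    have : D.γ i j k n * (D.γ (D.dual k) (D.dual j) (D.dual i) n * (D.β i * D.β j * D.β k)) = 1 := by
      rw [← t1]; ring
    rw [h', mul_zero] at this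
    exact zero_ne_one this
  rw [← h.2] at t2
  rw [← h.1] at t3
  constructor
  · apply mul_right_cancel₀ h0
    linear_combination t1 - t2
  · apply mul_right_cancel₀ h0
    linear_combination t1 - t3

theorem star_ne_zero_of_N_ne_zero {j₁ j₂ j₃ j₄ j₅ j₆ : A} {a₁ a₂ a₃ a₄ : ℕ}
    (h : D.N j₁ j₂ j₃ j₄ j₅ j₆ a₁ a₂ a₃ a₄ ≠ 0) :
    D.N (D.dual j₂) (D.dual j₁) (D.dual j₃) j₅ j₄ j₆ a₁ a₂ a₄ a₃ ≠ 0 := by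
  intro h'
  have := D.N_star j₁ j₂ j₃ j₄ j₅ j₆ a₁ a₂ a₃ a₄
  rw [h'] at this
  simp only [zero_mul] at this
  exact h (star_eq_zero.1 this)

/-- Where the 6j-symbol does not vanish, its behaviour under the involution forces `γ` to be
invariant under rotations. -/
theorem gamma_rot_of_N_ne_zero {j₁ j₂ j₃ j₄ j₅ j₆ : A} {a₁ a₂ a₃ a₄ : ℕ}
    (h : D.N j₁ j₂ j₃ j₄ j₅ j₆ a₁ a₂ a₃ a₄ ≠ 0) :
    D.γ j₁ j₂ (D.dual j₃) a₁ = D.γ j₂ (D.dual j₃) j₁ a₁ := by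
  have h1 := D.N_star j₁ j₂ j₃ j₄ j₅ j₆ a₁ a₂ a₃ a₄
  have h2 := D.N_star j₂ (D.dual j₃) (D.dual j₁) j₅ j₆ j₄ a₁ a₃ a₄ a₂
  rw [← D.N_symm₁, D.N_symm₁ (D.dual (D.dual j₃))] at h2
  simp only [D.dual_dual, D.β_dual] at h2
  rw [h1] at h2
  have h3 := star_ne_zero_of_N_ne_zero h
  have h4 : star (D.N j₁ j₂ j₃ j₄ j₅ j₆ a₁ a₂ a₃ a₄) ≠ 0 := star_ne_zero.2 h
  rw [h1] at h4
  simp only [ne_eq, mul_eq_zero, not_or] at h4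
  obtain ⟨⟨⟨⟨⟨n0, n1⟩, n2⟩, n3⟩, n4⟩, n5⟩ := h4
  have n6 : D.β j₁ * D.β j₂ * D.β j₃ * D.β j₄ * D.β j₅ * D.β j₆ ≠ 0 := by
    simp only [ne_eq, mul_eq_zero, not_or]; exact n5
  apply mul_right_cancel₀ (mul_ne_zero (mul_ne_zero (mul_ne_zero (mul_ne_zero n0 n2) n3) n4) n6)
  linear_combination h2

theorem gammaRot₁_of_N_ne_zero {j₁ j₂ j₃ j₄ j₅ j₆ : A} {a₁ a₂ a₃ a₄ : ℕ}
    (h : D.N j₁ j₂ j₃ j₄ j₅ j₆ a₁ a₂ a₃ a₄ ≠ 0) : D.GammaRot j₁ j₂ (D.dual j₃) a₁ := by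
  have h1 := gamma_rot_of_N_ne_zero h
  rw [D.N_symm₁] at h
  have h2 := gamma_rot_of_N_ne_zero h
  rw [D.dual_dual] at h2
  exact ⟨h1, h1.trans h2⟩

theorem gammaRot_of_N_ne_zero {j₁ j₂ j₃ j₄ j₅ j₆ : A} {a₁ a₂ a₃ a₄ : ℕ}
    (h : D.N j₁ j₂ j₃ j₄ j₅ j₆ a₁ a₂ a₃ a₄ ≠ 0) : D.GammaRot j₁ j₂ (D.dual j₃) a₁ ∧
      D.GammaRot j₃ j₄ (D.dual j₅) a₂ ∧ D.GammaRot j₅ (D.dual j₆) (D.dual j₁) a₃ ∧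
      D.GammaRot (D.dual j₄) (D.dual j₂) j₆ a₄ := by
  refine ⟨gammaRot₁_of_N_ne_zero h, ?_, ?_, ?_⟩
  · rw [D.N_symm₂] at h
    exact gammaRot₁_of_N_ne_zero h
  · rw [D.N_symm₂, D.N_symm₂] at h
    exact gammaRot₁_of_N_ne_zero h
  · rw [D.N_half_turn] at h
    have := gammaRot₁_of_N_ne_zero h
    rwa [D.dual_dual] at this

/-- The data at a corner of a plaquette under the involution of the field. -/
theorem star_corner {yn xn y x k s : A} {an c c' a : ℕ}
    (h : D.N (D.dual yn) s (D.dual xn) x (D.dual k) y an c c' a ≠ 0) :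
    D.GammaRot x k (D.dual xn) c ∧ D.GammaRot y k (D.dual yn) c' ∧
    star (D.N (D.dual yn) s (D.dual xn) x (D.dual k) y an c c' a)
        * (D.γ y k (D.dual yn) c' * D.γ (D.dual y) s x a * D.β y)
      = D.N (D.dual xn) (D.dual s) (D.dual yn) y (D.dual k) x an c' c a
        * (D.γ x k (D.dual xn) c * D.γ (D.dual yn) s xn an * D.β xn) := by
  obtain ⟨r1, r2, r3, r4⟩ := gammaRot_of_N_ne_zero h
  obtain ⟨q1, q2, q3, q4⟩ := D.ranges_of_N_ne_zero h
  have hs := D.N_star (D.dual yn) s (D.dual xn) x (D.dual k) y an c c' a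
  simp only [D.dual_dual] at *
  have g2 : D.GammaRot y k (D.dual yn) c' := by
    refine GammaRot.of_dual ?_ q3.1 ?_
    · rw [D.dual_dual]; exact r3.rot.rot
    · rw [D.δ_dual, D.dual_dual, D.δ_rot]; exact q3.2
  have w4 : a ≤ D.δ x (D.dual y) s := by
    rw [D.δ_dual, D.dual_dual, D.δ_rot]; exact q4.2
  have g4 : D.GammaRot x (D.dual y) s a := by
    refine GammaRot.of_dual ?_ q4.1 w4
    rw [D.dual_dual]; exact r4.rot
  have t3 := D.γ_theta y k (D.dual yn) c' q3.1
    (by rw [D.δ_dual, D.dual_dual, D.δ_rot]; exact q3.2)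
  have t4 := D.γ_theta x (D.dual y) s a q4.1 w4
  simp only [D.dual_dual, D.β_dual] at t3 t4 hs
  refine ⟨r2.rot, g2, ?_⟩
  have e : D.N (D.dual s) yn xn (D.dual k) x y an c a c'
      = D.N (D.dual xn) (D.dual s) (D.dual yn) y (D.dual k) x an c' c a := by
    rw [D.N_symm₁ (D.dual xn)]; simp only [D.dual_dual]
  rw [e] at hs
  rw [hs, ← g4.1, ← r2.1]
  generalize D.N (D.dual xn) (D.dual s) (D.dual yn) y (D.dual k) x an c' c a = n
  linear_combination (n * D.γ (D.dual yn) s xn an * D.γ (D.dual xn) x k c * D.β xn) *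
    (D.γ x (D.dual y) s a * D.γ (D.dual s) y (D.dual x) a * D.β x * D.β y * D.β s * t3 + t4)

variable {E : Type*} [Fintype E] [DecidableEq E] (nx : Equiv.Perm E)

theorem star_ringCoeff (k : E → A) (s : A) (y x : E → A) (c' c : E → ℕ) (Γ Γ' : E → K)
    (hΓ : ∀ e, 1 ≤ c e → D.GammaRot (x e) (k e) (D.dual (x (nx e))) (c e) →
      Γ e = D.γ (x e) (k e) (D.dual (x (nx e))) (c e))
    (hΓ' : ∀ e, 1 ≤ c' e → D.GammaRot (y e) (k e) (D.dual (y (nx e))) (c' e) →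
      Γ' e = D.γ (y e) (k e) (D.dual (y (nx e))) (c' e)) :
    star (D.ringCoeff nx k s y x c' c) * ((∏ e, D.d (x e)) * (∏ e, Γ' e) * ∏ e, D.β (y e))
      = D.ringCoeff nx k (D.dual s) x y c c' *
        ((∏ e, D.d (y e)) * (∏ e, Γ e) * ∏ e, D.β (x e)) := by
  have hδ : ∀ e, D.δ (D.dual (x e)) (D.dual s) (y e) = D.δ (D.dual (y e)) s (x e) := fun e => by
    rw [D.δ_dual]; simp only [D.dual_dual]
  rw [ringCoeff_eq, ringCoeff_eq, star_mul']
  simp only [hδ]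
  have key : ∀ a ∈ Fintype.piFinset fun e => Finset.Icc 1 (D.δ (D.dual (y e)) s (x e)),
      star (∏ e, D.N (D.dual (y (nx e))) s (D.dual (x (nx e))) (x e) (D.dual (k e)) (y e)
        (a (nx e)) (c e) (c' e) (a e)) * ((∏ e, Γ' e) * ∏ e, D.β (y e))
      = (∏ e, D.N (D.dual (x (nx e))) (D.dual s) (D.dual (y (nx e))) (y e) (D.dual (k e)) (x e)
        (a (nx e)) (c' e) (c e) (a e)) * ((∏ e, Γ e) * ∏ e, D.β (x e)) := by
    intro a ha
    by_cases h : ∀ e, D.N (D.dual (y (nx e))) s (D.dual (x (nx e))) (x e) (D.dual (k e)) (y e)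
        (a (nx e)) (c e) (c' e) (a e) ≠ 0
    · have hγ : ∏ e, D.γ (D.dual (y e)) s (x e) (a e) ≠ 0 :=
        Finset.prod_ne_zero_iff.2 fun e _ => by
          have := Finset.mem_Icc.1 (Fintype.mem_piFinset.1 ha e)
          exact D.γ_ne_zero _ _ _ _ this.1 this.2
      have h1 : ∏ e, (star (D.N (D.dual (y (nx e))) s (D.dual (x (nx e))) (x e) (D.dual (k e))
          (y e) (a (nx e)) (c e) (c' e) (a e)) *
            (Γ' e * D.γ (D.dual (y e)) s (x e) (a e) * D.β (y e)))
        = ∏ e, (D.N (D.dual (x (nx e))) (D.dual s) (D.dual (y (nx e))) (y e) (D.dual (k e)) (x e)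
          (a (nx e)) (c' e) (c e) (a e) *
            (Γ e * D.γ (D.dual (y (nx e))) s (x (nx e)) (a (nx e)) * D.β (x (nx e)))) := by
        refine Finset.prod_congr rfl fun e _ => ?_
        obtain ⟨g1, g2, g3⟩ := star_corner (h e)
        obtain ⟨-, q2, q3, -⟩ := D.ranges_of_N_ne_zero (h e)
        rw [hΓ e q2.1 g1, hΓ' e q3.1 g2]
        exact g3
      simp only [Finset.prod_mul_distrib] at h1
      rw [Equiv.prod_comp nx fun e => D.γ (D.dual (y e)) s (x e) (a e),
        Equiv.prod_comp nx fun e => D.β (x e)] at h1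
      apply mul_right_cancel₀ hγ
      rw [star_prod]
      linear_combination h1
    · obtain ⟨e, he⟩ := not_forall.1 h
      rw [not_not] at he
      have he' : D.N (D.dual (x (nx e))) (D.dual s) (D.dual (y (nx e))) (y e) (D.dual (k e)) (x e)
          (a (nx e)) (c' e) (c e) (a e) = 0 := by
        by_contra h'
        have := (star_corner h').2.2
        rw [D.dual_dual, he, zero_mul] at this
        obtain ⟨g1, g2, -⟩ := star_corner h'
        obtain ⟨q1, q2, q3, q4⟩ := D.ranges_of_N_ne_zero h'
        refine mul_ne_zero (star_ne_zero.2 h') ?_ this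
        refine mul_ne_zero (mul_ne_zero ?_ ?_) (D.β_ne_zero _)
        · refine D.γ_ne_zero _ _ _ _ q3.1 ?_
          rw [D.δ_dual, D.dual_dual, D.δ_rot]
          simpa only [D.dual_dual] using q3.2
        · refine D.γ_ne_zero _ _ _ _ q4.1 ?_
          rw [D.δ_dual, D.dual_dual, D.dual_dual, D.δ_rot']
          rw [D.dual_dual, D.δ_rot'] at q4
          rw [D.δ_rot']
          exact q4.2
      have z := Finset.prod_eq_zero (f := fun e => D.N (D.dual (y (nx e))) s (D.dual (x (nx e)))
        (x e) (D.dual (k e)) (y e) (a (nx e)) (c e) (c' e) (a e)) (Finset.mem_univ e) he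
      have z' := Finset.prod_eq_zero (f := fun e => D.N (D.dual (x (nx e))) (D.dual s)
        (D.dual (y (nx e))) (y e) (D.dual (k e)) (x e) (a (nx e)) (c' e) (c e) (a e))
        (Finset.mem_univ e) he'
      rw [z, z', star_zero, zero_mul, zero_mul]
  rw [star_sum, star_prod]
  simp only [D.d_star]
  calc _ = (∏ e, D.d (y e)) * (∏ e, D.d (x e)) *
        ∑ a ∈ Fintype.piFinset fun e => Finset.Icc 1 (D.δ (D.dual (y e)) s (x e)),
        star (∏ e, D.N (D.dual (y (nx e))) s (D.dual (x (nx e))) (x e) (D.dual (k e)) (y e)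
        (a (nx e)) (c e) (c' e) (a e)) * ((∏ e, Γ' e) * ∏ e, D.β (y e)) := by
        rw [← Finset.sum_mul]; ring
    _ = _ := by
        rw [Finset.sum_congr rfl key, ← Finset.sum_mul]; ring

end

end LWData

/-! ### Hermitian operators for the indefinite inner product -/

theorem Fintype.prod_mul_prod_comp_comm {E T K : Type*} [Fintype E] [Fintype T] [CommMonoid K]
    (φ : E → T) (hφ : Function.Injective φ) (f f' : T → K)
    (h : ∀ t, (∀ e, φ e ≠ t) → f t = f' t) :
    (∏ t, f' t) * ∏ e, f (φ e) = (∏ t, f t) * ∏ e, f' (φ e) := by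
  classical
  have h1 : ∀ g : T → K, ∏ e, g (φ e) = ∏ t ∈ Finset.univ.image φ, g t := fun g => by
    rw [Finset.prod_image fun _ _ _ _ h => hφ h]
  have h2 : ∏ t ∈ (Finset.univ.image φ)ᶜ, f t = ∏ t ∈ (Finset.univ.image φ)ᶜ, f' t := by
    refine Finset.prod_congr rfl fun t ht => h t fun e he => ?_
    exact Finset.mem_compl.1 ht (Finset.mem_image.2 ⟨e, Finset.mem_univ e, he⟩)
  rw [h1, h1, ← Finset.prod_mul_prod_compl (Finset.univ.image φ) f',
    ← Finset.prod_mul_prod_compl (Finset.univ.image φ) f, h2]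
  ac_rfl

namespace LW

variable {G : Type*} [AddCommGroup G] {A : Type*} {D : LWData ℂ G A}
  {V F : Type*} [Fintype F] {S : TriangulatedSurface V F} {Φ Φ' Φ'' : GColoring S G}

omit [Fintype F] in
theorem vertexGamma_ne_zero (σ : LWState D Φ) (t : F) : vertexGamma D σ t ≠ 0 := by
  unfold vertexGamma
  split_ifs with h
  · exact one_ne_zero
  · exact D.γ_ne_zero _ _ _ _ (Nat.one_le_iff_ne_zero.2 h) (σ.br_le t)

theorem star_edgeProd (σ : LWState D Φ) (f : A → ℂ) (hf : ∀ a, f (D.dual a) = f a)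
    (h : ∀ a, star (f a) = f a) : star (edgeProd D σ f hf) = edgeProd D σ f hf := by
  unfold edgeProd
  refine (map_prod (starRingEnd ℂ) _ _).trans (Finset.prod_congr rfl fun e _ => ?_)
  induction e using Quotient.inductionOn with
  | h x => exact h _

theorem star_etaWeight (σ : LWState D Φ) : star (etaWeight D σ) = etaWeight D σ := by
  unfold etaWeight
  rw [star_div₀, star_mul', star_edgeProd σ _ _ D.d_star, star_edgeProd σ _ _ D.β_star, star_prod]
  congr 2
  refine Finset.prod_congr rfl fun t _ => ?_
  unfold vertexGamma
  split_ifs with h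
  · exact star_one ℂ
  · exact D.γ_star _ _ _ _ (Nat.one_le_iff_ne_zero.2 h) (σ.br_le t)

theorem exists_edgeProd_eq (σ : LWState D Φ) (f : A → ℂ) (hf : ∀ a, f (D.dual a) = f a) :
    ∃ g : S.Edge → ℂ, (∀ x, g (Quotient.mk S.edgeSetoid x) = f (σ.lab x)) ∧
      edgeProd D σ f hf = ∏ e, g e :=
  ⟨_, fun _ => rfl, rfl⟩

theorem edgeProd_mul_rim [DecidableEq V] {p : V} {σ' : LWState D Φ'} {σ : LWState D Φ}
    (h : AgreeAway p σ' σ) (f : A → ℂ) (hf : ∀ a, f (D.dual a) = f a) :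
    edgeProd D σ' f hf * ∏ e, f (rimLab p σ e) = edgeProd D σ f hf * ∏ e, f (rimLab p σ' e) := by
  obtain ⟨g, hg, eg⟩ := exists_edgeProd_eq σ f hf
  obtain ⟨g', hg', eg'⟩ := exists_edgeProd_eq σ' f hf
  let φ : S.Spoke p → S.Edge := fun e => Quotient.mk S.edgeSetoid e.1
  have h1 : ∀ e, f (rimLab p σ e) = g (φ e) := fun e => (hg e.1).symm
  have h2 : ∀ e, f (rimLab p σ' e) = g' (φ e) := fun e => (hg' e.1).symm
  simp only [eg, eg', h1, h2]
  refine Fintype.prod_mul_prod_comp_comm φ ?_ g g' ?_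
  · intro e e' he
    rcases Quotient.exact he with h1 | h1
    · exact Subtype.ext h1.symm
    · exact absurd h1.symm (S.opp_spoke_ne p e e')
  · intro t ht
    induction t using Quotient.inductionOn with
    | h x =>
      have hx := (S.not_mem_iff_spoke p x).2 ⟨fun i hi => ht i (congrArg _ hi), fun i hi =>
        ht i (Quotient.sound (Or.inr hi.symm))⟩
      rw [hg, hg', h.1 x hx.1 hx.2]

theorem vertexGamma_mul_rim [DecidableEq V] {p : V} {σ' : LWState D Φ'} {σ : LWState D Φ}
    (h : AgreeAway p σ' σ) :
    (∏ t, vertexGamma D σ' t) * ∏ e : S.Spoke p, vertexGamma D σ e.1.1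
      = (∏ t, vertexGamma D σ t) * ∏ e : S.Spoke p, vertexGamma D σ' e.1.1 := by
  refine Fintype.prod_mul_prod_comp_comm (fun e : S.Spoke p => e.1.1)
    (S.spoke_face_injective p) (fun t => vertexGamma D σ t) (fun t => vertexGamma D σ' t) ?_
  intro t ht
  have h1 : ∀ j, σ.lab (t, j) = σ'.lab (t, j) := fun j => by
    have hx := (S.not_mem_iff_spoke p (t, j)).2 ⟨fun i hi => ht i (by rw [hi]), fun i hi => by
      obtain ⟨e', he'⟩ := S.spoke_opp_face p i
      exact ht e' (by rw [he', hi])⟩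
    exact (h.1 _ hx.1 hx.2).symm
  unfold vertexGamma
  rw [h1, h1, h1, h.2 t ((S.face_not_mem_iff_spoke p t).2 ht)]

omit [Fintype F] in
theorem vertexGamma_of_gammaRot [DecidableEq V] (p : V) (σ : LWState D Φ) (e : S.Spoke p)
    (h : 1 ≤ rimBr p σ e)
    (h' : D.GammaRot (rimLab p σ e) (legLab p σ e) (D.dual (rimLab p σ (S.nextPerm p e)))
      (rimBr p σ e)) :
    vertexGamma D σ e.1.1 = D.γ (rimLab p σ e) (legLab p σ e)
      (D.dual (rimLab p σ (S.nextPerm p e))) (rimBr p σ e) := by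
  have e1 : D.dual (rimLab p σ (S.nextPerm p e)) = σ.lab (e.1.1, e.1.2 + 2) :=
    (σ.lab_add_two e.1).symm
  rw [e1] at h' ⊢
  have h0 : σ.br e.1.1 ≠ 0 := Nat.one_le_iff_ne_zero.1 h
  unfold vertexGamma
  rw [if_neg h0]
  unfold rimLab legLab rimBr LWData.GammaRot at *
  have e2 : e.1 = (e.1.1, e.1.2) := rfl
  rw [e2] at h' ⊢
  dsimp only at h' ⊢
  rcases Fin.three_rot e.1.2 with ⟨h0, h1, h2⟩ | ⟨h0, h1, h2⟩ | ⟨h0, h1, h2⟩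
  · rw [h1, h2, h0]
  · rw [h1, h2, h0] at h' ⊢
    exact h'.2.symm
  · rw [h1, h2, h0] at h' ⊢
    exact h'.1.symm

variable [Fintype V] [DecidableEq V] [DecidableEq F]

theorem star_plaquetteCoeff (p : V) (s : A) (σ' : LWState D Φ') (σ : LWState D Φ) :
    star (plaquetteCoeff D p s σ' σ) * etaWeight D σ
      = plaquetteCoeff D p (D.dual s) σ σ' * etaWeight D σ' := by
  classical
  by_cases h : AgreeAway p σ' σ
  swap
  · rw [plaquetteCoeff_eq, plaquetteCoeff_eq, if_neg h, if_neg fun h' => h h'.symm, star_zero,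
      zero_mul, zero_mul]
  have key := D.star_ringCoeff (S.nextPerm p) (legLab p σ) s (rimLab p σ') (rimLab p σ)
    (rimBr p σ') (rimBr p σ) (fun e => vertexGamma D σ e.1.1) (fun e => vertexGamma D σ' e.1.1)
    (fun e h1 h2 => vertexGamma_of_gammaRot p σ e h1 h2)
    (fun e h1 h2 => by
      rw [← h.legLab_eq] at h2 ⊢
      exact vertexGamma_of_gammaRot p σ' e h1 h2)
  rw [plaquetteCoeff_eq, plaquetteCoeff_eq, if_pos h, if_pos h.symm, h.legLab_eq]
  have hd := edgeProd_mul_rim h D.d D.d_dual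
  have hβ := edgeProd_mul_rim h D.β D.β_dual
  have hγ := vertexGamma_mul_rim h
  have n1 : ∏ e, D.d (rimLab p σ e) ≠ 0 := Finset.prod_ne_zero_iff.2 fun e _ => D.d_ne_zero _
  have n2 : ∏ e, D.β (rimLab p σ e) ≠ 0 := Finset.prod_ne_zero_iff.2 fun e _ => D.β_ne_zero _
  have n3 : ∏ e : S.Spoke p, vertexGamma D σ e.1.1 ≠ 0 :=
    Finset.prod_ne_zero_iff.2 fun e _ => vertexGamma_ne_zero σ _
  have n4 : ∏ t, vertexGamma D σ t ≠ 0 :=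
    Finset.prod_ne_zero_iff.2 fun e _ => vertexGamma_ne_zero σ _
  have n5 : ∏ t, vertexGamma D σ' t ≠ 0 :=
    Finset.prod_ne_zero_iff.2 fun e _ => vertexGamma_ne_zero σ' _
  have n6 : edgeProd D σ D.β D.β_dual ≠ 0 := edgeProd_ne_zero D σ _ _ D.β_ne_zero
  have n7 : edgeProd D σ' D.β D.β_dual ≠ 0 := edgeProd_ne_zero D σ' _ _ D.β_ne_zero
  unfold etaWeight
  generalize star (D.ringCoeff (S.nextPerm p) (legLab p σ) s (rimLab p σ') (rimLab p σ)
    (rimBr p σ') (rimBr p σ)) = R at *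
  generalize D.ringCoeff (S.nextPerm p) (legLab p σ) (D.dual s) (rimLab p σ) (rimLab p σ')
    (rimBr p σ) (rimBr p σ') = R' at *
  generalize edgeProd D σ D.d D.d_dual = pd at *
  generalize edgeProd D σ' D.d D.d_dual = pd' at *
  generalize edgeProd D σ D.β D.β_dual = pb at *
  generalize edgeProd D σ' D.β D.β_dual = pb' at *
  generalize ∏ t, vertexGamma D σ t = pg at *
  generalize ∏ t, vertexGamma D σ' t = pg' at *
  generalize ∏ e, D.d (rimLab p σ e) = rd at *
  generalize ∏ e, D.d (rimLab p σ' e) = rd' at *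
  generalize ∏ e, D.β (rimLab p σ e) = rb at *
  generalize ∏ e, D.β (rimLab p σ' e) = rb' at *
  generalize ∏ e : S.Spoke p, vertexGamma D σ e.1.1 = rg at *
  generalize ∏ e : S.Spoke p, vertexGamma D σ' e.1.1 = rg' at *
  rw [mul_div_assoc', mul_div_assoc', div_eq_div_iff (mul_ne_zero n4 n6) (mul_ne_zero n5 n7)]
  apply mul_right_cancel₀ (mul_ne_zero (mul_ne_zero n1 n2) n3)
  calc R * pd * (pg' * pb') * (rd * rb * rg)
      = R * pd * rd * (pg' * rg) * (pb' * rb) := by ring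
    _ = (R * (rd * rg' * rb')) * pd * pg * pb := by rw [hγ, hβ]; ring
    _ = R' * (pd * rd') * rg * rb * pg * pb := by rw [key]; ring
    _ = R' * pd' * (pg * pb) * (rd * rb * rg) := by rw [← hd]; ring

/-- The operators `T` and `T'` are adjoint for the indefinite inner products. -/
def IndefAdjoint (T : LWSpace D Φ →ₗ[ℂ] LWSpace D Φ') (T' : LWSpace D Φ' →ₗ[ℂ] LWSpace D Φ) :
    Prop :=
  ∀ ψ φ, indefInner D ψ (T φ) = indefInner D (T' ψ) φ

theorem indefInner_eq (ψ φ : LWSpace D Φ) :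
    indefInner D ψ φ = ∑ σ, star (ψ σ) * (etaWeight D σ)⁻¹ * φ σ := by
  unfold indefInner
  rw [PiLp.inner_apply]
  refine Finset.sum_congr rfl fun σ _ => ?_
  change (etaWeight D σ)⁻¹ * φ σ * star (ψ σ) = _
  ring

theorem indefAdjoint_toEuclideanLin (M : Matrix (LWState D Φ') (LWState D Φ) ℂ)
    (M' : Matrix (LWState D Φ) (LWState D Φ') ℂ)
    (h : ∀ σ' σ, star (M σ' σ) * etaWeight D σ = M' σ σ' * etaWeight D σ') :
    IndefAdjoint (Matrix.toEuclideanLin M) (Matrix.toEuclideanLin M') := by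
  intro ψ φ
  rw [indefInner_eq, indefInner_eq]
  simp only [Matrix.toLpLin_apply, Matrix.mulVec, dotProduct, star_sum, star_mul',
    Finset.mul_sum, Finset.sum_mul]
  rw [Finset.sum_comm]
  refine Finset.sum_congr rfl fun σ _ => Finset.sum_congr rfl fun σ' _ => ?_
  have h1 := congrArg star (h σ' σ)
  rw [star_mul', star_mul', star_star, star_etaWeight, star_etaWeight] at h1
  have h2 : (etaWeight D σ')⁻¹ * M σ' σ = star (M' σ σ') * (etaWeight D σ)⁻¹ := by
    have n1 := etaWeight_ne_zero D σ
    have n2 := etaWeight_ne_zero D σ'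
    field_simp
    linear_combination h1
  linear_combination (star (ψ σ') * φ σ) * h2

theorem indefAdjoint_plaquetteDegOp (p : V) (g : G) (Φ Φ' : GColoring S G) :
    IndefAdjoint (plaquetteDegOp D p g Φ Φ') (plaquetteDegOp D p (-g) Φ' Φ) := by
  rw [plaquetteDegOp_eq, plaquetteDegOp_eq]
  refine indefAdjoint_toEuclideanLin _ _ fun σ' σ => ?_
  simp only [degMatrix, Matrix.of_apply, star_sum, star_mul', D.b_star, Finset.sum_mul]
  refine Finset.sum_bij' (fun s _ => D.dual s) (fun s _ => D.dual s) ?_ ?_ ?_ ?_ ?_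
  · exact fun s hs => D.mem_I_dual.2 hs
  · intro s hs
    rw [← D.mem_I_dual, D.dual_dual]; exact hs
  · exact fun s _ => D.dual_dual s
  · exact fun s _ => D.dual_dual s
  · intro s _
    rw [mul_assoc, star_plaquetteCoeff, D.b_dual, mul_assoc]

theorem IndefAdjoint.comp {T : LWSpace D Φ →ₗ[ℂ] LWSpace D Φ'}
    {T' : LWSpace D Φ' →ₗ[ℂ] LWSpace D Φ} {U : LWSpace D Φ' →ₗ[ℂ] LWSpace D Φ''}
    {U' : LWSpace D Φ'' →ₗ[ℂ] LWSpace D Φ'} (h : IndefAdjoint T T') (h' : IndefAdjoint U U') :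
    IndefAdjoint (U ∘ₗ T) (T' ∘ₗ U') := fun ψ φ => by
  rw [LinearMap.comp_apply, LinearMap.comp_apply, h', h]

theorem isIndefHermitian_plaquetteComp (p : V) (g : G) :
    IsIndefHermitian D (plaquetteComp D Φ p g) := by
  have h := indefAdjoint_plaquetteDegOp (D := D) p g (Φ.addPlaquette (-g) p) Φ
  have h' := indefAdjoint_plaquetteDegOp (D := D) p (-g) Φ (Φ.addPlaquette (-g) p)
  rw [neg_neg] at h'
  exact h'.comp h

theorem isIndefHermitian_vertexOp (t : F) : IsIndefHermitian D (vertexOp D Φ t) := by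
  refine indefAdjoint_toEuclideanLin _ _ fun σ' σ => ?_
  by_cases h : σ' = σ
  · subst h
    simp only [Matrix.diagonal_apply_eq]
    split_ifs <;> simp
  · rw [Matrix.diagonal_apply_ne _ h, Matrix.diagonal_apply_ne' _ h]
    simp

theorem isIndefHermitian_add {T U : Module.End ℂ (LWSpace D Φ)} (hT : IsIndefHermitian D T)
    (hU : IsIndefHermitian D U) : IsIndefHermitian D (T + U) := fun ψ φ => by
  have h1 := hT ψ φ
  have h2 := hU ψ φ
  simp only [indefInner, LinearMap.add_apply, map_add, inner_add_left, inner_add_right] at *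
  rw [h1, h2]

theorem isIndefHermitian_one_sub {T : Module.End ℂ (LWSpace D Φ)} (hT : IsIndefHermitian D T) :
    IsIndefHermitian D (1 - T) := fun ψ φ => by
  have h1 := hT ψ φ
  simp only [indefInner, LinearMap.sub_apply, Module.End.one_apply, map_sub, inner_sub_left,
    inner_sub_right] at *
  rw [h1]

theorem isIndefHermitian_sum {ι : Type*} (s : Finset ι) (T : ι → Module.End ℂ (LWSpace D Φ))
    (hT : ∀ i, IsIndefHermitian D (T i)) : IsIndefHermitian D (∑ i ∈ s, T i) := by
  classical
  induction s using Finset.induction_on with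
  | empty => intro ψ φ; simp [indefInner]
  | insert a s ha ih =>
    rw [Finset.sum_insert ha]
    exact isIndefHermitian_add (hT a) ih

theorem IsIndefHermitian.isPseudoHermitian {T : Module.End ℂ (LWSpace D Φ)}
    (hT : IsIndefHermitian D T) : IsPseudoHermitian D T := by
  have hη : (eta D Φ).toLinearMap.IsSymmetric := by
    intro ψ φ
    rw [PiLp.inner_apply, PiLp.inner_apply]
    refine Finset.sum_congr rfl fun σ _ => ?_
    change φ σ * star (etaWeight D σ * ψ σ) = etaWeight D σ * φ σ * star (ψ σ)
    rw [star_mul', star_etaWeight]; ring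
  refine ⟨hη, ?_⟩
  symm
  rw [LinearMap.eq_adjoint_iff]
  intro ψ φ
  have hη' : ∀ ψ φ : LWSpace D Φ, inner ℂ ((eta D Φ).symm ψ) φ = inner ℂ ψ ((eta D Φ).symm φ) := by
    intro ψ φ
    have := hη ((eta D Φ).symm ψ) ((eta D Φ).symm φ)
    simpa using this.symm
  simp only [LinearMap.comp_apply, LinearEquiv.coe_coe]
  rw [hη']
  have h1 := hT (eta D Φ ψ) φ
  unfold indefInner at h1
  rw [← h1, ← hη', LinearEquiv.symm_apply_apply]

end LW

/-! ### Two plaquettes with a common edge: the local computation -/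

namespace LWData

variable {K : Type*} [Field K] [StarRing K] {G : Type*} [AddCommGroup G] {A : Type*}
  (D : LWData K G A)

/-- The pentagon identity at a vertex on the boundary of two plaquettes. -/
theorem N_pentagon_corner (s t a b c m y z w : A) (A₁ B₁ C C'' α β : ℕ)
    (h : D.deg s + D.deg a ∉ D.X) :
    ∑ i ∈ Finset.Icc 1 (D.δ m z c),
      D.N w s c m (D.dual z) y A₁ i C'' α * D.N m t a b (D.dual c) z β C i B₁
    = ∑ m' ∈ D.I (D.deg s + D.deg a),
      ∑ α' ∈ Finset.Icc 1 (D.δ (D.dual m') s a),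
      ∑ β' ∈ Finset.Icc 1 (D.δ y t (D.dual m')),
        D.d m' * (∑ i' ∈ Finset.Icc 1 (D.δ m' b w),
          D.N w s c a (D.dual b) m' A₁ C i' α' * D.N y t m' b (D.dual w) z β' i' C'' B₁)
          * D.N s a m' (D.dual t) y m α' β' α β := by
  have key := D.N_pentagon (D.dual z) w s a (D.dual t) c (D.dual b) y m C'' A₁ C B₁ α β h
  have e0 : D.δ (D.dual z) (D.dual m) (D.dual c) = D.δ m z c := by
    rw [← D.δ_dual, D.δ_rot]
  rw [e0] at key
  calc _ = _ := Finset.sum_congr rfl fun i _ => by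
        rw [mul_comm, D.N_rot₃ m, D.dual_dual]
    _ = _ := key.symm
    _ = _ := by
      refine Finset.sum_congr rfl fun m' _ => ?_
      have e1 : D.δ (D.dual b) (D.dual m') (D.dual w) = D.δ m' b w := by
        rw [← D.δ_dual, D.δ_rot]
      have e2 : D.δ m' (D.dual a) (D.dual s) = D.δ (D.dual m') s a := by
        rw [D.δ_dual, D.dual_dual, D.dual_dual, D.δ_rot']
      have e3 : D.δ y (D.dual (D.dual t)) (D.dual m') = D.δ y t (D.dual m') := by
        rw [D.dual_dual]
      rw [e1, e2, e3, Finset.sum_comm]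
      refine Finset.sum_congr rfl fun α' _ => ?_
      rw [Finset.sum_comm]
      refine Finset.sum_congr rfl fun β' _ => ?_
      rw [Finset.mul_sum, Finset.sum_mul]
      refine Finset.sum_congr rfl fun i' _ => ?_
      rw [D.N_rot₃ y, D.dual_dual]
      ring

theorem sum_I_dual (g : G) (f : A → K) :
    ∑ m ∈ D.I (-g), f m = ∑ m ∈ D.I g, f (D.dual m) :=
  Finset.sum_bij' (fun m _ => D.dual m) (fun m _ => D.dual m)
    (fun m hm => by rwa [← D.mem_I_dual, D.dual_dual]) (fun m hm => by rwa [D.mem_I_dual])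
    (fun m _ => D.dual_dual m) (fun m _ => D.dual_dual m) (fun m _ => by rw [D.dual_dual])

/-- The sum over the intermediate label `m` of a common edge of two plaquettes and the
intermediate branching labels of its ends, when first `t` acts on the second plaquette and then
`s` acts on the first one.  Initially the edge has the label `a`, and at its ends there are the
labels `a, b, c` and `a*, g, h`; the final labels are `y, b', c'` and `y*, g', h'`. -/
def edgeSum (s t a b c g h y b' c' g' h' : A) (C C' E E' A₁ A₂ B₁ B₂ : ℕ) : K :=
  ∑ m ∈ D.I (D.deg a - D.deg t),
    ∑ i ∈ Finset.Icc 1 (D.δ m b' c), ∑ j ∈ Finset.Icc 1 (D.δ (D.dual m) g h'),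
      D.d m *
        (∑ α ∈ Finset.Icc 1 (D.δ (D.dual y) s m),
          D.N c' s c m (D.dual b') y A₁ i C' α *
            D.N (D.dual y) s (D.dual m) g (D.dual h') g' α j E' A₂) *
        ∑ β ∈ Finset.Icc 1 (D.δ m t (D.dual a)),
          D.N h' t h (D.dual a) (D.dual g) (D.dual m) B₂ E j β *
            D.N m t a b (D.dual c) b' β C i B₁

theorem edgeSum_eq (s t a b c g h y b' c' g' h' : A) (C C' E E' A₁ A₂ B₁ B₂ : ℕ) :
    D.edgeSum s t a b c g h y b' c' g' h' C C' E E' A₁ A₂ B₁ B₂ =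
    ∑ m ∈ D.I (D.deg a - D.deg t),
      ∑ α ∈ Finset.Icc 1 (D.δ (D.dual y) s m), ∑ β ∈ Finset.Icc 1 (D.δ m t (D.dual a)),
      D.d m *
        (∑ i ∈ Finset.Icc 1 (D.δ m b' c),
          D.N c' s c m (D.dual b') y A₁ i C' α * D.N m t a b (D.dual c) b' β C i B₁) *
        ∑ j ∈ Finset.Icc 1 (D.δ (D.dual m) g h'),
          D.N h' t h (D.dual a) (D.dual g) (D.dual m) B₂ E j β *
            D.N (D.dual y) s (D.dual m) g (D.dual h') g' α j E' A₂ := by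
  refine Finset.sum_congr rfl fun m _ => ?_
  simp_rw [mul_assoc, Finset.sum_mul_sum, Finset.mul_sum]
  refine (((Finset.sum_congr rfl fun i _ => Finset.sum_comm.trans (Finset.sum_congr rfl
    fun α _ => Finset.sum_comm)).trans Finset.sum_comm).trans (Finset.sum_congr rfl
    fun α _ => Finset.sum_comm)).trans ?_
  refine Finset.sum_congr rfl fun α _ => Finset.sum_congr rfl fun β _ =>
    Finset.sum_congr rfl fun i _ => Finset.sum_congr rfl fun j _ => ?_
  ring

omit [StarRing K] in
theorem sum_mul_eq_of_expansion (I I' : Finset A) (P Q P' Q' : A → Finset ℕ) (d : A → K)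
    (X X' Y Y' : A → ℕ → ℕ → K) (n : A → ℕ → ℕ → A → ℕ → ℕ → K)
    (hX : ∀ m α β, X m α β = ∑ m' ∈ I', ∑ α' ∈ P' m', ∑ β' ∈ Q' m',
      d m' * Y m' α' β' * n m α β m' α' β')
    (hY' : ∀ m' α' β', Y' m' α' β' = ∑ m ∈ I, ∑ β ∈ Q m, ∑ α ∈ P m,
      d m * X' m α β * n m α β m' α' β') :
    ∑ m ∈ I, ∑ α ∈ P m, ∑ β ∈ Q m, d m * X m α β * X' m α β
      = ∑ m' ∈ I', ∑ β' ∈ Q' m', ∑ α' ∈ P' m', d m' * Y' m' α' β' * Y m' α' β' := by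
  have bundle : ∀ (I : Finset A) (P Q : A → Finset ℕ) (f : A → ℕ → ℕ → K),
      ∑ m ∈ I, ∑ p ∈ P m, ∑ q ∈ Q m, f m p q
        = ∑ x ∈ I.sigma fun m => P m ×ˢ Q m, f x.1 x.2.1 x.2.2 := by
    intro I P Q f
    rw [Finset.sum_sigma]
    refine Finset.sum_congr rfl fun m _ => ?_
    rw [Finset.sum_product]
  have swap : ∀ (I : Finset A) (P Q : A → Finset ℕ) (f : A → ℕ → ℕ → K),
      ∑ m ∈ I, ∑ p ∈ P m, ∑ q ∈ Q m, f m p q = ∑ m ∈ I, ∑ q ∈ Q m, ∑ p ∈ P m, f m p q :=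
    fun I P Q f => Finset.sum_congr rfl fun m _ => Finset.sum_comm
  rw [swap I' Q' P' fun m' β' α' => d m' * Y' m' α' β' * Y m' α' β']
  simp only [hX, hY', swap I Q P]
  simp only [bundle, Finset.mul_sum, Finset.sum_mul]
  rw [Finset.sum_comm]
  exact Finset.sum_congr rfl fun x _ => Finset.sum_congr rfl fun x' _ => by ring

/-- The actions on two plaquettes commute at a common edge. -/
theorem edgeSum_comm (s t a b c g h y b' c' g' h' : A) (C C' E E' A₁ A₂ B₁ B₂ : ℕ)
    (h₁ : D.deg s + D.deg a ∉ D.X) (h₂ : D.deg t + D.deg (D.dual a) ∉ D.X) :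
    D.edgeSum s t a b c g h y b' c' g' h' C C' E E' A₁ A₂ B₁ B₂
      = D.edgeSum t s (D.dual a) g h b c (D.dual y) g' h' b' c' E E' C C' B₂ B₁ A₂ A₁ := by
  rw [edgeSum_eq, edgeSum_eq]
  have d1 : D.deg a - D.deg t = -(D.deg t + D.deg (D.dual a)) := by rw [D.deg_dual]; abel
  have d2 : D.deg (D.dual a) - D.deg s = -(D.deg s + D.deg a) := by rw [D.deg_dual]; abel
  rw [d2, D.sum_I_dual (D.deg s + D.deg a)]
  rw [d1]
  simp only [D.dual_dual, D.d_dual]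
  refine sum_mul_eq_of_expansion _ (D.I (D.deg s + D.deg a)) _ _
    (fun m' => Finset.Icc 1 (D.δ (D.dual m') s a)) (fun m' => Finset.Icc 1 (D.δ y t (D.dual m')))
    D.d _ _
    (fun m' α' β' => ∑ i' ∈ Finset.Icc 1 (D.δ m' b c'),
          D.N c' s c a (D.dual b) m' A₁ C i' α' * D.N y t m' b (D.dual c') b' β' i' C' B₁)
    (fun m' α' β' => ∑ i' ∈ Finset.Icc 1 (D.δ (D.dual m') g' h),
      D.N h' t h (D.dual m') (D.dual g') (D.dual y) B₂ i' E' β' *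
        D.N (D.dual m') s (D.dual a) g (D.dual h) g' α' E i' A₂)
    (fun m α β m' α' β' => D.N s a m' (D.dual t) y m α' β' α β)
    (fun m α β => D.N_pentagon_corner s t a b c m y b' c' A₁ B₁ C C' α β h₁) ?_
  intro m' α' β'
  refine (D.N_pentagon_corner t s (D.dual a) g h (D.dual m') (D.dual y) g' h' B₂ A₂ E E' β' α'
    h₂).trans ?_
  rw [D.sum_I_dual]
  refine Finset.sum_congr rfl fun M _ => Finset.sum_congr rfl fun β _ =>
    Finset.sum_congr rfl fun α _ => ?_
  rw [D.N_half_turn s]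
  simp only [D.dual_dual, D.d_dual]

end LWData

/-! ### Commutation of plaquette operators -/

theorem Fintype.sum_piFinset_split {E B K : Type*} [Fintype E] [DecidableEq E] [AddCommMonoid K]
    (e₀ : E) (b₀ : B) (t t' : E → Finset B) (h₀ : t' e₀ = {b₀}) (h : ∀ e, e ≠ e₀ → t' e = t e)
    (f : (E → B) → K) :
    ∑ a ∈ Fintype.piFinset t, f a
      = ∑ a ∈ Fintype.piFinset t', ∑ b ∈ t e₀, f (Function.update a e₀ b) := by
  rw [← Finset.sum_product']
  refine Finset.sum_bij' (fun a _ => (Function.update a e₀ b₀, a e₀))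
    (fun w _ => Function.update w.1 e₀ w.2) ?_ ?_ ?_ ?_ ?_
  · intro a ha
    rw [Fintype.mem_piFinset] at ha
    rw [Finset.mem_product, Fintype.mem_piFinset]
    refine ⟨fun e => ?_, ha e₀⟩
    dsimp only
    by_cases he : e = e₀
    · subst he; rw [Function.update_self, h₀]; exact Finset.mem_singleton_self _
    · rw [Function.update_of_ne he, h e he]; exact ha e
  · rintro ⟨a, b⟩ hw
    rw [Finset.mem_product, Fintype.mem_piFinset] at hw
    rw [Fintype.mem_piFinset]
    intro e
    by_cases he : e = e₀
    · subst he; rw [Function.update_self]; exact hw.2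
    · rw [Function.update_of_ne he, ← h e he]; exact hw.1 e
  · intro a _
    simp
  · rintro ⟨a, b⟩ hw
    rw [Finset.mem_product, Fintype.mem_piFinset] at hw
    have := hw.1 e₀
    rw [h₀, Finset.mem_singleton] at this
    dsimp only at this ⊢
    rw [Function.update_self, Function.update_idem, ← this, Function.update_eq_self]
  · intro a _
    simp

theorem Fintype.sum_piFinset_bool {K : Type*} [AddCommMonoid K] (r : Bool → Finset ℕ)
    (f : ℕ → ℕ → K) :
    ∑ c ∈ Fintype.piFinset r, f (c true) (c false) = ∑ i ∈ r true, ∑ j ∈ r false, f i j := by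
  rw [← Finset.sum_product']
  refine Finset.sum_bij' (fun c _ => (c true, c false)) (fun w _ b => cond b w.1 w.2)
    ?_ ?_ ?_ ?_ ?_
  · intro c hc
    rw [Fintype.mem_piFinset] at hc
    exact Finset.mem_product.2 ⟨hc _, hc _⟩
  · intro w hw
    rw [Finset.mem_product] at hw
    rw [Fintype.mem_piFinset]
    rintro (_ | _)
    · exact hw.2
    · exact hw.1
  · intro c _
    funext b
    cases b <;> rfl
  · intro w _
    rfl
  · intro c _
    rfl

theorem Fintype.sum_piFinset_unit {B K : Type*} [AddCommMonoid K] (r : Finset B) (f : B → K) :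
    ∑ c ∈ Fintype.piFinset fun _ : Unit => r, f (c ()) = ∑ i ∈ r, f i :=
  Finset.sum_bij' (fun c _ => c ()) (fun b _ _ => b)
    (fun _ hc => Fintype.mem_piFinset.1 hc ()) (fun _ hb => Fintype.mem_piFinset.2 fun _ => hb)
    (fun _ _ => rfl) (fun _ _ => rfl) (fun _ _ => rfl)

namespace LWData

variable {K : Type*} [Field K] [StarRing K] {G : Type*} [AddCommGroup G] {A : Type*}
  (D : LWData K G A) {E : Type*} [Fintype E] [DecidableEq E] (nx : Equiv.Perm E)

/-- The branching labels on the edges of a ring other than `e₀`. -/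
def restLabels (e₀ : E) (s : A) (y x : E → A) : Finset (E → ℕ) :=
  Fintype.piFinset fun e => if e = e₀ then {0} else Finset.Icc 1 (D.δ (D.dual (y e)) s (x e))

/-- The contribution of the vertices of a ring that are not ends of the edge `e₀`. -/
def restProd (e₀ : E) (k : E → A) (s : A) (y x : E → A) (c' c a : E → ℕ) : K :=
  ∏ e ∈ (Finset.univ.erase e₀).erase (nx.symm e₀),
    D.N (D.dual (y (nx e))) s (D.dual (x (nx e))) (x e) (D.dual (k e)) (y e)
      (a (nx e)) (c e) (c' e) (a e)

theorem ringCoeff_split (e₀ : E) (hne : nx.symm e₀ ≠ e₀) (s : A)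
    (k k₀ y y₀ x x₀ : E → A) (c' c₀' c c₀ : E → ℕ)
    (hy : ∀ e, e ≠ e₀ → y e = y₀ e) (hx : ∀ e, e ≠ e₀ → x e = x₀ e)
    (hk : ∀ e, e ≠ e₀ → e ≠ nx.symm e₀ → k e = k₀ e)
    (hc : ∀ e, e ≠ e₀ → e ≠ nx.symm e₀ → c e = c₀ e)
    (hc' : ∀ e, e ≠ e₀ → e ≠ nx.symm e₀ → c' e = c₀' e) :
    D.ringCoeff nx k s y x c' c = (∏ e ∈ Finset.univ.erase e₀, D.d (y₀ e)) *
      ∑ a ∈ D.restLabels e₀ s y₀ x₀, D.restProd nx e₀ k₀ s y₀ x₀ c₀' c₀ a * (D.d (y e₀) *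
        ∑ α ∈ Finset.Icc 1 (D.δ (D.dual (y e₀)) s (x e₀)),
          D.N (D.dual (y₀ (nx e₀))) s (D.dual (x₀ (nx e₀))) (x e₀) (D.dual (k e₀)) (y e₀)
            (a (nx e₀)) (c e₀) (c' e₀) α *
          D.N (D.dual (y e₀)) s (D.dual (x e₀)) (x₀ (nx.symm e₀)) (D.dual (k (nx.symm e₀)))
            (y₀ (nx.symm e₀)) α (c (nx.symm e₀)) (c' (nx.symm e₀)) (a (nx.symm e₀))) := by
  have hne' : nx e₀ ≠ e₀ := fun h => hne (by rw [Equiv.symm_apply_eq, h])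
  rw [ringCoeff_eq, Fintype.sum_piFinset_split e₀ 0 _
    (fun e => if e = e₀ then {0} else Finset.Icc 1 (D.δ (D.dual (y₀ e)) s (x₀ e))) (if_pos rfl)
    (fun e he => by rw [if_neg he, hy e he, hx e he])]
  rw [← Finset.mul_prod_erase Finset.univ (fun e => D.d (y e)) (Finset.mem_univ e₀),
    mul_comm (D.d (y e₀)), mul_assoc]
  rw [Finset.prod_congr rfl fun e he => by rw [hy e (Finset.ne_of_mem_erase he)]]
  congr 1
  rw [Finset.mul_sum]
  refine Finset.sum_congr rfl fun a _ => ?_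
  rw [mul_left_comm]
  congr 1
  rw [Finset.mul_sum]
  refine Finset.sum_congr rfl fun α _ => ?_
  rw [← Finset.mul_prod_erase Finset.univ _ (Finset.mem_univ e₀),
    ← Finset.mul_prod_erase (Finset.univ.erase e₀) _
      (Finset.mem_erase.2 ⟨hne, Finset.mem_univ (nx.symm e₀)⟩)]
  rw [← mul_assoc, mul_comm]
  congr 1
  · refine Finset.prod_congr rfl fun e he => ?_
    have h1 := Finset.ne_of_mem_erase he
    have h2 := Finset.ne_of_mem_erase (Finset.mem_of_mem_erase he)
    have h3 : nx e ≠ e₀ := fun h => h1 (by rw [← h, Equiv.symm_apply_apply])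
    rw [Function.update_of_ne h3, Function.update_of_ne h2, hy e h2, hx e h2, hy _ h3, hx _ h3,
      hk e h2 h1, hc e h2 h1, hc' e h2 h1]
  · rw [Equiv.apply_symm_apply, Function.update_of_ne hne', Function.update_self,
      Function.update_of_ne hne, hy _ hne', hx _ hne', hy _ hne, hx _ hne]

end LWData

namespace TriangulatedSurface

variable {V F : Type*} (S : TriangulatedSurface V F) {p q : V}

/-- The edge between `p` and `q`, seen from `q`. -/
def flip (e : S.Spoke p) (he : S.tgt e.1 = q) : S.Spoke q :=
  ⟨S.opp e.1, (S.src_opp e.1).trans he⟩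

theorem eq_of_src_tgt {e e' : F × Fin 3} (h : S.src e = S.src e') (h' : S.tgt e = S.tgt e') :
    e = e' := S.edge_ext e e' h h'

theorem spoke_eq_of_tgt {e e' : S.Spoke p} (h : S.tgt e.1 = q) (h' : S.tgt e'.1 = q) : e = e' :=
  Subtype.ext (S.eq_of_src_tgt (e.2.trans e'.2.symm) (h.trans h'.symm))

theorem nextPerm_symm_ne (e : S.Spoke p) : (S.nextPerm p).symm e ≠ e := fun h => by
  have h1 : S.next e.1 = e.1 := by
    conv_lhs => rw [← congrArg Subtype.val h]
    exact S.next_prev e.1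
  have h2 : S.tgt (S.next e.1) = S.src (e.1.1, e.1.2 + 2) := S.tgt_opp _
  rw [h1] at h2
  have h3 : ∀ i : Fin 3, i + 1 ≠ i + 2 := by decide
  exact h3 _ (S.vert_injective _ h2)

/-- A triangle at `p` that contains `q` is adjacent to an edge between `p` and `q`. -/
theorem tgt_of_mem_face (hpq : p ≠ q) (e : S.Spoke p) (h : ∃ j, S.vert e.1.1 j = q) :
    S.tgt e.1 = q ∨ S.tgt (S.nextPerm p e).1 = q := by
  obtain ⟨j, hj⟩ := h
  rcases Fin.three_cases e.1.2 j with rfl | rfl | rfl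
  · exact absurd (e.2.symm.trans hj) hpq
  · exact Or.inl hj
  · right
    exact (S.tgt_opp _).trans hj

end TriangulatedSurface

namespace LW

variable {G : Type*} [AddCommGroup G] {A : Type*} {D : LWData ℂ G A}
  {V F : Type*} {S : TriangulatedSurface V F} {Φ Φ' Φ'' : GColoring S G}

/-- Two states agree away from the boundaries of the plaquettes `p` and `q`. -/
def AgreeAway₂ (p q : V) (σ' : LWState D Φ') (σ : LWState D Φ) : Prop :=
  (∀ e, S.src e ≠ p → S.tgt e ≠ p → S.src e ≠ q → S.tgt e ≠ q → σ'.lab e = σ.lab e) ∧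
    ∀ t, (∀ i, S.vert t i ≠ p) → (∀ i, S.vert t i ≠ q) → σ'.br t = σ.br t

theorem AgreeAway₂.swap {p q : V} {σ' : LWState D Φ'} {σ : LWState D Φ}
    (h : AgreeAway₂ p q σ' σ) : AgreeAway₂ q p σ' σ :=
  ⟨fun e h1 h2 h3 h4 => h.1 e h3 h4 h1 h2, fun t h1 h2 => h.2 t h2 h1⟩

theorem AgreeAway.agreeAway₂ {p q : V} {σ'' : LWState D Φ''} {ρ : LWState D Φ'}
    {σ : LWState D Φ} (h1 : AgreeAway p σ'' ρ) (h2 : AgreeAway q ρ σ) : AgreeAway₂ p q σ'' σ :=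
  ⟨fun e n1 n2 n3 n4 => (h1.1 e n1 n2).trans (h2.1 e n3 n4),
    fun t n1 n2 => (h1.2 t n1).trans (h2.2 t n2)⟩

section Between

variable {p q : V} {σ'' : LWState D Φ''} {ρ : LWState D Φ'} {σ : LWState D Φ}

theorem rimLab_eq_right (hpq : p ≠ q) (h2 : AgreeAway q ρ σ) (e : S.Spoke p)
    (he : S.tgt e.1 ≠ q) : rimLab p ρ e = rimLab p σ e :=
  h2.1 e.1 (fun h => hpq (e.2.symm.trans h)) he

theorem rimLab_eq_left (hpq : p ≠ q) (h1 : AgreeAway p σ'' ρ) (f : S.Spoke q)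
    (hf : S.tgt f.1 ≠ p) : rimLab q ρ f = rimLab q σ'' f :=
  (h1.1 f.1 (fun h => hpq (h.symm.trans f.2)) hf).symm

theorem legLab_eq_of_between (h1 : AgreeAway p σ'' ρ) (h2 : AgreeAway q ρ σ) (e : S.Spoke p)
    (he : ∀ j, S.vert e.1.1 j ≠ q) : legLab p σ'' e = legLab p σ e :=
  (h1.1 _ (S.third_not_mem p e).1 (S.third_not_mem p e).2).trans (h2.1 _ (he _) (he _))

variable (S) in
theorem face_not_mem_of_ne (hpq : p ≠ q) (e₀ : S.Spoke p) (he₀ : S.tgt e₀.1 = q) (e : S.Spoke p)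
    (n1 : e ≠ e₀) (n2 : e ≠ (S.nextPerm p).symm e₀) (j : Fin 3) : S.vert e.1.1 j ≠ q := by
  intro hj
  rcases S.tgt_of_mem_face hpq e ⟨j, hj⟩ with h | h
  · exact n1 (S.spoke_eq_of_tgt h he₀)
  · exact n2 (by rw [Equiv.eq_symm_apply]; exact S.spoke_eq_of_tgt h he₀)

theorem legLab_eq_rimLab_flip (σ : LWState D Φ) (e₀ : S.Spoke p) (he₀ : S.tgt e₀.1 = q) :
    legLab p σ e₀ = rimLab q σ ((S.nextPerm q).symm (S.flip e₀ he₀)) := by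
  change σ.lab _ = σ.lab (S.prev (S.opp e₀.1))
  rw [TriangulatedSurface.prev, S.opp_opp]

theorem legLab_prev (σ : LWState D Φ) (e₀ : S.Spoke p) (he₀ : S.tgt e₀.1 = q) :
    legLab p σ ((S.nextPerm p).symm e₀)
      = D.dual (rimLab q σ (S.nextPerm q (S.flip e₀ he₀))) := by
  have h : ∀ i : Fin 3, i + 1 + 1 = i + 2 := by decide
  change σ.lab ((S.opp e₀.1).1, (S.opp e₀.1).2 + 1 + 1) = D.dual (σ.lab (S.next (S.opp e₀.1)))
  rw [h, σ.lab_add_two]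

theorem tgt_flip (e₀ : S.Spoke p) (he₀ : S.tgt e₀.1 = q) : S.tgt (S.flip e₀ he₀).1 = p :=
  (S.tgt_opp e₀.1).trans e₀.2

end Between

variable [DecidableEq V] [Fintype F] [DecidableEq F]

theorem sum_mul_eq_sum_common {p q : V} (hpq : p ≠ q) {ι κ : Type*} [Fintype ι] [DecidableEq ι]
    [Fintype κ] [DecidableEq κ] {s t : A} (ε : ι → F × Fin 3) (τ : κ → F)
    (hε : Function.Injective ε) (hτ : Function.Injective τ)
    (hε₁ : ∀ i, S.src (ε i) = p ∧ S.tgt (ε i) = q)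
    (hε₂ : ∀ e, S.src e = p → S.tgt e = q → ∃ i, ε i = e)
    (hτ₁ : ∀ k, (∃ e : S.Spoke p, e.1.1 = τ k) ∧ ∃ j, S.vert (τ k) j = q)
    (hτ₂ : ∀ t, (∃ j, S.vert t j = p) → (∃ j, S.vert t j = q) → ∃ k, τ k = t)
    (hΦ' : Φ' = Φ.addPlaquette (D.deg t) q) (hΦ'' : Φ'' = Φ'.addPlaquette (D.deg s) p)
    (σ'' : LWState D Φ'') (σ : LWState D Φ) (h : AgreeAway₂ p q σ'' σ)
    (r : (ι → A) → κ → ℕ)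
    (hr : ∀ ρ : LWState D Φ', AgreeAway p σ'' ρ → AgreeAway q ρ σ → ∀ k,
      r (fun i => ρ.lab (ε i)) k =
        D.δ (ρ.lab (τ k, 0)) (ρ.lab (τ k, 1)) (ρ.lab (τ k, 2)))
    (f₀ : (ι → A) → (κ → ℕ) → ℂ)
    (hf₀ : ∀ ρ : LWState D Φ', AgreeAway p σ'' ρ → AgreeAway q ρ σ →
      plaquetteCoeff D p s σ'' ρ * plaquetteCoeff D q t ρ σ
        = f₀ (fun i => ρ.lab (ε i)) (fun k => ρ.br (τ k))) :
    ∑ ρ : LWState D Φ', plaquetteCoeff D p s σ'' ρ * plaquetteCoeff D q t ρ σ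
      = ∑ x ∈ Fintype.piFinset fun i => D.I (Φ'.val (ε i)),
        ∑ c ∈ Fintype.piFinset fun k => Finset.Icc 1 (r x k), f₀ x c := by
  classical
  let lab₀ : F × Fin 3 → A := fun e =>
    if S.src e = q ∨ S.tgt e = q then σ''.lab e else σ.lab e
  let br₀ : F → ℕ := fun t => if ∃ j, S.vert t j = q then σ''.br t else σ.br t
  have off : ∀ e, (∀ i, ε i ≠ e) → (∀ i, S.opp (ε i) ≠ e) → (S.src e = q ∨ S.tgt e = q) →
      S.src e ≠ p ∧ S.tgt e ≠ p := by
    intro e h1 h2 h3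
    constructor
    · intro h4
      rcases h3 with h3 | h3
      · exact hpq (h4.symm.trans h3)
      · obtain ⟨i, hi⟩ := hε₂ e h4 h3
        exact h1 i hi
    · intro h4
      rcases h3 with h3 | h3
      · obtain ⟨i, hi⟩ := hε₂ (S.opp e) (by rw [S.src_opp, h4]) (by rw [S.tgt_opp, h3])
        exact h2 i (by rw [hi, S.opp_opp])
      · exact hpq (h4.symm.trans h3)
  have between : ∀ ρ : LWState D Φ', LWState.AgreesOff ε τ lab₀ br₀ ρ →
      AgreeAway p σ'' ρ ∧ AgreeAway q ρ σ := by
    rintro ρ ⟨h1, h2⟩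
    refine ⟨⟨fun e n1 n2 => ?_, fun t n1 => ?_⟩, ⟨fun e n1 n2 => ?_, fun t n1 => ?_⟩⟩
    · have h3 := h1 e (fun i hi => n1 (by rw [← hi, (hε₁ i).1]))
        (fun i hi => n2 (by rw [← hi, S.tgt_opp, (hε₁ i).1]))
      by_cases h4 : S.src e = q ∨ S.tgt e = q
      · rw [h3]; exact (if_pos h4).symm
      · rw [h3]
        refine Eq.trans ?_ (if_neg h4).symm
        exact h.1 e n1 n2 (fun h5 => h4 (Or.inl h5)) (fun h5 => h4 (Or.inr h5))
    · have h3 := h2 t fun k hk => by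
        obtain ⟨e, he⟩ := (hτ₁ k).1
        exact (S.face_not_mem_iff_spoke p t).1 n1 e (he.trans hk)
      by_cases h4 : ∃ j, S.vert t j = q
      · rw [h3]; exact (if_pos h4).symm
      · rw [h3]
        exact (h.2 t n1 (not_exists.1 h4)).trans (if_neg h4).symm
    · have h3 := h1 e (fun i hi => n2 (by rw [← hi, (hε₁ i).2]))
        (fun i hi => n1 (by rw [← hi, S.src_opp, (hε₁ i).2]))
      rw [h3]
      exact if_neg (not_or.2 ⟨n1, n2⟩)
    · have h3 := h2 t fun k hk => by
        obtain ⟨j, hj⟩ := (hτ₁ k).2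
        exact n1 j (by rw [← hk, hj])
      rw [h3]
      exact if_neg (not_exists.2 n1)
  have vert_edge : ∀ t j, (S.src (t, j) = q ∨ S.tgt (t, j) = q) → ∃ j, S.vert t j = q := by
    rintro t j (h1 | h1)
    · exact ⟨_, h1⟩
    · exact ⟨_, h1⟩
  refine LWState.sum_eq_sum_patch hε ?_ hτ ?_ ?_ lab₀ br₀ ?_ ?_ r
    (fun ρ hρ => hr ρ (between ρ hρ).1 (between ρ hρ).2) _ f₀ ?_
    (fun ρ hρ => hf₀ ρ (between ρ hρ).1 (between ρ hρ).2)
  · intro i j hij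
    have := (hε₁ j).1
    rw [← hij, S.src_opp, (hε₁ i).2] at this
    exact hpq this.symm
  · exact fun i => hτ₂ _ ⟨_, (hε₁ i).1⟩ ⟨_, (hε₁ i).2⟩
  · exact fun i => hτ₂ _ ⟨_, (S.tgt_opp _).trans (hε₁ i).1⟩ ⟨_, (S.src_opp _).trans (hε₁ i).2⟩
  · intro e h1 h2
    by_cases h3 : S.src e = q ∨ S.tgt e = q
    · have h4 : S.src (S.opp e) = q ∨ S.tgt (S.opp e) = q := by
        rw [S.src_opp, S.tgt_opp]; exact h3.symm
      obtain ⟨n1, n2⟩ := off e h1 h2 h3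
      refine ⟨?_, ?_⟩
      · have h5 := σ''.lab_mem e
        simp only [hΦ'', GColoring.addPlaquette, if_neg n1, if_neg n2, add_zero, sub_zero] at h5
        change (if _ then _ else _) ∈ _
        rwa [if_pos h3]
      · change (if _ then _ else _) = D.dual (if _ then _ else _)
        rw [if_pos h3, if_pos h4, σ''.lab_opp]
    · have h4 : ¬ (S.src (S.opp e) = q ∨ S.tgt (S.opp e) = q) := by
        rw [S.src_opp, S.tgt_opp]; exact fun h => h3 h.symm
      obtain ⟨n1, n2⟩ := not_or.1 h3
      refine ⟨?_, ?_⟩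
      · have h5 := σ.lab_mem e
        change (if _ then _ else _) ∈ _
        rw [if_neg h3]
        simpa only [hΦ', GColoring.addPlaquette, if_neg n1, if_neg n2, add_zero, sub_zero]
          using h5
      · change (if _ then _ else _) = D.dual (if _ then _ else _)
        rw [if_neg h3, if_neg h4, σ.lab_opp]
  · intro t ht
    by_cases h1 : ∃ j, S.vert t j = q
    · have h2 : ∀ j, S.vert t j ≠ p := fun j hj => by
        obtain ⟨k, hk⟩ := hτ₂ t ⟨j, hj⟩ h1
        exact ht k hk
      have h3 : ∀ j, lab₀ (t, j) = σ''.lab (t, j) := fun j => by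
        by_cases h4 : S.src (t, j) = q ∨ S.tgt (t, j) = q
        · exact if_pos h4
        · refine (if_neg h4).trans (h.1 (t, j) (h2 j) (h2 (j + 1)) ?_ ?_).symm
          · exact fun h5 => h4 (Or.inl h5)
          · exact fun h5 => h4 (Or.inr h5)
      rw [h3, h3, h3]
      exact (if_pos h1).trans_le (σ''.br_le t)
    · have h3 : ∀ j, lab₀ (t, j) = σ.lab (t, j) := fun j =>
        if_neg fun h4 => h1 (vert_edge t j h4)
      rw [h3, h3, h3]
      exact (if_neg h1).trans_le (σ.br_le t)
  · intro ρ hρ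
    have g1 := agreeAway_of_plaquetteCoeff_ne_zero (left_ne_zero_of_mul hρ)
    have g2 := agreeAway_of_plaquetteCoeff_ne_zero (right_ne_zero_of_mul hρ)
    refine ⟨⟨fun e h1 h2 => ?_, fun t ht => ?_⟩, fun k => ?_⟩
    · by_cases h3 : S.src e = q ∨ S.tgt e = q
      · obtain ⟨n1, n2⟩ := off e h1 h2 h3
        exact (g1.1 e n1 n2).symm.trans (if_pos h3).symm
      · obtain ⟨n1, n2⟩ := not_or.1 h3
        exact (g2.1 e n1 n2).trans (if_neg h3).symm
    · by_cases h3 : ∃ j, S.vert t j = q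
      · refine (g1.2 t fun j hj => ?_).symm.trans (if_pos h3).symm
        obtain ⟨k, hk⟩ := hτ₂ t ⟨j, hj⟩ h3
        exact ht k hk
      · exact (g2.2 t (not_exists.1 h3)).trans (if_neg h3).symm
    · obtain ⟨e, he⟩ := (hτ₁ k).1
      rw [← he]
      exact (one_le_of_plaquetteCoeff_ne_zero (left_ne_zero_of_mul hρ) e).1

theorem sum_mul_eq_zero_of_not_agree {p q : V} {s t : A} {σ'' : LWState D Φ''}
    {σ : LWState D Φ} (h : ¬ AgreeAway₂ p q σ'' σ) :
    ∑ ρ : LWState D Φ', plaquetteCoeff D p s σ'' ρ * plaquetteCoeff D q t ρ σ = 0 := by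
  refine Finset.sum_eq_zero fun ρ _ => ?_
  by_contra h'
  exact h ((agreeAway_of_plaquetteCoeff_ne_zero (left_ne_zero_of_mul h')).agreeAway₂
    (agreeAway_of_plaquetteCoeff_ne_zero (right_ne_zero_of_mul h')))

/-- Plaquettes without a common edge. -/
theorem sum_mul_of_not_adjacent {p q : V} (hpq : p ≠ q) {s t : A}
    (hadj : ∀ e, S.src e = p → S.tgt e ≠ q)
    (hΦ' : Φ' = Φ.addPlaquette (D.deg t) q) (hΦ'' : Φ'' = Φ'.addPlaquette (D.deg s) p)
    (σ'' : LWState D Φ'') (σ : LWState D Φ) (h : AgreeAway₂ p q σ'' σ) :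
    ∑ ρ : LWState D Φ', plaquetteCoeff D p s σ'' ρ * plaquetteCoeff D q t ρ σ
      = D.ringCoeff (S.nextPerm p) (legLab p σ) s (rimLab p σ'') (rimLab p σ) (rimBr p σ'')
          (rimBr p σ) *
        D.ringCoeff (S.nextPerm q) (legLab q σ) t (rimLab q σ'') (rimLab q σ) (rimBr q σ'')
          (rimBr q σ) := by
  classical
  have face : ∀ t, (∃ j, S.vert t j = p) → ¬ ∃ j, S.vert t j = q := by
    rintro t ⟨i, hi⟩ h2
    rcases S.tgt_of_mem_face hpq ⟨(t, i), hi⟩ h2 with h3 | h3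
    · exact hadj (t, i) hi h3
    · exact hadj _ (S.nextPerm p ⟨(t, i), hi⟩).2 h3
  have hadj' : ∀ e, S.src e = q → S.tgt e ≠ p := fun e h1 h2 =>
    hadj (S.opp e) (by rw [S.src_opp, h2]) (by rw [S.tgt_opp, h1])
  rw [sum_mul_eq_sum_common hpq (ι := Empty) (κ := Empty) (fun i => i.elim) (fun i => i.elim)
    (fun i => i.elim) (fun i => i.elim) (fun i => i.elim) (fun e h1 h2 => absurd h2 (hadj e h1))
    (fun i => i.elim) (fun t h1 h2 => absurd h2 (face t h1)) hΦ' hΦ'' σ'' σ h (fun _ i => i.elim)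
    (fun _ _ _ i => i.elim) (fun _ _ =>
      D.ringCoeff (S.nextPerm p) (legLab p σ) s (rimLab p σ'') (rimLab p σ) (rimBr p σ'')
          (rimBr p σ) *
        D.ringCoeff (S.nextPerm q) (legLab q σ) t (rimLab q σ'') (rimLab q σ) (rimBr q σ'')
          (rimBr q σ)) ?_]
  · simp
  · intro ρ h1 h2
    have e1 : rimLab p ρ = rimLab p σ := funext fun e => rimLab_eq_right hpq h2 e (hadj _ e.2)
    have e2 : rimLab q ρ = rimLab q σ'' := funext fun f => rimLab_eq_left hpq h1 f (hadj' _ f.2)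
    have e3 : rimBr p ρ = rimBr p σ := funext fun e =>
      h2.2 _ (not_exists.1 (face _ ⟨_, e.2⟩))
    have e4 : rimBr q ρ = rimBr q σ'' := funext fun f =>
      (h1.2 _ (not_exists.1 fun h3 => face _ h3 ⟨_, f.2⟩)).symm
    have e5 : legLab p ρ = legLab p σ := funext fun e => by
      rw [← h1.legLab_eq]
      exact legLab_eq_of_between h1 h2 e (not_exists.1 (face _ ⟨_, e.2⟩))
    rw [plaquetteCoeff_eq, plaquetteCoeff_eq, if_pos h1, if_pos h2, e1, e2, e3, e4, e5]

end LW

namespace LW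

theorem sum_comm₂ {K N B C : Type*} [AddCommMonoid K] (X : Finset N) (R : Finset B)
    (R' : Finset C) (f : N → B → C → K) :
    ∑ x ∈ X, ∑ a ∈ R, ∑ b ∈ R', f x a b = ∑ a ∈ R, ∑ b ∈ R', ∑ x ∈ X, f x a b :=
  Finset.sum_comm.trans (Finset.sum_congr rfl fun _ _ => Finset.sum_comm)

theorem sum_mul_sum_factor {K B C M : Type*} [CommRing K] (I : Finset M) (J J' : M → Finset ℕ)
    (R : Finset B) (R' : Finset C) (dp dq dy : K) (P : B → K) (Q : C → K) (d : M → K)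
    (L : M → ℕ → ℕ → B → K) (L' : M → ℕ → ℕ → C → K) :
    ∑ m ∈ I, ∑ i ∈ J m, ∑ j ∈ J' m, (dp * ∑ a ∈ R, P a * (dy * L m i j a)) *
        (dq * ∑ b ∈ R', Q b * (d m * L' m i j b))
      = dp * dq * dy * ∑ a ∈ R, ∑ b ∈ R', P a * Q b *
        ∑ m ∈ I, ∑ i ∈ J m, ∑ j ∈ J' m, d m * L m i j a * L' m i j b := by
  have h1 : ∀ m i j, (dp * ∑ a ∈ R, P a * (dy * L m i j a)) *
        (dq * ∑ b ∈ R', Q b * (d m * L' m i j b))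
      = ∑ a ∈ R, ∑ b ∈ R', dp * dq * dy * (P a * Q b * (d m * L m i j a * L' m i j b)) := by
    intro m i j
    rw [mul_mul_mul_comm, Finset.sum_mul_sum, Finset.mul_sum]
    refine Finset.sum_congr rfl fun a _ => ?_
    rw [Finset.mul_sum]
    exact Finset.sum_congr rfl fun b _ => by ring
  simp only [h1]
  refine ((Finset.sum_congr rfl fun m _ => (Finset.sum_congr rfl fun i _ =>
    sum_comm₂ _ R R' _).trans (sum_comm₂ _ R R' _)).trans (sum_comm₂ _ R R' _)).trans ?_
  simp only [Finset.mul_sum]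

variable {G : Type*} [AddCommGroup G] {A : Type*} {D : LWData ℂ G A}
  {V F : Type*} {S : TriangulatedSurface V F} {Φ Φ' Φ'' Φ₁ Φ₂ : GColoring S G}
  [DecidableEq V] [Fintype F] [DecidableEq F]

/-- Plaquettes with a common edge. -/
theorem sum_mul_of_adjacent {p q : V} (hpq : p ≠ q) {s t : A}
    (e₀ : S.Spoke p) (f₀ : S.Spoke q) (hf₀ : f₀.1 = S.opp e₀.1)
    (hΦ' : Φ' = Φ.addPlaquette (D.deg t) q) (hΦ'' : Φ'' = Φ'.addPlaquette (D.deg s) p)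
    (σ'' : LWState D Φ'') (σ : LWState D Φ) (h : AgreeAway₂ p q σ'' σ) :
    ∑ ρ : LWState D Φ', plaquetteCoeff D p s σ'' ρ * plaquetteCoeff D q t ρ σ
      = (∏ e ∈ Finset.univ.erase e₀, D.d (rimLab p σ'' e)) *
        (∏ f ∈ Finset.univ.erase f₀, D.d (rimLab q σ'' f)) * D.d (rimLab p σ'' e₀) *
        ∑ a ∈ D.restLabels e₀ s (rimLab p σ'') (rimLab p σ),
        ∑ b ∈ D.restLabels f₀ t (rimLab q σ'') (rimLab q σ),
          D.restProd (S.nextPerm p) e₀ (legLab p σ) s (rimLab p σ'') (rimLab p σ)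
            (rimBr p σ'') (rimBr p σ) a *
          D.restProd (S.nextPerm q) f₀ (legLab q σ) t (rimLab q σ'') (rimLab q σ)
            (rimBr q σ'') (rimBr q σ) b *
          D.edgeSum s t (rimLab p σ e₀)
            (rimLab q σ ((S.nextPerm q).symm f₀)) (D.dual (rimLab p σ (S.nextPerm p e₀)))
            (rimLab p σ ((S.nextPerm p).symm e₀)) (D.dual (rimLab q σ (S.nextPerm q f₀)))
            (rimLab p σ'' e₀)
            (rimLab q σ'' ((S.nextPerm q).symm f₀)) (D.dual (rimLab p σ'' (S.nextPerm p e₀)))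
            (rimLab p σ'' ((S.nextPerm p).symm e₀)) (D.dual (rimLab q σ'' (S.nextPerm q f₀)))
            (rimBr p σ e₀) (rimBr p σ'' e₀) (rimBr q σ f₀) (rimBr q σ'' f₀)
            (a (S.nextPerm p e₀)) (a ((S.nextPerm p).symm e₀))
            (b ((S.nextPerm q).symm f₀)) (b (S.nextPerm q f₀)) := by
  classical
  have he₀ : S.tgt e₀.1 = q := by rw [← S.src_opp, ← hf₀, f₀.2]
  have hfl : f₀ = S.flip e₀ he₀ := Subtype.ext hf₀
  have hft : S.tgt f₀.1 = p := by rw [hfl]; exact tgt_flip e₀ he₀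
  have hfl' : e₀ = S.flip f₀ hft := Subtype.ext
    (show e₀.1 = S.opp f₀.1 by rw [hf₀, S.opp_opp])
  have np := S.nextPerm_symm_ne e₀
  have nq := S.nextPerm_symm_ne f₀
  have np' : S.nextPerm p e₀ ≠ e₀ := fun h => np (by rw [Equiv.symm_apply_eq, h])
  have nq' : S.nextPerm q f₀ ≠ f₀ := fun h => nq (by rw [Equiv.symm_apply_eq, h])
  have tp : ∀ e : S.Spoke p, e ≠ e₀ → S.tgt e.1 ≠ q := fun e n h => n (S.spoke_eq_of_tgt h he₀)
  have tq : ∀ f : S.Spoke q, f ≠ f₀ → S.tgt f.1 ≠ p := fun f n h => n (S.spoke_eq_of_tgt h hft)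
  have face₁ : ((S.nextPerm q).symm f₀).1.1 = e₀.1.1 := by
    change (S.opp f₀.1).1 = _
    rw [hf₀, S.opp_opp]
  have face₂ : ((S.nextPerm p).symm e₀).1.1 = f₀.1.1 := by
    change (S.opp e₀.1).1 = _
    rw [hf₀]
  have leg₁ : ∀ {Ψ : GColoring S G} (ρ : LWState D Ψ),
      legLab p ρ e₀ = rimLab q ρ ((S.nextPerm q).symm f₀) := fun ρ => by
    rw [legLab_eq_rimLab_flip ρ e₀ he₀, ← hfl]
  have leg₂ : ∀ {Ψ : GColoring S G} (ρ : LWState D Ψ),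
      legLab p ρ ((S.nextPerm p).symm e₀) = D.dual (rimLab q ρ (S.nextPerm q f₀)) := fun ρ => by
    rw [legLab_prev ρ e₀ he₀, ← hfl]
  have leg₃ : ∀ {Ψ : GColoring S G} (ρ : LWState D Ψ),
      legLab q ρ f₀ = rimLab p ρ ((S.nextPerm p).symm e₀) := fun ρ => by
    rw [legLab_eq_rimLab_flip ρ f₀ hft, ← hfl']
  have leg₄ : ∀ {Ψ : GColoring S G} (ρ : LWState D Ψ),
      legLab q ρ ((S.nextPerm q).symm f₀) = D.dual (rimLab p ρ (S.nextPerm p e₀)) := fun ρ => by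
    rw [legLab_prev ρ f₀ hft, ← hfl']
  have flip_lab : ∀ {Ψ : GColoring S G} (ρ : LWState D Ψ),
      rimLab q ρ f₀ = D.dual (rimLab p ρ e₀) := fun ρ => by
    rw [rimLab, hf₀, ρ.lab_opp, rimLab]
  let LP : A → ℕ → ℕ → (S.Spoke p → ℕ) → ℂ := fun m i j a =>
    ∑ α ∈ Finset.Icc 1 (D.δ (D.dual (rimLab p σ'' e₀)) s m),
      D.N (D.dual (rimLab p σ'' (S.nextPerm p e₀))) s (D.dual (rimLab p σ (S.nextPerm p e₀))) m
        (D.dual (rimLab q σ'' ((S.nextPerm q).symm f₀))) (rimLab p σ'' e₀)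
        (a (S.nextPerm p e₀)) i (rimBr p σ'' e₀) α *
      D.N (D.dual (rimLab p σ'' e₀)) s (D.dual m) (rimLab p σ ((S.nextPerm p).symm e₀))
        (D.dual (D.dual (rimLab q σ'' (S.nextPerm q f₀)))) (rimLab p σ'' ((S.nextPerm p).symm e₀))
        α j (rimBr q σ'' f₀) (a ((S.nextPerm p).symm e₀))
  let LQ : A → ℕ → ℕ → (S.Spoke q → ℕ) → ℂ := fun m i j b =>
    ∑ β ∈ Finset.Icc 1 (D.δ m t (D.dual (rimLab p σ e₀))),
      D.N (D.dual (rimLab q σ'' (S.nextPerm q f₀))) t (D.dual (rimLab q σ (S.nextPerm q f₀)))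
        (D.dual (rimLab p σ e₀)) (D.dual (rimLab p σ ((S.nextPerm p).symm e₀))) (D.dual m)
        (b (S.nextPerm q f₀)) (rimBr q σ f₀) j β *
      D.N m t (rimLab p σ e₀) (rimLab q σ ((S.nextPerm q).symm f₀))
        (D.dual (D.dual (rimLab p σ (S.nextPerm p e₀)))) (rimLab q σ'' ((S.nextPerm q).symm f₀))
        β (rimBr p σ e₀) i (b ((S.nextPerm q).symm f₀))
  let g : A → ℕ → ℕ → ℂ := fun m i j =>
    ((∏ e ∈ Finset.univ.erase e₀, D.d (rimLab p σ'' e)) *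
      ∑ a ∈ D.restLabels e₀ s (rimLab p σ'') (rimLab p σ),
        D.restProd (S.nextPerm p) e₀ (legLab p σ) s (rimLab p σ'') (rimLab p σ)
            (rimBr p σ'') (rimBr p σ) a * (D.d (rimLab p σ'' e₀) * LP m i j a)) *
    ((∏ f ∈ Finset.univ.erase f₀, D.d (rimLab q σ'' f)) *
      ∑ b ∈ D.restLabels f₀ t (rimLab q σ'') (rimLab q σ),
        D.restProd (S.nextPerm q) f₀ (legLab q σ) t (rimLab q σ'') (rimLab q σ)
            (rimBr q σ'') (rimBr q σ) b * (D.d m * LQ m i j b))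
  let r : (Unit → A) → Bool → ℕ := fun x k => cond k
    (D.δ (x ()) (rimLab q σ'' ((S.nextPerm q).symm f₀)) (D.dual (rimLab p σ (S.nextPerm p e₀))))
    (D.δ (D.dual (x ())) (rimLab p σ ((S.nextPerm p).symm e₀))
      (D.dual (rimLab q σ'' (S.nextPerm q f₀))))
  have key := sum_mul_eq_sum_common hpq (s := s) (t := t) (ι := Unit) (κ := Bool)
    (fun _ => e₀.1) (fun k => cond k e₀.1.1 f₀.1.1) (fun _ _ _ => rfl) ?_
    (fun _ => ⟨e₀.2, he₀⟩) ?_ ?_ ?_ hΦ' hΦ'' σ'' σ h r ?_ (fun x c => g (x ()) (c true) (c false)) ?_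
  · rw [key]
    have hdeg : Φ'.val e₀.1 = D.deg (rimLab p σ e₀) - D.deg t := by
      have n : S.src e₀.1 ≠ q := fun h => hpq (e₀.2.symm.trans h)
      rw [hΦ', rimLab, σ.deg_lab]
      simp only [GColoring.addPlaquette, if_neg n, if_pos he₀, add_zero]
    refine (Finset.sum_congr rfl fun x _ => Fintype.sum_piFinset_bool
      (fun k => Finset.Icc 1 (r x k)) (g (x ()))).trans ?_
    refine (Fintype.sum_piFinset_unit (D.I (Φ'.val e₀.1)) (fun m =>
      ∑ i ∈ Finset.Icc 1 (r (fun _ => m) true), ∑ j ∈ Finset.Icc 1 (r (fun _ => m) false),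
        g m i j)).trans ?_
    rw [hdeg]
    exact sum_mul_sum_factor _ _ _ _ _ _ _ _ _ _ _ LP LQ
  · have hne : e₀.1.1 ≠ f₀.1.1 := fun h => np (S.spoke_face_injective p (face₂.trans h.symm))
    rintro (_ | _) (_ | _) hk
    · rfl
    · exact absurd hk.symm hne
    · exact absurd hk hne
    · rfl
  · exact fun e h1 h2 => ⟨(), congrArg Subtype.val (S.spoke_eq_of_tgt he₀ h2 (e' := ⟨e, h1⟩))⟩
  · rintro (_ | _)
    · exact ⟨⟨_, face₂⟩, ⟨_, f₀.2⟩⟩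
    · exact ⟨⟨e₀, rfl⟩, ⟨_, he₀⟩⟩
  · rintro t ⟨i, hi⟩ h2
    rcases S.tgt_of_mem_face hpq ⟨(t, i), hi⟩ h2 with h3 | h3
    · refine ⟨true, ?_⟩
      have h4 := S.spoke_eq_of_tgt he₀ h3
      exact congrArg (fun e : S.Spoke p => e.1.1) h4
    · refine ⟨false, face₂.symm.trans ?_⟩
      have h4 := S.spoke_eq_of_tgt he₀ h3
      rw [h4, Equiv.symm_apply_apply]
  · intro ρ h1 h2 k
    cases k
    · have e1 : (f₀.1.1, f₀.1.2 + 1) = ((S.nextPerm p).symm e₀).1 := by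
        rw [hf₀]; rfl
      change D.δ (D.dual (ρ.lab e₀.1)) _ _ = D.δ (ρ.lab (f₀.1.1, 0)) (ρ.lab (f₀.1.1, 1))
        (ρ.lab (f₀.1.1, 2))
      rw [ρ.δ_rot_lab f₀.1.1 f₀.1.2, ρ.lab_add_two, e1]
      change _ = D.δ (rimLab q ρ f₀) (rimLab p ρ ((S.nextPerm p).symm e₀))
        (D.dual (rimLab q ρ (S.nextPerm q f₀)))
      rw [flip_lab, rimLab_eq_right hpq h2 _ (tp _ np), rimLab_eq_left hpq h1 _ (tq _ nq')]
      rfl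
    · change D.δ (ρ.lab e₀.1) _ _ = D.δ (ρ.lab (e₀.1.1, 0)) (ρ.lab (e₀.1.1, 1))
        (ρ.lab (e₀.1.1, 2))
      rw [ρ.δ_rot_lab e₀.1.1 e₀.1.2, ρ.lab_add_two]
      change _ = D.δ (rimLab p ρ e₀) (legLab p ρ e₀)
        (D.dual (rimLab p ρ (S.nextPerm p e₀)))
      rw [leg₁, rimLab_eq_right hpq h2 _ (tp _ np'), rimLab_eq_left hpq h1 _ (tq _ nq)]
      rfl
  · intro ρ h1 h2
    have k1 := D.ringCoeff_split (S.nextPerm p) e₀ np s (legLab p ρ) (legLab p σ)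
      (rimLab p σ'') (rimLab p σ'') (rimLab p ρ) (rimLab p σ) (rimBr p σ'') (rimBr p σ'')
      (rimBr p ρ) (rimBr p σ) (fun _ _ => rfl) (fun e n => rimLab_eq_right hpq h2 e (tp e n))
      (fun e n n' => by
        rw [← h1.legLab_eq]
        exact legLab_eq_of_between h1 h2 e (face_not_mem_of_ne S hpq e₀ he₀ e n n'))
      (fun e n n' => h2.2 _ (face_not_mem_of_ne S hpq e₀ he₀ e n n')) (fun _ _ _ => rfl)
    have k2 := D.ringCoeff_split (S.nextPerm q) f₀ nq t (legLab q σ) (legLab q σ)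
      (rimLab q ρ) (rimLab q σ'') (rimLab q σ) (rimLab q σ) (rimBr q ρ) (rimBr q σ'')
      (rimBr q σ) (rimBr q σ) (fun e n => rimLab_eq_left hpq h1 e (tq e n)) (fun _ _ => rfl)
      (fun _ _ _ => rfl) (fun _ _ _ => rfl)
      (fun e n n' => (h1.2 _ (face_not_mem_of_ne S hpq.symm f₀ hft e n n')).symm)
    rw [plaquetteCoeff_eq, plaquetteCoeff_eq, if_pos h1, if_pos h2, k1, k2]
    rw [← h1.legLab_eq, leg₁, leg₂, leg₃, leg₄]
    simp only [flip_lab, D.d_dual, D.dual_dual]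
    have b1 : ∀ {Ψ : GColoring S G} (ρ : LWState D Ψ),
      rimBr p ρ ((S.nextPerm p).symm e₀) = rimBr q ρ f₀ := fun ρ => congrArg ρ.br face₂
    have b2 : ∀ {Ψ : GColoring S G} (ρ : LWState D Ψ),
      rimBr q ρ ((S.nextPerm q).symm f₀) = rimBr p ρ e₀ := fun ρ => congrArg ρ.br face₁
    simp only [b1, b2]
    simp only [g, LP, LQ, D.dual_dual]
    rfl

end LW

/-! ### Plaquette operators commute -/

namespace LW

variable {G : Type*} [AddCommGroup G] {A : Type*} {D : LWData ℂ G A}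
  {V F : Type*} {S : TriangulatedSurface V F} {Φ Φp Φq Φ'' : GColoring S G}
  [DecidableEq V] [Fintype F] [DecidableEq F]

theorem sum_plaquetteCoeff_mul_comm_of_adjacent {p q : V} (hpq : p ≠ q) {s t : A}
    (e₀ : S.Spoke p) (f₀ : S.Spoke q) (hf₀ : f₀.1 = S.opp e₀.1)
    (hp : Φp.Admissible D.X) (hq : Φq.Admissible D.X)
    (hΦp : Φp = Φ.addPlaquette (D.deg s) p) (hΦq : Φq = Φ.addPlaquette (D.deg t) q)
    (hΦ₁ : Φ'' = Φq.addPlaquette (D.deg s) p) (hΦ₂ : Φ'' = Φp.addPlaquette (D.deg t) q)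
    (σ'' : LWState D Φ'') (σ : LWState D Φ) (h : AgreeAway₂ p q σ'' σ) :
    ∑ ρ : LWState D Φq, plaquetteCoeff D p s σ'' ρ * plaquetteCoeff D q t ρ σ
      = ∑ ρ : LWState D Φp, plaquetteCoeff D q t σ'' ρ * plaquetteCoeff D p s ρ σ := by
  have he₀ : e₀.1 = S.opp f₀.1 := by rw [hf₀, S.opp_opp]
  have flip_lab : ∀ {Ψ : GColoring S G} (ρ : LWState D Ψ),
      rimLab q ρ f₀ = D.dual (rimLab p ρ e₀) := fun ρ => by
    rw [rimLab, hf₀, ρ.lab_opp, rimLab]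
  have deg_rim : ∀ {r : V} (e : S.Spoke r) (u : A) (Ψ : GColoring S G),
      Ψ = Φ.addPlaquette (D.deg u) r → Ψ.val e.1 = D.deg u + D.deg (rimLab r σ e) := by
    intro r e u Ψ hΨ
    have h1 : S.tgt e.1 ≠ r := fun h => S.src_ne_tgt e.1 (e.2.trans h.symm)
    rw [hΨ, rimLab, σ.deg_lab]
    simp only [GColoring.addPlaquette, if_pos e.2, if_neg h1, sub_zero, add_comm]
  have h₁ : D.deg s + D.deg (rimLab p σ e₀) ∉ D.X := by
    rw [← deg_rim e₀ s Φp hΦp]; exact hp _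
  have h₂ : D.deg t + D.deg (D.dual (rimLab p σ e₀)) ∉ D.X := by
    rw [← flip_lab, ← deg_rim f₀ t Φq hΦq]; exact hq _
  refine (sum_mul_of_adjacent hpq e₀ f₀ hf₀ hΦq hΦ₁ σ'' σ h).trans
    (Eq.trans ?_ (sum_mul_of_adjacent hpq.symm f₀ e₀ he₀ hΦp hΦ₂ σ'' σ h.swap).symm)
  rw [Finset.sum_comm]
  refine congrArg₂ (· * ·) (congrArg₂ (· * ·) (mul_comm _ _) ?_)
    (Finset.sum_congr rfl fun b _ => Finset.sum_congr rfl fun a _ =>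
      congrArg₂ (· * ·) (mul_comm _ _) ?_)
  · rw [flip_lab σ'', D.d_dual]
  · rw [flip_lab σ, flip_lab σ'']
    exact D.edgeSum_comm _ _ _ _ _ _ _ _ _ _ _ _ _ _ _ _ _ _ _ _ h₁ h₂

theorem sum_plaquetteCoeff_mul_comm {p q : V} (hpq : p ≠ q) {s t : A}
    (hp : Φp.Admissible D.X) (hq : Φq.Admissible D.X)
    (hΦp : Φp = Φ.addPlaquette (D.deg s) p) (hΦq : Φq = Φ.addPlaquette (D.deg t) q)
    (hΦ₁ : Φ'' = Φq.addPlaquette (D.deg s) p) (hΦ₂ : Φ'' = Φp.addPlaquette (D.deg t) q)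
    (σ'' : LWState D Φ'') (σ : LWState D Φ) :
    ∑ ρ : LWState D Φq, plaquetteCoeff D p s σ'' ρ * plaquetteCoeff D q t ρ σ
      = ∑ ρ : LWState D Φp, plaquetteCoeff D q t σ'' ρ * plaquetteCoeff D p s ρ σ := by
  by_cases h : AgreeAway₂ p q σ'' σ
  swap
  · rw [sum_mul_eq_zero_of_not_agree h, sum_mul_eq_zero_of_not_agree fun h' => h h'.swap]
  by_cases hadj : ∀ e, S.src e = p → S.tgt e ≠ q
  · have hadj' : ∀ e, S.src e = q → S.tgt e ≠ p := fun e h1 h2 =>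
      hadj (S.opp e) (by rw [S.src_opp, h2]) (by rw [S.tgt_opp, h1])
    rw [sum_mul_of_not_adjacent hpq hadj hΦq hΦ₁ σ'' σ h,
      sum_mul_of_not_adjacent hpq.symm hadj' hΦp hΦ₂ σ'' σ h.swap, mul_comm]
  push Not at hadj
  obtain ⟨e, he, het⟩ := hadj
  exact sum_plaquetteCoeff_mul_comm_of_adjacent hpq ⟨e, he⟩ ⟨S.opp e, by rw [S.src_opp, het]⟩ rfl
    hp hq hΦp hΦq hΦ₁ hΦ₂ σ'' σ h

theorem plaquetteDegOp_comm {p q : V} (hpq : p ≠ q) {g h : G}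
    (hp : Φp.Admissible D.X) (hq : Φq.Admissible D.X)
    (hΦp : Φp = Φ.addPlaquette g p) (hΦq : Φq = Φ.addPlaquette h q)
    (hΦ : Φ'' = Φq.addPlaquette g p) :
    plaquetteDegOp D p g Φq Φ'' ∘ₗ plaquetteDegOp D q h Φ Φq
      = plaquetteDegOp D q h Φp Φ'' ∘ₗ plaquetteDegOp D p g Φ Φp := by
  simp only [plaquetteDegOp_eq, toEuclideanLin_comp]
  congr 1
  ext σ'' σ
  simp only [Matrix.mul_apply, degMatrix, Matrix.of_apply, Finset.sum_mul_sum]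
  have h1 : ∀ s ∈ D.I g, ∀ t ∈ D.I h, ∑ ρ : LWState D Φq,
      D.b s * plaquetteCoeff D p s σ'' ρ * (D.b t * plaquetteCoeff D q t ρ σ)
      = ∑ ρ : LWState D Φp,
      D.b t * plaquetteCoeff D q t σ'' ρ * (D.b s * plaquetteCoeff D p s ρ σ) := by
    intro s hs t ht
    rw [D.mem_I] at hs ht
    have key := sum_plaquetteCoeff_mul_comm hpq (s := s) (t := t) hp hq (by rwa [hs]) (by rwa [ht])
      (by rwa [hs]) (by rw [hΦ, hΦq, hΦp, ht, addPlaquette_comm]) σ'' σ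
    calc _ = D.b s * D.b t * ∑ ρ : LWState D Φq,
          plaquetteCoeff D p s σ'' ρ * plaquetteCoeff D q t ρ σ := by
          rw [Finset.mul_sum]
          exact Finset.sum_congr rfl fun ρ _ => by ring
      _ = _ := by
          rw [key, Finset.mul_sum]
          exact Finset.sum_congr rfl fun ρ _ => by ring
  calc _ = ∑ s ∈ D.I g, ∑ t ∈ D.I h, ∑ ρ : LWState D Φq,
        D.b s * plaquetteCoeff D p s σ'' ρ * (D.b t * plaquetteCoeff D q t ρ σ) :=
        Finset.sum_comm.trans (Finset.sum_congr rfl fun s _ => Finset.sum_comm)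
    _ = ∑ s ∈ D.I g, ∑ t ∈ D.I h, ∑ ρ : LWState D Φp,
        D.b t * plaquetteCoeff D q t σ'' ρ * (D.b s * plaquetteCoeff D p s ρ σ) :=
        Finset.sum_congr rfl fun s hs => Finset.sum_congr rfl fun t ht => h1 s hs t ht
    _ = _ := (Finset.sum_comm.trans ((Finset.sum_congr rfl fun t _ => Finset.sum_comm).trans
        Finset.sum_comm))

theorem plaquetteComp_comm_of_genericAt (hΦ : Φ.Admissible D.X) {p q : V} (hpq : p ≠ q) {g h : G}
    (hg : GenericAt D Φ p g) (hh : GenericAt D Φ q h)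
    (hh' : GenericAt D (Φ.addPlaquette (-g) p) q h) :
    plaquetteComp D Φ p g * plaquetteComp D Φ q h
      = plaquetteComp D Φ q h * plaquetteComp D Φ p g := by
  have cancel : ∀ (Ψ : GColoring S G) (k : G) (r : V),
      Ψ = (Ψ.addPlaquette (-k) r).addPlaquette k r := fun Ψ k r => by
    rw [addPlaquette_addPlaquette, neg_add_cancel, addPlaquette_zero]
  simp only [Module.End.mul_eq_comp, plaquetteComp]
  set P := Φ.addPlaquette (-g) p with hP
  set Q := Φ.addPlaquette (-h) q with hQ
  set R := P.addPlaquette (-h) q with hR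
  have hRQ : R = Q.addPlaquette (-g) p := by rw [hR, hP, hQ, addPlaquette_comm]
  have ePΦ : Φ = P.addPlaquette g p := cancel Φ g p
  have eQΦ : Φ = Q.addPlaquette h q := cancel Φ h q
  have eRP : P = R.addPlaquette h q := cancel P h q
  have eRQ : Q = R.addPlaquette g p := by rw [hRQ]; exact cancel Q g p
  have c₁ := plaquetteDegOp_comm (D := D) hpq (Φp := R) (Φq := Φ) (Φ'' := P) (Φ := Q) (g := -g)
    (h := h) hh'.2 hΦ hRQ eQΦ hP
  have c₂ := plaquetteDegOp_comm (D := D) hpq (Φp := Q) (Φq := P) (Φ'' := Φ) (Φ := R) (g := g)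
    (h := h) hh.2 hg.2 eRQ eRP ePΦ
  have c₃ := plaquetteDegOp_comm (D := D) hpq (Φp := P) (Φq := Q) (Φ'' := R) (Φ := Φ) (g := -g)
    (h := -h) hg.2 hh.2 hP hQ hRQ
  have c₄ := plaquetteDegOp_comm (D := D) hpq (Φp := Φ) (Φq := R) (Φ'' := Q) (Φ := P) (g := g)
    (h := -h) hΦ hh'.2 ePΦ hR eRQ
  refine LinearMap.ext fun ψ => ?_
  have c₁' := fun ψ => LinearMap.congr_fun c₁ ψ
  have c₂' := fun ψ => LinearMap.congr_fun c₂ ψ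
  have c₃' := fun ψ => LinearMap.congr_fun c₃ ψ
  have c₄' := fun ψ => LinearMap.congr_fun c₄ ψ
  simp only [LinearMap.comp_apply] at c₁' c₂' c₃' c₄' ⊢
  rw [c₁', c₂', c₃', c₄']

theorem plaquetteComp_comm (hΦ : Φ.Admissible D.X) (p q : V) {g h : G}
    (hg : GenericAt D Φ p g) (hh : GenericAt D Φ q h) :
    plaquetteComp D Φ p g * plaquetteComp D Φ q h
      = plaquetteComp D Φ q h * plaquetteComp D Φ p g := by
  by_cases hpq : p = q
  · subst hpq
    rw [plaquetteComp_eq hΦ p hg hh]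
  · obtain ⟨k, hk, hk', -⟩ := exists_genericAt₂ (D := D) hΦ hg.2 q 0 0
    rw [plaquetteComp_eq hΦ q hh hk]
    exact plaquetteComp_comm_of_genericAt hΦ hpq hg hk hk'

end LW

/-! ### Vertex operators and locality -/

namespace LW

variable {G : Type*} [AddCommGroup G] {A : Type*} {D : LWData ℂ G A}
  {V F : Type*} {S : TriangulatedSurface V F} {Φ : GColoring S G}
  [DecidableEq V] [Fintype F] [DecidableEq F]

omit [DecidableEq V] [DecidableEq F] in
theorem vertexOp_eq (t : F) : vertexOp D Φ t = Matrix.toEuclideanLin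
    (Matrix.diagonal fun σ : LWState D Φ => if 1 ≤ σ.br t then (1 : ℂ) else 0) := by
  unfold vertexOp
  simp only [LWState.br_le, and_true]

omit [DecidableEq V] [DecidableEq F] in
theorem vertexOp_mul_self (t : F) : vertexOp D Φ t * vertexOp D Φ t = vertexOp D Φ t := by
  rw [vertexOp_eq, Module.End.mul_eq_comp, toEuclideanLin_comp, Matrix.diagonal_mul_diagonal]
  simp

omit [DecidableEq V] [DecidableEq F] in
theorem vertexOp_comm (t t' : F) :
    vertexOp D Φ t * vertexOp D Φ t' = vertexOp D Φ t' * vertexOp D Φ t := by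
  simp only [vertexOp_eq, Module.End.mul_eq_comp, toEuclideanLin_comp,
    Matrix.diagonal_mul_diagonal, mul_comm]

/-- The matrix of `B_p^g B_p^{-g}`. -/
noncomputable def compMatrix (D : LWData ℂ G A) (Φ : GColoring S G) (p : V) (g : G) :
    Matrix (LWState D Φ) (LWState D Φ) ℂ :=
  degMatrix D p g (Φ.addPlaquette (-g) p) Φ * degMatrix D p (-g) Φ (Φ.addPlaquette (-g) p)

theorem plaquetteComp_eq_toEuclideanLin (p : V) (g : G) :
    plaquetteComp D Φ p g = Matrix.toEuclideanLin (compMatrix D Φ p g) := by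
  rw [plaquetteComp, plaquetteDegOp_eq, plaquetteDegOp_eq, toEuclideanLin_comp, compMatrix]

theorem exists_of_compMatrix_ne_zero {p : V} {g : G} {σ' σ : LWState D Φ}
    (h : compMatrix D Φ p g σ' σ ≠ 0) : ∃ (s s' : A)
      (ρ : LWState D (Φ.addPlaquette (-g) p)), plaquetteCoeff D p s σ' ρ ≠ 0 ∧
        plaquetteCoeff D p s' ρ σ ≠ 0 := by
  obtain ⟨ρ, -, hρ⟩ := Finset.exists_ne_zero_of_sum_ne_zero h
  obtain ⟨s, -, hs⟩ := Finset.exists_ne_zero_of_sum_ne_zero (left_ne_zero_of_mul hρ)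
  obtain ⟨s', -, hs'⟩ := Finset.exists_ne_zero_of_sum_ne_zero (right_ne_zero_of_mul hρ)
  exact ⟨s, s', ρ, right_ne_zero_of_mul hs, right_ne_zero_of_mul hs'⟩

theorem agreeAway_of_compMatrix_ne_zero {p : V} {g : G} {σ' σ : LWState D Φ}
    (h : compMatrix D Φ p g σ' σ ≠ 0) : AgreeAway p σ' σ := by
  obtain ⟨s, s', ρ, h1, h2⟩ := exists_of_compMatrix_ne_zero h
  exact (agreeAway_of_plaquetteCoeff_ne_zero h1).trans (agreeAway_of_plaquetteCoeff_ne_zero h2)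

theorem one_le_br_iff_of_compMatrix_ne_zero {p : V} {g : G} {σ' σ : LWState D Φ}
    (h : compMatrix D Φ p g σ' σ ≠ 0) (t : F) : 1 ≤ σ'.br t ↔ 1 ≤ σ.br t := by
  by_cases ht : ∀ i, S.vert t i ≠ p
  · rw [(agreeAway_of_compMatrix_ne_zero h).2 t ht]
  · push Not at ht
    obtain ⟨i, hi⟩ := ht
    obtain ⟨s, s', ρ, h1, h2⟩ := exists_of_compMatrix_ne_zero h
    exact iff_of_true (one_le_of_plaquetteCoeff_ne_zero h1 ⟨(t, i), hi⟩).2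
      (one_le_of_plaquetteCoeff_ne_zero h2 ⟨(t, i), hi⟩).1

theorem vertexOp_comm_plaquetteComp (t : F) (p : V) (g : G) :
    vertexOp D Φ t * plaquetteComp D Φ p g = plaquetteComp D Φ p g * vertexOp D Φ t := by
  rw [vertexOp_eq, plaquetteComp_eq_toEuclideanLin, Module.End.mul_eq_comp, Module.End.mul_eq_comp,
    toEuclideanLin_comp, toEuclideanLin_comp]
  congr 1
  ext σ' σ
  rw [Matrix.diagonal_mul, Matrix.mul_diagonal]
  by_cases h : compMatrix D Φ p g σ' σ = 0
  · rw [h, mul_zero, zero_mul]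
  · simp only [one_le_br_iff_of_compMatrix_ne_zero h, mul_comm]

omit [DecidableEq V] [Fintype F] in
theorem eq_of_agreeAt {R : Finset F} {σ τ τ' : LWState D Φ} (h1 : ∀ t ∉ R, AgreeAt D τ' τ t)
    (h2 : ∀ t ∈ R, AgreeAt D σ τ t) (h3 : ∀ t ∈ R, AgreeAt D σ τ' t) : τ' = τ := by
  have h : ∀ t, AgreeAt D τ' τ t := fun t => by
    by_cases ht : t ∈ R
    · exact ⟨(h3 t ht).1.symm.trans (h2 t ht).1, fun i => ((h3 t ht).2 i).symm.trans ((h2 t ht).2 i)⟩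
    · exact h1 t ht
  exact LWState.ext (funext fun e => (h e.1).2 e.2) (funext fun t => (h t).1)

omit [DecidableEq V] in
theorem supportedOn_one_sub {R : Finset F} {M : Matrix (LWState D Φ) (LWState D Φ) ℂ}
    (h₁ : ∀ σ σ', M σ' σ ≠ 0 → ∀ t ∉ R, AgreeAt D σ' σ t)
    (h₂ : ∀ σ σ' τ τ' : LWState D Φ,
      (∀ t ∉ R, AgreeAt D σ' σ t) → (∀ t ∉ R, AgreeAt D τ' τ t) →
      (∀ t ∈ R, AgreeAt D σ τ t) → (∀ t ∈ R, AgreeAt D σ' τ' t) → M σ' σ = M τ' τ) :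
    SupportedOn D R (1 - Matrix.toEuclideanLin M) := by
  classical
  have key : ∀ σ σ' : LWState D Φ, (1 - Matrix.toEuclideanLin M) (ket D σ) σ'
      = (if σ' = σ then 1 else 0) - M σ' σ := fun σ σ' => by
    rw [LinearMap.sub_apply, PiLp.sub_apply, ket, toEuclideanLin_single, Module.End.one_apply]
    simp
  refine ⟨fun σ σ' h => ?_, fun σ σ' τ τ' a1 a2 a3 a4 => ?_⟩
  · by_cases h' : σ' = σ
    · subst h'
      exact fun t _ => ⟨rfl, fun _ => rfl⟩
    · rw [key, if_neg h', zero_sub, neg_ne_zero] at h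
      exact h₁ σ σ' h
  · have : σ' = σ ↔ τ' = τ := by
      constructor
      · rintro rfl
        exact eq_of_agreeAt a2 a3 a4
      · rintro rfl
        exact eq_of_agreeAt a1 (fun t ht => ⟨(a3 t ht).1.symm, fun i => ((a3 t ht).2 i).symm⟩)
          (fun t ht => ⟨(a4 t ht).1.symm, fun i => ((a4 t ht).2 i).symm⟩)
    rw [key, key, h₂ σ σ' τ τ' a1 a2 a3 a4]
    simp only [this]

omit [DecidableEq V] in
theorem supportedOn_vertexOp (t : F) : SupportedOn D {t} (1 - vertexOp D Φ t) := by
  rw [vertexOp_eq]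
  refine supportedOn_one_sub (fun σ σ' h => ?_) fun σ σ' τ τ' a1 a2 a3 a4 => ?_
  · have : σ' = σ := of_not_not fun h' => h (Matrix.diagonal_apply_ne _ h')
    subst this
    exact fun t _ => ⟨rfl, fun _ => rfl⟩
  · by_cases h : σ' = σ
    · subst h
      have := eq_of_agreeAt a2 a3 a4
      subst this
      rw [Matrix.diagonal_apply_eq, Matrix.diagonal_apply_eq,
        (a3 t (Finset.mem_singleton_self t)).1]
    · have h' : τ' ≠ τ := by
        rintro rfl
        exact h (eq_of_agreeAt a1 (fun t ht => ⟨(a3 t ht).1.symm, fun i => ((a3 t ht).2 i).symm⟩)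
          (fun t ht => ⟨(a4 t ht).1.symm, fun i => ((a4 t ht).2 i).symm⟩))
      rw [Matrix.diagonal_apply_ne _ h, Matrix.diagonal_apply_ne _ h']

omit [DecidableEq V] [DecidableEq F] in
theorem not_mem_starFaces {p : V} {t : F} : t ∉ S.starFaces p ↔ ∀ i, S.vert t i ≠ p := by
  simp [TriangulatedSurface.starFaces]

omit [DecidableEq V] [DecidableEq F] in
theorem spoke_mem_starFaces {p : V} (e : S.Spoke p) : e.1.1 ∈ S.starFaces p :=
  of_not_not fun h => not_mem_starFaces.1 h e.1.2 e.2

omit [DecidableEq F] in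
/-- The triangles on the two sides of an edge do not have the same opposite vertex. -/
theorem opp_not_mem_starFaces {p : V} {e : F × Fin 3} (h1 : S.src e ≠ p) (h2 : S.tgt e ≠ p)
    (he : e.1 ∈ S.starFaces p) : (S.opp e).1 ∉ S.starFaces p := by
  intro h
  have third : ∀ e : F × Fin 3, S.src e ≠ p → S.tgt e ≠ p → e.1 ∈ S.starFaces p →
      S.vert e.1 (e.2 + 2) = p := by
    intro e h1 h2 he
    by_contra h3
    refine not_mem_starFaces.2 (fun j hj => ?_) he
    rcases Fin.three_cases e.2 j with rfl | rfl | rfl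
    · exact h1 hj
    · exact h2 hj
    · exact h3 hj
  have e1 := third e h1 h2 he
  have e2 := third (S.opp e) (by rwa [S.src_opp]) (by rwa [S.tgt_opp]) h
  have hr : ∀ e : F × Fin 3, Set.range (S.vert e.1) =
      {S.src e, S.tgt e, S.vert e.1 (e.2 + 2)} := by
    intro e
    ext x
    simp only [Set.mem_range, Set.mem_insert_iff, Set.mem_singleton_iff]
    constructor
    · rintro ⟨j, rfl⟩
      rcases Fin.three_cases e.2 j with rfl | rfl | rfl
      · exact Or.inl rfl
      · exact Or.inr (Or.inl rfl)
      · exact Or.inr (Or.inr rfl)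
    · rintro (rfl | rfl | rfl)
      · exact ⟨_, rfl⟩
      · exact ⟨_, rfl⟩
      · exact ⟨_, rfl⟩
  have hf : (S.opp e).1 = e.1 := S.face_ext _ _ (by
    rw [hr, hr, e1, e2, S.src_opp, S.tgt_opp, Set.insert_comm])
  have i1 : (S.opp e).2 = e.2 + 1 := S.vert_injective e.1 (by
    have := S.src_opp e
    rwa [TriangulatedSurface.src, hf] at this)
  have i2 : (S.opp e).2 + 1 = e.2 := S.vert_injective e.1 (by
    have := S.tgt_opp e
    rwa [TriangulatedSurface.tgt, hf] at this)
  have : ∀ i : Fin 3, i + 1 + 1 ≠ i := by decide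
  exact this e.2 (by rw [← i1, i2])

theorem agreeAway_of_agreeAt {p : V} {σ' σ : LWState D Φ}
    (h : ∀ t ∉ S.starFaces p, AgreeAt D σ' σ t) : AgreeAway p σ' σ := by
  refine ⟨fun e h1 h2 => ?_, fun t ht => (h t (not_mem_starFaces.2 ht)).1⟩
  by_cases he : e.1 ∈ S.starFaces p
  · have h3 := (h _ (opp_not_mem_starFaces h1 h2 he)).2 (S.opp e).2
    rw [Prod.mk.eta, σ'.lab_opp, σ.lab_opp] at h3
    exact D.dual_injective h3
  · exact (h _ he).2 e.2

open Classical in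
theorem compMatrix_eq (p : V) (g : G) (σ' σ : LWState D Φ) (h : AgreeAway p σ' σ) :
    compMatrix D Φ p g σ' σ = ∑ s ∈ D.I g, ∑ s' ∈ D.I (-g), D.b s * D.b s' *
      ∑ m ∈ Fintype.piFinset fun e : S.Spoke p => D.I ((Φ.addPlaquette (-g) p).val e.1),
        ∑ c ∈ Fintype.piFinset fun e => Finset.Icc 1
          (D.δ (m e) (legLab p σ e) (D.dual (m (S.nextPerm p e)))),
        D.ringCoeff (S.nextPerm p) (legLab p σ) s (rimLab p σ') m (rimBr p σ') c *
          D.ringCoeff (S.nextPerm p) (legLab p σ) s' m (rimLab p σ) c (rimBr p σ) := by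
  simp only [compMatrix, Matrix.mul_apply, degMatrix, Matrix.of_apply, Finset.sum_mul_sum]
  refine Finset.sum_comm.trans (Finset.sum_congr rfl fun s _ => Finset.sum_comm.trans
    (Finset.sum_congr rfl fun s' _ => ?_))
  have key := sum_plaquetteCoeff_mul (D := D) (Φ := Φ) (Φ' := Φ.addPlaquette (-g) p) p s s'
    (fun e h1 h2 => by simp [GColoring.addPlaquette, h1, h2]) σ' σ
  rw [if_pos h] at key
  rw [← key, Finset.mul_sum]
  exact Finset.sum_congr rfl fun ρ _ => by ring

theorem supportedOn_plaquetteComp (p : V) (g : G) :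
    SupportedOn D (S.starFaces p) (1 - plaquetteComp D Φ p g) := by
  rw [plaquetteComp_eq_toEuclideanLin]
  refine supportedOn_one_sub (fun σ σ' h t ht => ?_) fun σ σ' τ τ' a1 a2 a3 a4 => ?_
  · have h1 := agreeAway_of_compMatrix_ne_zero h
    rw [not_mem_starFaces] at ht
    exact ⟨h1.2 t ht, fun i => h1.1 _ (ht i) (ht (i + 1))⟩
  · have data : ∀ σ τ : LWState D Φ, (∀ t ∈ S.starFaces p, AgreeAt D σ τ t) →
        rimLab p σ = rimLab p τ ∧ legLab p σ = legLab p τ ∧ rimBr p σ = rimBr p τ :=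
      fun σ τ h => ⟨funext fun e => (h _ (spoke_mem_starFaces e)).2 _,
        funext fun e => (h _ (spoke_mem_starFaces e)).2 _,
        funext fun e => (h _ (spoke_mem_starFaces e)).1⟩
    obtain ⟨e1, e2, e3⟩ := data σ τ a3
    obtain ⟨e1', -, e3'⟩ := data σ' τ' a4
    rw [compMatrix_eq p g σ' σ (agreeAway_of_agreeAt a1),
      compMatrix_eq p g τ' τ (agreeAway_of_agreeAt a2), e1, e2, e3, e1', e3']

end LW

/-! ### The Hamiltonian -/

namespace LW

variable {G : Type*} [AddCommGroup G] {A : Type*} {D : LWData ℂ G A}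
  {V F : Type*} [Fintype V] [DecidableEq V] [Fintype F] [DecidableEq F]
  {S : TriangulatedSurface V F} {Φ : GColoring S G}

theorem plaquetteOp_eq (hΦ : Φ.Admissible D.X) (p : V) {g : G} (hg : GenericAt D Φ p g) :
    plaquetteOp D Φ hΦ p = plaquetteComp D Φ p g :=
  plaquetteComp_eq hΦ p (exists_genericAt D Φ hΦ p).choose_spec hg

/-- The summands `1 - B_p` and `1 - Q_v` of the Hamiltonian. -/
noncomputable def hamiltonianTerm (D : LWData ℂ G A) (Φ : GColoring S G)
    (hΦ : Φ.Admissible D.X) : V ⊕ F → Module.End ℂ (LWSpace D Φ) :=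
  Sum.elim (fun p => 1 - plaquetteOp D Φ hΦ p) fun t => 1 - vertexOp D Φ t

theorem sum_hamiltonianTerm (hΦ : Φ.Admissible D.X) :
    ∑ i, hamiltonianTerm D Φ hΦ i = hamiltonian D Φ hΦ :=
  Fintype.sum_sum_type _

theorem hamiltonianTerm_mul_self (hΦ : Φ.Admissible D.X) (i : V ⊕ F) :
    hamiltonianTerm D Φ hΦ i * hamiltonianTerm D Φ hΦ i = hamiltonianTerm D Φ hΦ i := by
  rcases i with p | t
  · exact IsIdempotentElem.one_sub
      (plaquetteComp_mul_self hΦ p (exists_genericAt D Φ hΦ p).choose_spec)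
  · exact IsIdempotentElem.one_sub (vertexOp_mul_self t)

theorem hamiltonianTerm_comm (hΦ : Φ.Admissible D.X) (i j : V ⊕ F) :
    hamiltonianTerm D Φ hΦ i * hamiltonianTerm D Φ hΦ j
      = hamiltonianTerm D Φ hΦ j * hamiltonianTerm D Φ hΦ i := by
  have h : ∀ x y : Module.End ℂ (LWSpace D Φ), x * y = y * x →
      (1 - x) * (1 - y) = (1 - y) * (1 - x) := fun x y hxy => by
    simp only [sub_mul, mul_sub, one_mul, mul_one, hxy]; abel
  rcases i with p | t <;> rcases j with q | u
  · exact h _ _ (plaquetteComp_comm hΦ p q (exists_genericAt D Φ hΦ p).choose_spec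
      (exists_genericAt D Φ hΦ q).choose_spec)
  · exact h _ _ (vertexOp_comm_plaquetteComp u p _).symm
  · exact h _ _ (vertexOp_comm_plaquetteComp t q _)
  · exact h _ _ (vertexOp_comm t u)

theorem isIndefHermitian_hamiltonian (hΦ : Φ.Admissible D.X) :
    IsIndefHermitian D (hamiltonian D Φ hΦ) :=
  isIndefHermitian_add
    (isIndefHermitian_sum _ _ fun p => isIndefHermitian_one_sub (isIndefHermitian_plaquetteComp p _))
    (isIndefHermitian_sum _ _ fun t => isIndefHermitian_one_sub (isIndefHermitian_vertexOp t))

theorem exists_nat_of_mem_spectrum_hamiltonian (hΦ : Φ.Admissible D.X) {z : ℂ}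
    (hz : z ∈ spectrum ℂ (hamiltonian D Φ hΦ)) : ∃ n : ℕ, z = n := by
  rw [← Module.End.hasEigenvalue_iff_mem_spectrum] at hz
  obtain ⟨v, hv⟩ := hz.exists_hasEigenvector
  have h := hv.apply_eq_smul
  rw [← sum_hamiltonianTerm] at h
  obtain ⟨n, hn, -⟩ := eigenvalue_sum_commuting_idempotents (hamiltonianTerm D Φ hΦ)
    (hamiltonianTerm_mul_self hΦ) (hamiltonianTerm_comm hΦ) z v hv.2 h
  exact ⟨n, hn⟩

omit [Fintype V] [DecidableEq V] [Fintype F] [DecidableEq F] in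
theorem hasSpectralGap_of_nat {T : Module.End ℂ (LWSpace D Φ)}
    (hT : ∀ z ∈ spectrum ℂ T, ∃ n : ℕ, z = n) : HasSpectralGap D T 1 := by
  intro x hx y hy hxy
  obtain ⟨m, rfl⟩ := hT x hx
  obtain ⟨n, rfl⟩ := hT y hy
  have hne : (m : ℤ) - n ≠ 0 := fun h => hxy (by exact_mod_cast sub_eq_zero.1 h)
  have h : ((m : ℂ) - n) = (((m : ℤ) - n : ℤ) : ℂ) := by push_cast; rfl
  rw [h, Complex.norm_intCast]
  exact_mod_cast Int.one_le_abs hne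

theorem eigenspace_hamiltonian_zero (hΦ : Φ.Admissible D.X) :
    Module.End.eigenspace (hamiltonian D Φ hΦ) 0 =
      (⨅ p, Module.End.eigenspace (plaquetteOp D Φ hΦ p) 1) ⊓
        ⨅ t, Module.End.eigenspace (vertexOp D Φ t) 1 := by
  have one_sub : ∀ (T : Module.End ℂ (LWSpace D Φ)) ψ, (1 - T) ψ = 0 ↔ T ψ = ψ := fun T ψ => by
    rw [LinearMap.sub_apply, Module.End.one_apply, sub_eq_zero, eq_comm]
  ext ψ
  simp only [Submodule.mem_inf, Submodule.mem_iInf, Module.End.mem_eigenspace_iff, zero_smul,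
    one_smul]
  constructor
  · intro h
    rw [← sum_hamiltonianTerm] at h
    have h' := sum_commuting_idempotents_apply_eq_zero (hamiltonianTerm D Φ hΦ)
      (hamiltonianTerm_mul_self hΦ) (hamiltonianTerm_comm hΦ) ψ h
    exact ⟨fun p => (one_sub _ ψ).1 (h' (Sum.inl p)), fun t => (one_sub _ ψ).1 (h' (Sum.inr t))⟩
  · rintro ⟨h1, h2⟩
    rw [hamiltonian, LinearMap.add_apply, LinearMap.sum_apply, LinearMap.sum_apply,
      Finset.sum_eq_zero fun p _ => (one_sub _ ψ).2 (h1 p),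
      Finset.sum_eq_zero fun t _ => (one_sub _ ψ).2 (h2 t), add_zero]

end LW

theorem mainTheorem9 {G : Type*} [AddCommGroup G] {A : Type*} (D : LWData ℂ G A)
    {V F : Type*} [Fintype V] [DecidableEq V] [Fintype F] [DecidableEq F]
    (S : TriangulatedSurface V F) (Φ : GColoring S G) (hΦ : Φ.Admissible D.X) :
    -- the operators `B_p = B_p^g B_p^{-g}` do not depend on the choice of `g`
    (∀ p g, LW.GenericAt D Φ p g → LW.plaquetteOp D Φ hΦ p = LW.plaquetteComp D Φ p g) ∧
    -- `H` is Hermitian for the indefinite inner product, and pseudo-Hermitian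
    LW.IsIndefHermitian D (LW.hamiltonian D Φ hΦ) ∧
    LW.IsPseudoHermitian D (LW.hamiltonian D Φ hΦ) ∧
    -- `H` is local
    (∀ p, LW.SupportedOn D (S.starFaces p) (1 - LW.plaquetteOp D Φ hΦ p)) ∧
    (∀ t, LW.SupportedOn D {t} (1 - LW.vertexOp D Φ t)) ∧
    -- `H` is gapped, uniformly in the data
    LW.HasSpectralGap D (LW.hamiltonian D Φ hΦ) 1 ∧
    -- the spectrum of `H`, and its space of ground states, of energy zero
    (∀ z ∈ spectrum ℂ (LW.hamiltonian D Φ hΦ), ∃ n : ℕ, z = n) ∧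
    Module.End.eigenspace (LW.hamiltonian D Φ hΦ) 0 =
      (⨅ p, Module.End.eigenspace (LW.plaquetteOp D Φ hΦ p) 1) ⊓
        ⨅ t, Module.End.eigenspace (LW.vertexOp D Φ t) 1 :=
  ⟨fun p _ hg => LW.plaquetteOp_eq hΦ p hg, LW.isIndefHermitian_hamiltonian hΦ,
    (LW.isIndefHermitian_hamiltonian hΦ).isPseudoHermitian,
    fun p => LW.supportedOn_plaquetteComp p _, fun t => LW.supportedOn_vertexOp t,
    LW.hasSpectralGap_of_nat fun _ => LW.exists_nat_of_mem_spectrum_hamiltonian hΦ,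
    fun _ => LW.exists_nat_of_mem_spectrum_hamiltonian hΦ, LW.eigenspace_hamiltonian_zero hΦ⟩
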